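/- Let $p$ be a prime. For a unital ring $R$ and $a\in R$ let $\langle a\rangle_1=\{q(a): q\in\mathbb Z[x]\}$ be the unital subring generated by $a$. The unital compressed commuting graph $\Lambda^1(R)$ is the undirected graph (with loops) whose vertices are the subrings $\langle a\rangle_1$, $a\in R$, where $\langle a\rangle_1$ and $\langle b\rangle_1$ are adjacent if and only if $ab=ba$. For $R=\mathcal M_3(\mathrm{GF}(p))$, a matrix $A$ with characteristic polynomial $p_A$ and minimal polynomial $m_A$ is of type (A) if $p_A=(x-\lambda)^3$, $m_A=x-\lambda$; (B) if $p_A=(x-\lambda)(x-\mu)^2$, $m_A=(x-\lambda)(x-\mu)$; (C) if $p_A=m_A=(x-\lambda)(x-\mu)(x-\nu)$; (D) if $p_A=m_A=(x-\lambda)^3$; (E) if $p_A=(x-\lambda)^3$, $m_A=(x-\lambda)^2$; (F) if $p_A=m_A=(x-\lambda)^2(x-\mu)$; (G) if $p_A=m_A$ is irreducible; (H) if $p_A=m_A=(x-\lambda)p_1(x)$ with $p_1$ irreducible; here $\lambda,\mu,\nu\in\mathrm{GF}(p)$ are pairwise distinct. Let $T_p$ be the $0$-$1$ matrix of order $1+p+p^2$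 $$T_p=\begin{bmatrix}1&e^T&0&0&\cdots&0\\ e&0&R_1&R_2&\cdots&R_p\\ 0&R_1^T&I_p&I_p&\cdots&I_p\\ 0&R_2^T&S_{2,1}&S_{2,2}&\cdots&S_{2,p}\\ \vdots&\vdots&\vdots&\vdots&\ddots&\vdots\\ 0&R_p^T&S_{p,1}&S_{p,2}&\cdots&S_{p,p}\end{bmatrix},$$ where $e$ is the all-ones vector of length $p$, $R_s$ is the $p\times p$ matrix whose $s$-th row consists of ones and whose other entries are $0$, and $(S_{s,t})_{i,j}=1$ if $(s-1)(i+j)\equiv t \pmod p$ and $0$ otherwise ($1\le i,j\le p$). Construct a graph $\mathcal G_p$ as follows. 1. Take the entries (positions) of $T_p$ as vertices; the zeros are the vertices of type (B), the ones are the vertices of type (E). Connect two different ones if and only if they lie in the same row or in the same column. Connect two zeros, or a zero and a one, if and only if they lie in different rows and different columns and the other two entries of the $2\times2$ submatrix containing them are both equal to $1$. 2. If $p\ge3$, then for every triangle of vertices of type (B) add one vertex of type (C) and connect it to the three vertices of the triangle. If $p=2$, skip this step. 3. For every edge between a vertex of type (B) and a vertex of type (E) add one vertex of type (F) and connect it to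 both endpoints. 4. For every vertex of type (B) add $\frac{p(p-1)}2$ vertices of type (H) and connect them to it. 5. For every vertex of type (E) add $p-1$ vertices of type (D) and connect them to it. 6. Add $\frac13(p^3-p)(p^3-p^2)$ vertices of type (G). 7. Add one vertex of type (A) and connect it to every other vertex. 8. Put a loop on every vertex. Then the rows of $T_p$ can be labelled bijectively by the points $P_i$ ($1$-dimensional subspaces of $\mathrm{GF}(p)^3$) and its columns by the lines $L_j$ ($2$-dimensional subspaces) of the projective plane $\mathrm{PG}(2,p)$, and there is a graph isomorphism $\varphi\colon\Lambda^1(\mathcal M_3(\mathrm{GF}(p)))\to\mathcal G_p$, such that: - $T_p$ is the incidence matrix of $\mathrm{PG}(2,p)$: $(T_p)_{i,j}=1$ if $P_i\subset L_j$, and $(T_p)_{i,j}=0$ otherwise; - for every matrix $A$ and every $\mathrm X\in\{\mathrm A,\dots,\mathrm H\}$, $A$ is of type (X) if and only if $\varphi(\langle A\rangle_1)$ is of type (X); - if $A$ is a matrix with image $P_i$ and kernel $L_j$, then $\varphi(\langle A\rangle_1)$ is the entry $(i,j)$ of $T_p$. -/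

import Mathlib

open Polynomial

/-! ### Undirected graphs with loops and the unital compressed commuting graph -/

/-- An undirected graph without multiple edges in which loops are allowed. -/
structure LoopGraph (V : Type*) where
  Adj : V → V → Prop
  symm : ∀ u v, Adj u v → Adj v u

/-- Put a loop on every vertex of a simple graph. -/
def LoopGraph.withLoops {V : Type*} (G : SimpleGraph V) : LoopGraph V where
  Adj u v := u = v ∨ G.Adj u v
  symm := by
    rintro u v (h | h)
    · exact Or.inl h.symm
    · exact Or.inr h.symm

/-- The vertices of the unital compressed commuting graph of `R`: the unital subrings of `R`
generated by one element. -/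
def UCCVertex (R : Type*) [Ring R] : Type _ :=
  {S : Subring R // ∃ a : R, S = Subring.closure {a}}

/-- The vertex `⟨a⟩₁`. -/
def UCCVertex.gen {R : Type*} [Ring R] (a : R) : UCCVertex R :=
  ⟨Subring.closure {a}, a, rfl⟩

/-- The unital subring generated by `a` consists of the values `q(a)`, `q ∈ ℤ[x]`. -/
theorem mem_closure_singleton_iff_aeval {R : Type*} [Ring R] (a x : R) :
    x ∈ Subring.closure {a} ↔ ∃ q : ℤ[X], x = aeval a q := by
  constructor
  · intro hx
    induction hx using Subring.closure_induction with
    | mem y hy => exact ⟨X, by simpa using hy⟩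
    | zero => exact ⟨0, by simp⟩
    | one => exact ⟨1, by simp⟩
    | add y z _ _ hy hz =>
      obtain ⟨q, rfl⟩ := hy
      obtain ⟨r, rfl⟩ := hz
      exact ⟨q + r, by simp⟩
    | neg y _ hy =>
      obtain ⟨q, rfl⟩ := hy
      exact ⟨-q, by simp⟩
    | mul y z _ _ hy hz =>
      obtain ⟨q, rfl⟩ := hy
      obtain ⟨r, rfl⟩ := hz
      exact ⟨q * r, by simp⟩
  · rintro ⟨q, rfl⟩
    induction q using Polynomial.induction_on' with
    | add q r hq hr => simpa using add_mem hq hr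
    | monomial n c =>
      rw [aeval_monomial]
      simpa using mul_mem (intCast_mem (Subring.closure {a}) c)
        (pow_mem (Subring.subset_closure (Set.mem_singleton a)) n)

/-- The unital compressed commuting graph `Λ¹(R)`: two vertices are adjacent when their
generators commute (the choice of the generators is immaterial, see `uccGraph_adj_gen`). -/
def uccGraph (R : Type*) [Ring R] : LoopGraph (UCCVertex R) where
  Adj u v := ∃ a b : R, u = UCCVertex.gen a ∧ v = UCCVertex.gen b ∧ a * b = b * a
  symm := by
    rintro u v ⟨a, b, hu, hv, h⟩
    exact ⟨b, a, hv, hu, h.symm⟩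

theorem uccGraph_adj_gen {R : Type*} [Ring R] (a b : R) :
    (uccGraph R).Adj (UCCVertex.gen a) (UCCVertex.gen b) ↔ a * b = b * a := by
  constructor
  · rintro ⟨c, d, hc, hd, h⟩
    have hc' : Subring.closure {a} = Subring.closure {c} := congrArg Subtype.val hc
    have hd' : Subring.closure {b} = Subring.closure {d} := congrArg Subtype.val hd
    have ha : a ∈ Subring.closure {c} := hc' ▸ Subring.subset_closure (Set.mem_singleton a)
    have hb : b ∈ Subring.closure {d} := hd' ▸ Subring.subset_closure (Set.mem_singleton b)
    have h1 : c ∈ Subring.centralizer {d} := by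
      rw [Subring.mem_centralizer_iff]
      rintro g rfl
      exact h.symm
    have h2 : Subring.closure {c} ≤ Subring.centralizer {d} := by
      rw [Subring.closure_le]
      rintro x rfl
      exact h1
    have h3 : d ∈ Subring.centralizer {a} := by
      rw [Subring.mem_centralizer_iff]
      rintro g rfl
      exact ((Subring.mem_centralizer_iff.1 (h2 ha)) d rfl).symm
    have h4 : Subring.closure {d} ≤ Subring.centralizer {a} := by
      rw [Subring.closure_le]
      rintro x rfl
      exact h3
    exact (Subring.mem_centralizer_iff.1 (h4 hb)) a rfl
  · intro h
    exact ⟨a, b, rfl, rfl, h⟩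

/-! ### Types of `3 × 3` matrices -/

/-- The names of the eight types of matrices and of vertices. -/
inductive VType
  | A | B | C | D | E | F | G | H
  deriving DecidableEq

/-- The type of a `3 × 3` matrix, by its characteristic and minimal polynomials. -/
def Matrix.IsOfType {K : Type*} [Field K] (M : Matrix (Fin 3) (Fin 3) K) : VType → Prop
  | .A => ∃ a : K, M.charpoly = (X - C a) ^ 3 ∧ minpoly K M = X - C a
  | .B => ∃ a b : K, a ≠ b ∧ M.charpoly = (X - C a) * (X - C b) ^ 2 ∧
      minpoly K M = (X - C a) * (X - C b)
  | .C => ∃ a b c : K, a ≠ b ∧ a ≠ c ∧ b ≠ c ∧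
      M.charpoly = (X - C a) * (X - C b) * (X - C c) ∧
      minpoly K M = (X - C a) * (X - C b) * (X - C c)
  | .D => ∃ a : K, M.charpoly = (X - C a) ^ 3 ∧ minpoly K M = (X - C a) ^ 3
  | .E => ∃ a : K, M.charpoly = (X - C a) ^ 3 ∧ minpoly K M = (X - C a) ^ 2
  | .F => ∃ a b : K, a ≠ b ∧ M.charpoly = (X - C a) ^ 2 * (X - C b) ∧
      minpoly K M = (X - C a) ^ 2 * (X - C b)
  | .G => Irreducible M.charpoly ∧ minpoly K M = M.charpoly
  | .H => ∃ (a : K) (q : K[X]), Irreducible q ∧ M.charpoly = (X - C a) * q ∧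
      minpoly K M = (X - C a) * q

/-! ### The matrix `T_p`

Rows and columns are indexed by blocks of sizes `1`, `p` and `p` times `p`. An element `i : Fin p`
stands for the index `i + 1` of `{1, …, p}`. -/

/-- The index set of the rows and of the columns of `T_p`, of size `1 + p + p²`. -/
abbrev PGIdx (p : ℕ) : Type := Unit ⊕ Fin p ⊕ Fin p × Fin p

/-- The matrix `R_s`: its `s`-th row consists of ones, all other entries are zero. -/
def blockR {p : ℕ} (s : Fin p) : Matrix (Fin p) (Fin p) ℕ :=
  Matrix.of fun i _ => if i = s then 1 else 0

/-- The matrix `S_{s,t}`, `2 ≤ s`: the entry `(i, j)` is one when `(s - 1)(i + j) ≡ t mod p`. -/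
def blockS {p : ℕ} (s t : Fin p) : Matrix (Fin p) (Fin p) ℕ :=
  Matrix.of fun i j =>
    if (s : ℕ) * (((i : ℕ) + 1) + ((j : ℕ) + 1)) ≡ (t : ℕ) + 1 [MOD p] then 1 else 0

/-- The 0-1 matrix `T_p`. The blocks of the first row of blocks of the `p × p` array of blocks are
identity matrices, the other ones are the `S_{s,t}`. -/
def incMatrix (p : ℕ) : Matrix (PGIdx p) (PGIdx p) ℕ :=
  Matrix.of fun
  | .inl _, .inl _ => 1
  | .inl _, .inr (.inl _) => 1
  | .inl _, .inr (.inr _) => 0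
  | .inr (.inl _), .inl _ => 1
  | .inr (.inl _), .inr (.inl _) => 0
  | .inr (.inl i), .inr (.inr (t, j)) => blockR t i j
  | .inr (.inr _), .inl _ => 0
  | .inr (.inr (s, i)), .inr (.inl j) => (blockR s).transpose i j
  | .inr (.inr (s, i)), .inr (.inr (t, j)) =>
      if (s : ℕ) = 0 then (1 : Matrix (Fin p) (Fin p) ℕ) i j else blockS s t i j

/-! ### The constructed graph -/

/-- The positions of the entries of `T_p`. -/
abbrev PGEntry (p : ℕ) : Type := PGIdx p × PGIdx p

/-- Entries of `T_p` which are zero, i.e. vertices of type (B). -/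
def IsB {p : ℕ} (x : PGEntry p) : Prop := incMatrix p x.1 x.2 = 0

/-- Entries of `T_p` which are one, i.e. vertices of type (E). -/
def IsE {p : ℕ} (x : PGEntry p) : Prop := incMatrix p x.1 x.2 = 1

/-- The (B)–(E) graph, without its loops, on the entries of `T_p`. Two different entries that are
equal to one are adjacent when they lie in the same row or in the same column. Two entries of which
at least one is zero are adjacent when they lie in different rows and columns and the other two
entries of the `2 × 2` submatrix that they span are equal to one. -/
def beGraph (p : ℕ) : SimpleGraph (PGEntry p) where
  Adj x y := x ≠ y ∧
    ((IsE x ∧ IsE y ∧ (x.1 = y.1 ∨ x.2 = y.2)) ∨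
      ((IsB x ∨ IsB y) ∧ x.1 ≠ y.1 ∧ x.2 ≠ y.2 ∧ IsE (x.1, y.2) ∧ IsE (y.1, x.2)))
  symm := ⟨by
    rintro x y ⟨hne, h | h⟩
    · exact ⟨hne.symm, Or.inl ⟨h.2.1, h.1, h.2.2.imp Eq.symm Eq.symm⟩⟩
    · exact ⟨hne.symm, Or.inr ⟨h.1.symm, h.2.1.symm, h.2.2.1.symm, h.2.2.2.2, h.2.2.2.1⟩⟩⟩
  loopless := ⟨fun _ h => h.1 rfl⟩

/-- The vertices of the constructed graph. -/
inductive PGVertex (p : ℕ) : Type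
  /-- the entries of `T_p`: vertices of types (B) and (E) -/
  | entry (x : PGEntry p)
  /-- for `p ≥ 3`, one vertex for every triangle of vertices of type (B) -/
  | typeC (hp : 3 ≤ p) (t : Finset (PGEntry p)) (ht : (beGraph p).IsNClique 3 t)
      (hB : ∀ x ∈ t, IsB x)
  /-- one vertex for every edge between a vertex `b` of type (B) and a vertex `e` of type (E) -/
  | typeF (b e : PGEntry p) (hb : IsB b) (he : IsE e) (hbe : (beGraph p).Adj b e)
  /-- `p(p-1)/2` vertices for every vertex of type (B) -/
  | typeH (b : PGEntry p) (hb : IsB b) (k : Fin (p * (p - 1) / 2))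
  /-- `p-1` vertices for every vertex of type (E) -/
  | typeD (e : PGEntry p) (he : IsE e) (k : Fin (p - 1))
  /-- `(p³-p)(p³-p²)/3` further vertices -/
  | typeG (k : Fin ((p ^ 3 - p) * (p ^ 3 - p ^ 2) / 3))
  /-- one further vertex -/
  | typeA

/-- The edges that are drawn in the construction, up to orientation and without the loops. -/
inductive PGVertex.Joined {p : ℕ} : PGVertex p → PGVertex p → Prop
  | be (x y : PGEntry p) : (beGraph p).Adj x y → Joined (.entry x) (.entry y)
  | triangle (hp t ht hB) (x : PGEntry p) : x ∈ t → Joined (.typeC hp t ht hB) (.entry x)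
  | edgeB (b e hb he hbe) : Joined (.typeF b e hb he hbe) (.entry b)
  | edgeE (b e hb he hbe) : Joined (.typeF b e hb he hbe) (.entry e)
  | pendantH (b hb k) : Joined (.typeH b hb k) (.entry b)
  | pendantD (e he k) : Joined (.typeD e he k) (.entry e)
  | universal (v : PGVertex p) : v ≠ .typeA → Joined .typeA v

/-- The constructed graph: the edges above, and a loop on every vertex. -/
def constructedGraph (p : ℕ) : LoopGraph (PGVertex p) :=
  LoopGraph.withLoops (SimpleGraph.fromRel PGVertex.Joined)

/-- The type of a vertex of the constructed graph. -/
def PGVertex.vtype {p : ℕ} : PGVertex p → VType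
  | .entry x => if incMatrix p x.1 x.2 = 0 then .B else .E
  | .typeC _ _ _ _ => .C
  | .typeF _ _ _ _ _ => .F
  | .typeH _ _ _ => .H
  | .typeD _ _ _ => .D
  | .typeG _ => .G
  | .typeA => .A

/-! ### The projective plane `PG(2,p)` -/

/-- The points of the projective plane over `K`. -/
abbrev PGPoint (K : Type*) [Field K] : Type _ :=
  {P : Submodule K (Fin 3 → K) // Module.finrank K P = 1}

/-- The lines of the projective plane over `K`. -/
abbrev PGLine (K : Type*) [Field K] : Type _ :=
  {L : Submodule K (Fin 3 → K) // Module.finrank K L = 2}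

/-!
The isomorphism is obtained from an invariant of vertices with values in
`ℕ × Finset (PGEntry p)`, called `key`, that both graphs share.

Over `GF(p)` the ring `⟨M⟩₁` is the algebra `K[M]`, whose dimension is the degree of the minimal
polynomial of `M`. In dimension one there is only the algebra of scalars. In dimension two, `M` is
a scalar plus a matrix of rank one (`Matrix.exists_eq_smul_one_add_of_natDegree_eq_two`), so the
vertex is generated by a matrix of rank one. Up to scalars, such a matrix is given by its image and
its kernel, a point and a line of the projective plane; with the coordinates `pointVec` and
`lineVec`, in which `T_p` is the incidence matrix (`incMatrix_eq`), these matrices are the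
`entryMatrix x`, `x` an entry of `T_p`. The matrix is nilpotent or a multiple of an idempotent
according to whether the point lies on the line, and two of them commute exactly when the entries
are equal or adjacent in `beGraph` (`beGraph_adj_iff`). In dimension three, `K[M]` is its own
centralizer (`Matrix.mem_adjoin_of_commute`), so that the neighbours of `K[M]` are its subalgebras:
itself, the scalars, and the algebras generated by its elements of rank one. Up to scalars, these
elements are the `(m / (X - t))(M)`, where `t` runs through the roots of the minimal polynomial `m`
(`Matrix.exists_eq_smul_aeval_of_mul_eq_smul`, `Matrix.rank_aeval_eq_one`), nilpotent if `t` is a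
multiple root and idempotent up to a scalar if it is a simple root
(`IsEigenEntry.isE_iff_eval_eq_zero`).

The `key` of a vertex consists of the dimension and of the entries `x` whose `entryMatrix x` lies
in the algebra. For vertices of the constructed graph it is defined by what the vertices are meant
to represent. In both graphs it determines the adjacency of different vertices, by the same rule
`KeyAdj` (`uccGraph_adj_iff`, `constructedGraph_adj_iff`), and it determines the type
(`exists_key_eq_and_isOfType`, `PGVertex.vtype_eq_of_key_eq`). Therefore any bijection between the
two vertex sets that respects `key` is an isomorphism that respects the types, and it maps
`⟨entryMatrix x⟩₁` to the entry `x`, the only vertex with its `key`. Such a bijection exists as soon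
as the fibres of `key` in the two graphs have the same cardinalities (`card_fibre_eq`). The fibre of
a triangle of zeros, or of an edge between a zero and a one, is a single algebra, generated by a
suitable combination of the matrices of rank one (`exists_unique_key_eq_triangle`,
`exists_unique_key_eq_pair`). The cubic algebras with exactly one or with no line of matrices of
rank one are counted by normal forms: conjugation reduces to a standard idempotent or nilpotent,
each algebra has a unique normalized generator, and the normalized generators correspond to the
quadratic polynomials without roots, to the nonzero scalars, and to the cubic polynomials without
roots together with a vector (`card_cubicSubalgebrasOver_vecMulVec_of_ne`,
`card_cubicSubalgebrasOver_vecMulVec_of_eq`, `card_cubicSubalgebrasOverNone`).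
-/

open Matrix Module

/-! ### Matrices of rank one and commutative matrix algebras -/

theorem Matrix.rank_eq_one_iff_exists_vecMulVec {K m n : Type*} [Field K] [Fintype m] [Fintype n]
    [DecidableEq n] {X : Matrix m n K} :
    X.rank = 1 ↔ ∃ u f, u ≠ 0 ∧ f ≠ 0 ∧ X = vecMulVec u f := by
  constructor
  · intro h
    have h' : finrank K (LinearMap.range X.mulVecLin) = 1 := h
    obtain ⟨⟨u, hu⟩, hu0, hspan⟩ := finrank_eq_one_iff'.1 h'
    have hcol : ∀ j, ∃ c : K, c • u = X.col j := by
      intro j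
      obtain ⟨c, hc⟩ := hspan ⟨X.col j, ⟨Pi.single j 1, by simp⟩⟩
      exact ⟨c, congrArg Subtype.val hc⟩
    choose f hf using hcol
    have hX : X = vecMulVec u f := by
      ext i j
      have := congrFun (hf j) i
      simp only [Pi.smul_apply, smul_eq_mul, col_apply] at this
      rw [vecMulVec_apply, ← this, mul_comm]
    refine ⟨u, f, fun h0 => hu0 (Subtype.ext h0), ?_, hX⟩
    rintro rfl
    rw [hX, show vecMulVec u (0 : n → K) = 0 by ext; simp [vecMulVec_apply], rank_zero] at h
    exact zero_ne_one h
  · rintro ⟨u, f, hu, hf, rfl⟩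
    refine le_antisymm (rank_vecMulVec_le _ _) (Nat.one_le_iff_ne_zero.2 fun h => ?_)
    have h1 : finrank K (LinearMap.range (vecMulVec u f).mulVecLin) = 0 := h
    rw [Submodule.finrank_eq_zero, LinearMap.range_eq_bot] at h1
    obtain ⟨i, hi⟩ := Function.ne_iff.1 hu
    obtain ⟨j, hj⟩ := Function.ne_iff.1 hf
    have := congrFun (LinearMap.congr_fun h1 (Pi.single j 1)) i
    simp [vecMulVec_apply] at this
    tauto

theorem finrank_adjoin_singleton_eq_natDegree_minpoly {K A : Type*} [Field K] [Ring A] [Algebra K A]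
    (a : A) :
    finrank K (Algebra.adjoin K {a}) = (minpoly K a).natDegree := by
  have e1 := (Ideal.quotientKerEquivRange (aeval (R := K) a)).toLinearEquiv.finrank_eq
  have e2 := (Ideal.quotientEquivAlgOfEq K
    (minpoly.ker_aeval_eq_span_minpoly K a)).toLinearEquiv.finrank_eq
  rw [Algebra.adjoin_singleton_eq_range_aeval, ← e1, e2, finrank_quotient_span_eq_natDegree]

/-- A vector whose annihilator in `K[X]` is generated by the minimal polynomial separates the
elements of `K[M]`. It exists because `K^n` is a torsion module over the principal ideal domain
`K[X]`. -/
theorem Matrix.exists_mulVec_injOn_adjoin {K n : Type*} [Field K] [Fintype n] [DecidableEq n]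
    (M : Matrix n n K) :
    ∃ v : n → K, ∀ Y ∈ Algebra.adjoin K {M}, Y *ᵥ v = 0 → Y = 0 := by
  obtain ⟨x, hx⟩ := exists_ker_toSpanSingleton_eq_annihilator K[X]
    (AEval' (toLin' M))
  obtain ⟨v, rfl⟩ := (AEval'.of _).surjective x
  refine ⟨v, fun Y hY h => ?_⟩
  rw [Algebra.adjoin_singleton_eq_range_aeval] at hY
  obtain ⟨q, rfl⟩ := hY
  rw [← span_minpoly_eq_annihilator, minpoly_toLin'] at hx
  have h2 : q ∈ LinearMap.ker (LinearMap.toSpanSingleton K[X] _ (AEval'.of (toLin' M) v)) := by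
    rw [LinearMap.mem_ker, LinearMap.toSpanSingleton_apply, ← AEval.of_aeval_smul]
    have h3 : aeval (toLin' M) q = toLin' (aeval M q) :=
      aeval_algHom_apply (Matrix.toLinAlgEquiv' : Matrix n n K ≃ₐ[K] _) M q
    rw [h3, Module.End.smul_def, toLin'_apply]
    exact (AEval'.of _).map_eq_zero_iff.2 h
  rw [hx, Ideal.mem_span_singleton] at h2
  exact (minpoly.dvd_iff).1 h2

/-- A matrix whose minimal polynomial has full degree generates its own centralizer: evaluation at
a cyclic vector identifies both with the whole space. -/
theorem Matrix.mem_adjoin_of_commute {K n : Type*} [Field K] [Fintype n] [DecidableEq n]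
    {M X : Matrix n n K} (hM : (minpoly K M).natDegree = Fintype.card n) (h : X * M = M * X) :
    X ∈ Algebra.adjoin K {M} := by
  obtain ⟨v, hv⟩ := M.exists_mulVec_injOn_adjoin
  let e : Algebra.adjoin K {M} →ₗ[K] (n → K) :=
    { toFun := fun Y => Y.1 *ᵥ v
      map_add' := fun Y Z => add_mulVec _ _ _
      map_smul' := fun c Y => smul_mulVec _ _ _ }
  have hinj : Function.Injective e := by
    rw [← LinearMap.ker_eq_bot, LinearMap.ker_eq_bot']
    exact fun Y hY => Subtype.ext (hv Y.1 Y.2 hY)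
  have hsurj : Function.Surjective e := by
    refine (LinearMap.injective_iff_surjective_of_finrank_eq_finrank ?_).1 hinj
    rw [finrank_adjoin_singleton_eq_natDegree_minpoly, hM,
      finrank_fintype_fun_eq_card]
  have hcomm : ∀ Z ∈ Algebra.adjoin K {M}, ∀ Y, Y * M = M * Y → Y * Z = Z * Y := by
    intro Z hZ Y hY
    have : Algebra.adjoin K {M} ≤ Subalgebra.centralizer K {Y} := by
      rw [Algebra.adjoin_le_iff]
      rintro _ rfl
      rw [SetLike.mem_coe, Subalgebra.mem_centralizer_iff]
      rintro _ rfl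
      exact hY
    exact (Subalgebra.mem_centralizer_iff K).1 (this hZ) Y rfl
  obtain ⟨Y, hY⟩ := hsurj (X *ᵥ v)
  have hYM : Y.1 * M = M * Y.1 :=
    (hcomm Y.1 Y.2 M rfl).symm
  have : X = Y.1 := by
    rw [← sub_eq_zero]
    refine Matrix.ext_of_mulVec_single fun i => ?_
    obtain ⟨Z, hZ⟩ := hsurj (Pi.single i 1)
    change Z.1 *ᵥ v = _ at hZ
    change Y.1 *ᵥ v = _ at hY
    rw [← hZ, mulVec_mulVec, hcomm Z.1 Z.2 _ (by rw [sub_mul, mul_sub, h, hYM]), ← mulVec_mulVec,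
      sub_mulVec, hY]
    simp
  exact this ▸ Y.2

theorem Matrix.commute_of_mem_adjoin {K n : Type*} [Field K] [Fintype n] [DecidableEq n]
    {M X Y : Matrix n n K} (hX : X ∈ Algebra.adjoin K {M}) (hY : Y ∈ Algebra.adjoin K {M}) :
    X * Y = Y * X := by
  rw [Algebra.adjoin_singleton_eq_range_aeval] at hX hY
  obtain ⟨q, rfl⟩ := hX
  obtain ⟨r, rfl⟩ := hY
  change aeval M q * aeval M r = aeval M r * aeval M q
  rw [← map_mul, mul_comm, map_mul]

theorem Matrix.minpoly_eq_charpoly_of_natDegree {K n : Type*} [Field K] [Fintype n] [DecidableEq n]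
    {M : Matrix n n K} (hM : (minpoly K M).natDegree = Fintype.card n) :
    minpoly K M = M.charpoly :=
  (Polynomial.eq_of_monic_of_dvd_of_natDegree_le (minpoly.monic (Matrix.isIntegral M))
    M.charpoly_monic (Matrix.minpoly_dvd_charpoly M)
    (by rw [hM, M.charpoly_natDegree_eq_dim])).symm

theorem Algebra.adjoin_singleton_smul_one_add_smul {K A : Type*} [Field K] [Ring A] [Algebra K A]
    (a : A) (s : K) {t : K} (ht : t ≠ 0) :
    Algebra.adjoin K {s • 1 + t • a} = Algebra.adjoin K {a} := by
  apply le_antisymm <;> rw [Algebra.adjoin_le_iff, Set.singleton_subset_iff]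
  · exact add_mem (Subalgebra.smul_mem _ (one_mem _) _)
      (Subalgebra.smul_mem _ (Algebra.self_mem_adjoin_singleton K a) _)
  · have h : a = t⁻¹ • ((s • 1 + t • a) - s • 1) := by
      rw [add_sub_cancel_left, smul_smul, inv_mul_cancel₀ ht, one_smul]
    have h2 := Subalgebra.smul_mem _ (sub_mem (Algebra.self_mem_adjoin_singleton K (s • 1 + t • a))
      (Subalgebra.smul_mem _ (one_mem _) s)) t⁻¹
    rwa [← h] at h2

section Three

variable {K : Type*} [Field K] {M X : Matrix (Fin 3) (Fin 3) K}

theorem Matrix.exists_mul_self_eq_smul_of_rank_eq_one {n : Type*} [Fintype n] [DecidableEq n]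
    {R : Matrix n n K} (h : R.rank = 1) : ∃ c : K, R * R = c • R := by
  obtain ⟨u, f, -, -, rfl⟩ := rank_eq_one_iff_exists_vecMulVec.1 h
  exact ⟨f ⬝ᵥ u, by rw [vecMulVec_mul_vecMulVec, vecMulVec_smul]⟩

theorem Matrix.rank_ne_zero {m n : Type*} [Fintype m] [Fintype n] [DecidableEq n]
    {R : Matrix m n K} (h : R ≠ 0) : R.rank ≠ 0 := by
  intro h0
  have h1 : finrank K (LinearMap.range R.mulVecLin) = 0 := h0
  rw [Submodule.finrank_eq_zero, LinearMap.range_eq_bot] at h1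
  refine h (Matrix.ext_of_mulVec_single fun i => ?_)
  rw [zero_mulVec]
  exact LinearMap.congr_fun h1 (Pi.single i 1)

theorem Matrix.exists_mul_eq_smul_of_rank_eq_one {n : Type*} [Fintype n] [DecidableEq n]
    {M X : Matrix n n K} (hX : X.rank = 1) (h : X * M = M * X) : ∃ a : K, M * X = a • X := by
  obtain ⟨u, f, hu, hf, rfl⟩ := rank_eq_one_iff_exists_vecMulVec.1 hX
  rw [vecMulVec_mul, mul_vecMulVec] at h
  obtain ⟨i, hi⟩ := Function.ne_iff.1 hf
  refine ⟨(f ᵥ* M) i * (f i)⁻¹, ?_⟩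
  rw [mul_vecMulVec, ← smul_vecMulVec]
  congr 1
  ext j
  have h1 : u j * (f ᵥ* M) i = (M *ᵥ u) j * f i := congrFun (congrFun h j) i
  simp only [Pi.smul_apply, smul_eq_mul]
  field_simp [show f i ≠ 0 from hi]
  linear_combination -h1

/-- The cofactor `d(a)` of a root `x` of the minimal polynomial of `a` is an eigenvector, with
eigenvalue `q(x)`, for the multiplication by any `q(a)`. -/
theorem aeval_mul_aeval_of_minpoly_eq {A : Type*} [Ring A] [Algebra K A] {a : A} {x : K}
    {d : K[X]} (h : minpoly K a = (Polynomial.X - C x) * d) (q : K[X]) :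
    aeval a q * aeval a d = q.eval x • aeval a d := by
  obtain ⟨r, hr⟩ := X_sub_C_dvd_sub_C_eval (p := q) (a := x)
  have h1 : q * d = minpoly K a * r + C (q.eval x) * d := by
    rw [h]
    linear_combination d * hr
  rw [← map_mul, h1, map_add, map_mul, minpoly.aeval, zero_mul, zero_add, map_mul, aeval_C,
    Algebra.smul_def]

/-- The rank-one elements of `K[M]`, for `M` with minimal polynomial `m` of degree three, are up to
scalars the values at `M` of the cofactors `m / (X - a)`, `a` a root of `m`. -/
theorem Matrix.exists_eq_smul_aeval_of_mul_eq_smul (hM : (minpoly K M).natDegree = 3)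
    (hX : X ∈ Algebra.adjoin K {M}) (hX0 : X ≠ 0) {a : K} (ha : M * X = a • X) :
    ∃ (d : K[X]) (c : K), c ≠ 0 ∧ minpoly K M = (Polynomial.X - C a) * d ∧
      X = c • aeval M d := by
  have hmon := minpoly.monic (Matrix.isIntegral M (R := K))
  rw [Algebra.adjoin_singleton_eq_range_aeval] at hX
  obtain ⟨q, hq⟩ := hX
  change aeval M q = X at hq
  set r := q %ₘ minpoly K M with hr
  have hrX : aeval M r = X := by
    rw [hr, modByMonic_eq_sub_mul_div _, map_sub, map_mul, minpoly.aeval, zero_mul, sub_zero, hq]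
  have hr0 : r ≠ 0 := by
    intro h
    rw [h, map_zero] at hrX
    exact hX0 hrX.symm
  have hdeg : r.natDegree < 3 := by
    rw [← hM]
    exact natDegree_modByMonic_lt _ hmon (by intro h; rw [h] at hM; simp at hM)
  have hdvd : minpoly K M ∣ (Polynomial.X - C a) * r := by
    apply minpoly.dvd
    rw [map_mul, hrX, map_sub, aeval_X, aeval_C, sub_mul, ha, Algebra.algebraMap_eq_smul_one,
      smul_mul_assoc, one_mul, sub_self]
  obtain ⟨s, hs⟩ := hdvd
  have hne : (Polynomial.X - C a) * r ≠ 0 := mul_ne_zero (X_sub_C_ne_zero a) hr0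
  have hs0 : s ≠ 0 := by rintro rfl; exact hne (by rw [hs, mul_zero])
  have hsd : s.natDegree = 0 := by
    have := congrArg natDegree hs
    rw [natDegree_mul (X_sub_C_ne_zero a) hr0, natDegree_mul hmon.ne_zero hs0,
      natDegree_X_sub_C, hM] at this
    omega
  obtain ⟨c, rfl⟩ := natDegree_eq_zero.1 hsd
  have hc : c ≠ 0 := by rintro rfl; simp at hs0
  have hcc : (C c⁻¹ * C c : K[X]) = 1 := by rw [← C_mul, inv_mul_cancel₀ hc, C_1]
  refine ⟨C c⁻¹ * r, c, hc, ?_, ?_⟩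
  · linear_combination (-minpoly K M) * hcc - C c⁻¹ * hs
  · rw [map_mul, aeval_C, hrX, ← Algebra.smul_def, smul_smul, mul_inv_cancel₀ hc, one_smul]

/-- The product `(M - a) d(M)` vanishes, and `M - a` has rank at least two: the square of a matrix
of rank one is proportional to it, so rank one would give a quadratic polynomial vanishing at `M`.
-/
theorem Matrix.rank_aeval_eq_one (hM : (minpoly K M).natDegree = 3) {a : K} {d : K[X]}
    (h : minpoly K M = (Polynomial.X - C a) * d) : (aeval M d).rank = 1 := by
  have hmon := minpoly.monic (Matrix.isIntegral M (R := K))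
  have hd0 : d ≠ 0 := by rintro rfl; rw [h] at hM; simp at hM
  have hd : d.natDegree = 2 := by
    rw [h, natDegree_mul (X_sub_C_ne_zero a) hd0, natDegree_X_sub_C] at hM
    omega
  have hlow : ∀ q : K[X], q ≠ 0 → q.natDegree ≤ 2 → aeval M q ≠ 0 := by
    intro q hq hq2 h0
    have := natDegree_le_of_dvd (minpoly.dvd K M h0) hq
    omega
  have h0 : aeval M d ≠ 0 := hlow d hd0 hd.le
  have hprod : (aeval M (Polynomial.X - C a)) * aeval M d = 0 := by
    rw [← map_mul, ← h, minpoly.aeval]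
  have hsum := rank_add_rank_le_card_of_mul_eq_zero hprod
  have h1 := rank_ne_zero h0
  have h2 := rank_ne_zero (hlow (Polynomial.X - C a) (X_sub_C_ne_zero a) (by simp))
  have h3 : (aeval M (Polynomial.X - C a)).rank ≠ 1 := by
    intro hr
    obtain ⟨c, hc⟩ := exists_mul_self_eq_smul_of_rank_eq_one hr
    refine hlow ((Polynomial.X - C a) * (Polynomial.X - C a - C c)) ?_ ?_ ?_
    · rw [sub_sub, ← C_add]
      exact mul_ne_zero (X_sub_C_ne_zero _) (X_sub_C_ne_zero _)
    · rw [sub_sub, ← C_add, natDegree_mul (X_sub_C_ne_zero _) (X_sub_C_ne_zero _),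
        natDegree_X_sub_C, natDegree_X_sub_C]
    · rw [mul_sub, map_sub, map_mul, hc, map_mul, aeval_C, ← Algebra.commutes, ← Algebra.smul_def,
        sub_self]
  simp only [Fintype.card_fin] at hsum
  omega

theorem Matrix.natDegree_minpoly_le (M : Matrix (Fin 3) (Fin 3) K) :
    (minpoly K M).natDegree ≤ 3 := by
  have := natDegree_le_of_dvd (Matrix.minpoly_dvd_charpoly M) M.charpoly_monic.ne_zero
  rwa [M.charpoly_natDegree_eq_dim, Fintype.card_fin] at this

/-- If `m(a) ≠ 0`, then `m(M) - m(a) = -m(a)` would be an invertible multiple of `M - a`. -/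
theorem Matrix.eval_minpoly_eq_zero_of_eval_charpoly {n : Type*} [Fintype n] [DecidableEq n]
    {M : Matrix n n K} {a : K} (h : M.charpoly.eval a = 0) : (minpoly K M).eval a = 0 := by
  by_contra hne
  obtain ⟨r, hr⟩ := X_sub_C_dvd_sub_C_eval (p := minpoly K M) (a := a)
  have h1 := congrArg (aeval M) hr
  rw [map_sub, minpoly.aeval, map_mul, map_sub, aeval_X, aeval_C, aeval_C, zero_sub] at h1
  have h2 := congrArg det h1
  rw [det_mul, ← neg_sub (algebraMap K (Matrix n n K) a), det_neg, det_neg,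
    algebraMap_eq_diagonal (R := K)] at h2
  have h3 : (algebraMap K (Matrix n n K) a - M).det = 0 := by
    rw [← h, eval_charpoly]; rfl
  rw [h3] at h2
  simp [hne] at h2

/-- A `3 × 3` matrix with quadratic minimal polynomial is a scalar plus a matrix of rank one. -/
theorem Matrix.exists_eq_smul_one_add_of_natDegree_eq_two (hM : (minpoly K M).natDegree = 2) :
    ∃ (c : K) (R : Matrix (Fin 3) (Fin 3) K), R.rank = 1 ∧ M = c • 1 + R := by
  have hmon := minpoly.monic (Matrix.isIntegral M (R := K))
  obtain ⟨l, hl⟩ := Matrix.minpoly_dvd_charpoly M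
  have hlm : l.Monic := hmon.of_mul_monic_left (hl ▸ M.charpoly_monic)
  have hl1 : l.natDegree = 1 := by
    have := M.charpoly_natDegree_eq_dim
    rw [hl, hmon.natDegree_mul hlm, hM, Fintype.card_fin] at this
    omega
  obtain ⟨a, rfl⟩ : ∃ a, l = Polynomial.X - C a :=
    ⟨-l.coeff 0, by rw [hlm.eq_X_add_C hl1]; simp⟩
  have hroot := Matrix.eval_minpoly_eq_zero_of_eval_charpoly (M := M) (a := a) (by rw [hl]; simp)
  obtain ⟨r, hr⟩ := dvd_iff_isRoot.2 hroot
  have hrm : r.Monic := (monic_X_sub_C a).of_mul_monic_left (hr ▸ hmon)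
  have hr1 : r.natDegree = 1 := by
    rw [hr, (monic_X_sub_C a).natDegree_mul hrm, natDegree_X_sub_C] at hM
    omega
  obtain ⟨b, rfl⟩ : ∃ a, r = Polynomial.X - C a :=
    ⟨-r.coeff 0, by rw [hrm.eq_X_add_C hr1]; simp⟩
  have hprod : (M - a • 1) * (M - b • 1) = 0 := by
    have := minpoly.aeval K M
    rw [hr] at this
    simpa [Algebra.algebraMap_eq_smul_one] using this
  have hsum := rank_add_rank_le_card_of_mul_eq_zero hprod
  have hne : ∀ c : K, (M - c • 1).rank ≠ 0 := by
    intro c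
    refine rank_ne_zero fun h0 => ?_
    have : aeval M (Polynomial.X - C c) = 0 := by
      simpa [Algebra.algebraMap_eq_smul_one] using h0
    have := natDegree_le_of_dvd (minpoly.dvd K M this) (X_sub_C_ne_zero c)
    rw [natDegree_X_sub_C] at this
    omega
  have ha := hne a
  have hb := hne b
  rw [Fintype.card_fin] at hsum
  rcases (show (M - a • 1).rank = 1 ∨ (M - b • 1).rank = 1 by omega) with h | h
  · exact ⟨a, _, h, by abel⟩
  · exact ⟨b, _, h, by abel⟩

theorem Matrix.exists_eq_smul_one_of_natDegree_eq_one {n : Type*} [Fintype n] [DecidableEq n]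
    {M : Matrix n n K} (hM : (minpoly K M).natDegree = 1) :
    ∃ c : K, M = c • 1 := by
  have hmon := minpoly.monic (Matrix.isIntegral M (R := K))
  refine ⟨-(minpoly K M).coeff 0, ?_⟩
  have := minpoly.aeval K M
  rw [hmon.eq_X_add_C hM] at this
  simp [Algebra.algebraMap_eq_smul_one] at this
  rw [neg_smul, eq_neg_iff_add_eq_zero, this]

theorem Matrix.mem_adjoin_iff_of_rank_eq_one {n : Type*} [Fintype n] [DecidableEq n]
    {R X : Matrix n n K} (hR : R.rank = 1) :
    X ∈ Algebra.adjoin K {R} ↔ ∃ s t : K, X = s • 1 + t • R := by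
  obtain ⟨c, hc⟩ := exists_mul_self_eq_smul_of_rank_eq_one hR
  constructor
  · intro hX
    induction hX using Algebra.adjoin_induction with
    | mem y hy => exact ⟨0, 1, by simp_all⟩
    | algebraMap r => exact ⟨r, 0, by simp [Algebra.algebraMap_eq_smul_one]⟩
    | add y z _ _ hy hz =>
      obtain ⟨s, t, rfl⟩ := hy
      obtain ⟨s', t', rfl⟩ := hz
      exact ⟨s + s', t + t', by module⟩
    | mul y z _ _ hy hz =>
      obtain ⟨s, t, rfl⟩ := hy
      obtain ⟨s', t', rfl⟩ := hz
      refine ⟨s * s', s * t' + t * s' + t * t' * c, ?_⟩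
      simp only [add_mul, mul_add, smul_mul_smul_comm, one_mul, mul_one, hc]
      module
  · rintro ⟨s, t, rfl⟩
    exact add_mem (Subalgebra.smul_mem _ (one_mem _) _)
      (Subalgebra.smul_mem _ (Algebra.self_mem_adjoin_singleton K R) _)

theorem Matrix.eq_smul_of_mem_adjoin_of_rank_eq_one {R X : Matrix (Fin 3) (Fin 3) K}
    (hR : R.rank = 1) (hX : X.rank = 1) (h : X ∈ Algebra.adjoin K {R}) :
    ∃ t : K, X = t • R := by
  obtain ⟨s, t, rfl⟩ := (mem_adjoin_iff_of_rank_eq_one hR).1 h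
  refine ⟨t, ?_⟩
  by_cases hs : s = 0
  · simp [hs]
  exfalso
  -- every vector would lie in the sum of the images of the two matrices of rank one
  have htop : (⊤ : Submodule K (Fin 3 → K)) ≤
      LinearMap.range (s • 1 + t • R).mulVecLin ⊔ LinearMap.range R.mulVecLin := by
    intro w _
    have hw : w = s⁻¹ • ((s • 1 + t • R) *ᵥ w) + (-(s⁻¹ * t)) • (R *ᵥ w) := by
      rw [add_mulVec, smul_mulVec, smul_mulVec, one_mulVec, smul_add, smul_smul, smul_smul,
        inv_mul_cancel₀ hs]
      module
    rw [hw]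
    exact add_mem (Submodule.smul_mem _ _ (Submodule.mem_sup_left ⟨w, rfl⟩))
      (Submodule.smul_mem _ _ (Submodule.mem_sup_right ⟨w, rfl⟩))
  have h1 := Submodule.finrank_mono htop
  have h2 := Submodule.finrank_add_le_finrank_add_finrank
    (LinearMap.range (s • 1 + t • R).mulVecLin) (LinearMap.range R.mulVecLin)
  change _ ≤ (s • 1 + t • R).rank + R.rank at h2
  rw [finrank_top, finrank_fintype_fun_eq_card, Fintype.card_fin] at h1
  omega

theorem Matrix.natDegree_minpoly_of_rank_eq_one {R : Matrix (Fin 3) (Fin 3) K}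
    (hR : R.rank = 1) : (minpoly K R).natDegree = 2 := by
  obtain ⟨c, hc⟩ := exists_mul_self_eq_smul_of_rank_eq_one hR
  have h1 : minpoly K R ∣ Polynomial.X * (Polynomial.X - C c) := by
    apply minpoly.dvd
    rw [map_mul, map_sub, aeval_X, aeval_C, mul_sub, hc, ← Algebra.commutes, ← Algebra.smul_def,
      sub_self]
  have h2 := natDegree_le_of_dvd h1 (mul_ne_zero X_ne_zero (X_sub_C_ne_zero c))
  rw [natDegree_mul X_ne_zero (X_sub_C_ne_zero c), natDegree_X, natDegree_X_sub_C] at h2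
  have h3 := minpoly.natDegree_pos (Matrix.isIntegral R (R := K))
  have h4 : (minpoly K R).natDegree ≠ 1 := by
    intro h
    obtain ⟨s, rfl⟩ := exists_eq_smul_one_of_natDegree_eq_one h
    by_cases hs : s = 0
    · simp [hs] at hR
    · rw [rank_of_det_ne_zero (by simp [hs]), Fintype.card_fin] at hR
      omega
  omega

end Three

/-! ### Monic polynomials without roots over a finite field -/

/-- The monic polynomials of degree `n`. -/
def monicsOfDegree (K : Type*) [Field K] (n : ℕ) : Set K[X] :=
  {f | f.Monic ∧ f.natDegree = n}

theorem card_monicsOfDegree (K : Type*) [Field K] [Fintype K] (n : ℕ) :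
    Nat.card (monicsOfDegree K n) = Fintype.card K ^ n := by
  have e1 : monicsOfDegree K n ≃ (Fin n → K) :=
    (Equiv.setCongr (by ext f; rfl)).trans ((monicEquivDegreeLT n).trans (degreeLTEquiv K n).toEquiv)
  rw [Nat.card_congr e1]
  simp

instance (K : Type*) [Field K] [Fintype K] (n : ℕ) : Finite (monicsOfDegree K n) :=
  Nat.finite_of_card_ne_zero (by rw [card_monicsOfDegree]; positivity)

/-- The polynomials with the prescribed roots `T` are the multiples of `∏ t ∈ T, (X - t)`. -/
theorem card_monicsOfDegree_forall_isRoot (K : Type*) [Field K] [Fintype K] {n : ℕ} (T : Finset K)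
    (hT : T.card ≤ n) :
    Nat.card {f : monicsOfDegree K n // ∀ t ∈ T, f.1.IsRoot t} =
      Fintype.card K ^ (n - T.card) := by
  set P : K[X] := ∏ t ∈ T, (Polynomial.X - C t) with hP
  have hPm : P.Monic := monic_prod_X_sub_C _ _
  have hPd : P.natDegree = T.card := by simp [hP]
  have hPdvd : ∀ f : K[X], P ∣ f ↔ ∀ t ∈ T, f.IsRoot t := by
    intro f
    rw [hP]
    constructor
    · intro h t ht
      exact dvd_iff_isRoot.1
        ((Finset.dvd_prod_of_mem (fun t => (Polynomial.X - C t : K[X])) ht).trans h)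
    · intro h
      exact Finset.prod_dvd_of_coprime
        (fun a _ b _ hab => isCoprime_X_sub_C_of_isUnit_sub (sub_ne_zero.2 hab).isUnit)
        (fun t ht => dvd_iff_isRoot.2 (h t ht))
  rw [← card_monicsOfDegree]
  refine (Nat.card_congr (Equiv.ofBijective
    (fun g : monicsOfDegree K (n - T.card) =>
      (⟨⟨P * g.1, hPm.mul g.2.1, ?_⟩, ?_⟩ :
        {f : monicsOfDegree K n // ∀ t ∈ T, f.1.IsRoot t})) ⟨?_, ?_⟩)).symm
  · rw [hPm.natDegree_mul g.2.1, hPd, g.2.2]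
    omega
  · exact (hPdvd _).1 (dvd_mul_right _ _)
  · intro g h hgh
    exact Subtype.ext (mul_left_cancel₀ hPm.ne_zero (congrArg (fun z => z.1.1) hgh))
  · rintro ⟨⟨f, hfm, hfd⟩, hf⟩
    obtain ⟨g, rfl⟩ := (hPdvd f).2 hf
    have hgm := hPm.of_mul_monic_left hfm
    rw [hPm.natDegree_mul hgm, hPd] at hfd
    exact ⟨⟨g, hgm, by omega⟩, rfl⟩

/-- Inclusion-exclusion over the sets of prescribed roots. -/
theorem card_monicsOfDegree_forall_not_isRoot (K : Type*) [Field K] [Fintype K] (n : ℕ) :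
    (Nat.card {f : monicsOfDegree K n // ∀ t, ¬ f.1.IsRoot t} : ℤ) =
      ∑ k ∈ Finset.range (n + 1),
        (-1) ^ k * (Fintype.card K).choose k * (Fintype.card K : ℤ) ^ (n - k) := by
  classical
  have := Fintype.ofFinite (monicsOfDegree K n)
  have hroots : ∀ (f : monicsOfDegree K n) (t : K), t ∈ f.1.roots.toFinset ↔ f.1.IsRoot t := by
    intro f t
    rw [Multiset.mem_toFinset, mem_roots f.2.1.ne_zero]
  have h1 : (Nat.card {f : monicsOfDegree K n // ∀ t, ¬ f.1.IsRoot t} : ℤ) =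
      ∑ f : monicsOfDegree K n, ∑ T ∈ f.1.roots.toFinset.powerset, (-1 : ℤ) ^ T.card := by
    simp_rw [Finset.sum_powerset_neg_one_pow_card]
    rw [Nat.card_eq_fintype_card, Fintype.card_subtype, Finset.sum_boole]
    congr 2
    ext f
    simp only [Finset.mem_filter, Finset.mem_univ, true_and, Finset.eq_empty_iff_forall_notMem,
      hroots]
  have h2 : ∀ f : monicsOfDegree K n,
      ∑ T ∈ f.1.roots.toFinset.powerset, (-1 : ℤ) ^ T.card =
        ∑ k ∈ Finset.range (n + 1), ∑ T ∈ (Finset.univ : Finset K).powersetCard k,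
          if ∀ t ∈ T, f.1.IsRoot t then (-1 : ℤ) ^ k else 0 := by
    intro f
    have hmaps : ∀ T ∈ f.1.roots.toFinset.powerset, T.card ∈ Finset.range (n + 1) := by
      intro T hT
      have h3 := Finset.card_le_card (Finset.mem_powerset.1 hT)
      have h4 := f.1.roots.toFinset_card_le.trans f.1.card_roots'
      rw [f.2.2] at h4
      rw [Finset.mem_range]
      omega
    rw [← Finset.sum_fiberwise_of_maps_to hmaps]
    refine Finset.sum_congr rfl fun k _ => ?_
    rw [← Finset.sum_filter]
    refine Finset.sum_congr ?_ fun T hT => ?_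
    · ext T
      simp only [Finset.mem_filter, Finset.mem_powerset, Finset.mem_powersetCard,
        Finset.subset_univ, true_and, ← hroots]
      exact and_comm
    · rw [(Finset.mem_powersetCard.1 (Finset.mem_filter.1 hT).1).2]
  rw [h1, Finset.sum_congr rfl fun f _ => h2 f, Finset.sum_comm]
  refine Finset.sum_congr rfl fun k hk => ?_
  rw [Finset.sum_comm]
  have h3 : ∀ T ∈ (Finset.univ : Finset K).powersetCard k,
      (∑ f : monicsOfDegree K n, if ∀ t ∈ T, f.1.IsRoot t then (-1 : ℤ) ^ k else 0) =
        (-1) ^ k * (Fintype.card K : ℤ) ^ (n - k) := by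
    intro T hT
    rw [Finset.mem_powersetCard] at hT
    have := card_monicsOfDegree_forall_isRoot K (n := n) T
      (by rw [hT.2]; exact Nat.lt_succ_iff.1 (Finset.mem_range.1 hk))
    rw [Nat.card_eq_fintype_card, Fintype.card_subtype, hT.2] at this
    rw [← Finset.sum_filter, Finset.sum_const, this, nsmul_eq_mul]
    push_cast
    ring
  rw [Finset.sum_congr rfl h3, Finset.sum_const, Finset.card_powersetCard, nsmul_eq_mul,
    Finset.card_univ]
  ring

theorem card_monic_quadratic_forall_not_isRoot (K : Type*) [Field K] [Fintype K] :
    Nat.card {f : monicsOfDegree K 2 // ∀ t, ¬ f.1.IsRoot t} =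
      Fintype.card K * (Fintype.card K - 1) / 2 := by
  have h := card_monicsOfDegree_forall_not_isRoot K 2
  have h2 := Nat.choose_two_right (Fintype.card K)
  simp only [Finset.sum_range_succ, Finset.sum_range_zero] at h
  rw [← h2]
  zify
  rw [h]
  simp
  ring

theorem card_monic_cubic_forall_not_isRoot (K : Type*) [Field K] [Fintype K] :
    3 * Nat.card {f : monicsOfDegree K 3 // ∀ t, ¬ f.1.IsRoot t} =
      Fintype.card K ^ 3 - Fintype.card K := by
  have h := card_monicsOfDegree_forall_not_isRoot K 3
  obtain ⟨q, hq⟩ : ∃ q, Fintype.card K = q + 1 + 1 :=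
    ⟨Fintype.card K - 2, by have := Fintype.one_lt_card (α := K); omega⟩
  have h3 : 6 * ((q + 1 + 1).choose 3 : ℤ) = (q + 2) * (q + 1) * q := by
    have := Nat.descFactorial_eq_factorial_mul_choose (q + 1 + 1) 3
    simp [Nat.descFactorial, Nat.factorial] at this
    zify at this
    rw [← this]
    ring
  have h4 : 2 * ((q + 1 + 1).choose 2 : ℤ) = (q + 2) * (q + 1) := by
    have := Nat.descFactorial_eq_factorial_mul_choose (q + 1 + 1) 2
    simp [Nat.descFactorial, Nat.factorial] at this
    zify at this
    rw [← this]
    ring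
  simp only [Finset.sum_range_succ, Finset.sum_range_zero] at h
  rw [hq] at h ⊢
  have h5 : q + 1 + 1 ≤ (q + 1 + 1) ^ 3 := Nat.le_self_pow (by norm_num) _
  zify [h5]
  rw [h]
  simp
  have : ∀ a b : ℤ, 6 * a = 6 * b → a = b := fun a b h => by linarith
  apply this
  linear_combination 9 * (q + 1 + 1) * h4 - 3 * h3

/-! ### Cubic monogenic subalgebras and their elements of rank one -/

section Cubic

variable {K : Type*} [Field K]

/-- The three-dimensional subalgebras of `M₃(K)` that are generated by one element. -/
def cubicSubalgebras (K : Type*) [Field K] : Set (Subalgebra K (Matrix (Fin 3) (Fin 3) K)) :=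
  {W | ∃ M, (minpoly K M).natDegree = 3 ∧ W = Algebra.adjoin K {M}}

/-- The cubic monogenic subalgebras whose elements of rank one are the nonzero multiples of `R`. -/
def cubicSubalgebrasOver (R : Matrix (Fin 3) (Fin 3) K) :
    Set (Subalgebra K (Matrix (Fin 3) (Fin 3) K)) :=
  {W | W ∈ cubicSubalgebras K ∧ R ∈ W ∧ ∀ X ∈ W, X.rank = 1 → ∃ t : K, X = t • R}

/-- The cubic monogenic subalgebras without elements of rank one. -/
def cubicSubalgebrasOverNone (K : Type*) [Field K] :
    Set (Subalgebra K (Matrix (Fin 3) (Fin 3) K)) :=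
  {W | W ∈ cubicSubalgebras K ∧ ∀ X ∈ W, X.rank ≠ 1}

theorem finrank_of_mem_cubicSubalgebras {W : Subalgebra K (Matrix (Fin 3) (Fin 3) K)}
    (hW : W ∈ cubicSubalgebras K) : finrank K W = 3 := by
  obtain ⟨M, hM, rfl⟩ := hW
  rw [finrank_adjoin_singleton_eq_natDegree_minpoly, hM]

theorem eq_adjoin_of_mem_cubicSubalgebras {W : Subalgebra K (Matrix (Fin 3) (Fin 3) K)}
    (hW : W ∈ cubicSubalgebras K) {N : Matrix (Fin 3) (Fin 3) K} (hN : N ∈ W)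
    (h : (minpoly K N).natDegree = 3) : W = Algebra.adjoin K {N} := by
  have hle : Algebra.adjoin K {N} ≤ W := by
    rw [Algebra.adjoin_le_iff, Set.singleton_subset_iff]
    exact hN
  symm
  refine Subalgebra.eq_of_le_of_finrank_eq hle ?_
  rw [finrank_adjoin_singleton_eq_natDegree_minpoly, h, finrank_of_mem_cubicSubalgebras hW]

theorem Matrix.natDegree_minpoly_eq_three_or (N : Matrix (Fin 3) (Fin 3) K) :
    (minpoly K N).natDegree = 3 ∨ (∃ c : K, N = c • 1) ∨
      ∃ (c : K) (R : Matrix (Fin 3) (Fin 3) K), R.rank = 1 ∧ N = c • 1 + R := by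
  have h1 := N.natDegree_minpoly_le
  have h2 := minpoly.natDegree_pos (Matrix.isIntegral N (R := K))
  rcases (show (minpoly K N).natDegree = 1 ∨ (minpoly K N).natDegree = 2 ∨
    (minpoly K N).natDegree = 3 by omega) with h | h | h
  · exact Or.inr (Or.inl (exists_eq_smul_one_of_natDegree_eq_one h))
  · exact Or.inr (Or.inr (exists_eq_smul_one_add_of_natDegree_eq_two h))
  · exact Or.inl h

theorem Matrix.mul_apply_eq_of_rank_eq_one {m n : Type*} [Fintype m] [Fintype n] [DecidableEq n]
    {R : Matrix m n K} (h : R.rank = 1) (i j k l) : R i j * R k l = R i l * R k j := by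
  obtain ⟨u, f, -, -, rfl⟩ := rank_eq_one_iff_exists_vecMulVec.1 h
  simp only [vecMulVec_apply]
  ring

/-- A nonvanishing `2 × 2` minor of every `N - c` forces the minimal polynomial to be cubic. -/
theorem Matrix.natDegree_minpoly_eq_three {N : Matrix (Fin 3) (Fin 3) K}
    (h : ∀ c : K, ∃ i j k l, (N - c • 1) i j * (N - c • 1) k l ≠
      (N - c • 1) i l * (N - c • 1) k j) :
    (minpoly K N).natDegree = 3 := by
  rcases N.natDegree_minpoly_eq_three_or with h3 | ⟨c, hc⟩ | ⟨c, R, hR, hc⟩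
  · exact h3
  · obtain ⟨i, j, k, l, hne⟩ := h c
    rw [hc] at hne
    simp at hne
  · obtain ⟨i, j, k, l, hne⟩ := h c
    rw [hc, add_sub_cancel_left] at hne
    exact absurd (mul_apply_eq_of_rank_eq_one hR i j k l) hne

/-- For a cubic minimal polynomial, the eigenspaces of the multiplication by `M` on `K[M]` are at
most one-dimensional. -/
theorem Matrix.eq_smul_of_mul_eq_smul {M X Y : Matrix (Fin 3) (Fin 3) K}
    (hM : (minpoly K M).natDegree = 3) (hX : X ∈ Algebra.adjoin K {M})
    (hY : Y ∈ Algebra.adjoin K {M}) (hY0 : Y ≠ 0) {a : K} (hXa : M * X = a • X)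
    (hYa : M * Y = a • Y) : ∃ t : K, X = t • Y := by
  by_cases hX0 : X = 0
  · exact ⟨0, by simp [hX0]⟩
  obtain ⟨d, c, hc, hd, rfl⟩ := exists_eq_smul_aeval_of_mul_eq_smul hM hX hX0 hXa
  obtain ⟨d', c', hc', hd', rfl⟩ := exists_eq_smul_aeval_of_mul_eq_smul hM hY hY0 hYa
  obtain rfl : d = d' := mul_left_cancel₀ (X_sub_C_ne_zero a) (hd.symm.trans hd')
  exact ⟨c * c'⁻¹, by rw [smul_smul, mul_assoc, inv_mul_cancel₀ hc', mul_one]⟩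

theorem Matrix.exists_rank_eq_one_of_eval_charpoly {M : Matrix (Fin 3) (Fin 3) K}
    (hM : (minpoly K M).natDegree = 3) {a : K} (ha : M.charpoly.eval a = 0) :
    ∃ X ∈ Algebra.adjoin K {M}, X.rank = 1 ∧ M * X = a • X := by
  have hroot := eval_minpoly_eq_zero_of_eval_charpoly ha
  obtain ⟨d, hd⟩ := dvd_iff_isRoot.2 hroot
  refine ⟨aeval M d, aeval_mem_adjoin_singleton K M, rank_aeval_eq_one hM hd, ?_⟩
  have := aeval_mul_aeval_of_minpoly_eq hd Polynomial.X
  simpa using this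

theorem Matrix.eval_charpoly_eq_zero_of_mul_eq_smul {n : Type*} [Fintype n] [DecidableEq n]
    {M X : Matrix n n K} {a : K} (hX : X ≠ 0)
    (h : M * X = a • X) : M.charpoly.eval a = 0 := by
  by_contra hne
  rw [eval_charpoly] at hne
  have h0 : (scalar n a - M) * X = 0 := by
    rw [sub_mul, h, scalar_apply, ← smul_eq_diagonal_mul, sub_self]
  refine hX ?_
  have := congrArg ((scalar n a - M)⁻¹ * ·) h0
  rwa [← mul_assoc, nonsing_inv_mul _ (Ne.isUnit hne), one_mul, mul_zero] at this

theorem Matrix.exists_mul_eq_smul_of_mem_adjoin {n : Type*} [Fintype n] [DecidableEq n]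
    {M X : Matrix n n K} (hX : X ∈ Algebra.adjoin K {M}) (hr : X.rank = 1) :
    ∃ a : K, M * X = a • X :=
  exists_mul_eq_smul_of_rank_eq_one hr
    (commute_of_mem_adjoin hX (Algebra.self_mem_adjoin_singleton K M))

theorem Matrix.natDegree_minpoly_of_forall_not_isRoot {N : Matrix (Fin 3) (Fin 3) K}
    (h : ∀ t, ¬ N.charpoly.IsRoot t) : (minpoly K N).natDegree = 3 := by
  rcases N.natDegree_minpoly_eq_three_or with h3 | ⟨c, hc⟩ | ⟨c, R, hR, hc⟩
  · exact h3
  · refine absurd (eval_charpoly_eq_zero_of_mul_eq_smul (X := 1) (a := c) one_ne_zero ?_) (h c)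
    rw [hc, mul_one]
  · obtain ⟨u, f, -, -, rfl⟩ := rank_eq_one_iff_exists_vecMulVec.1 hR
    refine absurd ?_ (h c)
    rw [IsRoot, eval_charpoly, hc, scalar_apply, ← smul_one_eq_diagonal, sub_add_cancel_left,
      det_neg, det_vecMulVec, mul_zero]

/-! ### Subalgebras that are fields -/

theorem adjoin_mem_cubicSubalgebrasOverNone {N : Matrix (Fin 3) (Fin 3) K}
    (h : ∀ t, ¬ N.charpoly.IsRoot t) : Algebra.adjoin K {N} ∈ cubicSubalgebrasOverNone K := by
  refine ⟨⟨N, natDegree_minpoly_of_forall_not_isRoot h, rfl⟩, fun X hX hr => ?_⟩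
  obtain ⟨a, ha⟩ := exists_mul_eq_smul_of_mem_adjoin hX hr
  exact h a (eval_charpoly_eq_zero_of_mul_eq_smul (by rintro rfl; simp at hr) ha)

/-- Every nonscalar element of a cubic subalgebra without elements of rank one generates it, and has
no eigenvalues. -/
theorem eq_adjoin_of_mem_cubicSubalgebrasOverNone
    {W : Subalgebra K (Matrix (Fin 3) (Fin 3) K)} (hW : W ∈ cubicSubalgebrasOverNone K)
    {N : Matrix (Fin 3) (Fin 3) K} (hN : N ∈ W) (hs : ∀ c : K, N ≠ c • 1) :
    W = Algebra.adjoin K {N} ∧ ∀ t, ¬ N.charpoly.IsRoot t := by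
  rcases N.natDegree_minpoly_eq_three_or with h3 | ⟨c, hc⟩ | ⟨c, R, hR, hc⟩
  · have hWN := eq_adjoin_of_mem_cubicSubalgebras hW.1 hN h3
    refine ⟨hWN, fun t ht => ?_⟩
    obtain ⟨X, hX, hX1, -⟩ := exists_rank_eq_one_of_eval_charpoly h3 ht
    exact hW.2 X (hWN ▸ hX) hX1
  · exact absurd hc (hs c)
  · refine absurd hR (hW.2 R ?_)
    have : R = N - c • 1 := by rw [hc, add_sub_cancel_left]
    rw [this]
    exact sub_mem hN (Subalgebra.smul_mem _ (one_mem _) _)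

theorem eq_zero_of_mulVec_eq_zero_of_mem_cubicSubalgebrasOverNone
    {W : Subalgebra K (Matrix (Fin 3) (Fin 3) K)} (hW : W ∈ cubicSubalgebrasOverNone K)
    {Y : Matrix (Fin 3) (Fin 3) K} (hY : Y ∈ W) {v : Fin 3 → K} (hv : v ≠ 0)
    (h : Y *ᵥ v = 0) : Y = 0 := by
  by_cases hs : ∃ c : K, Y = c • 1
  · obtain ⟨c, rfl⟩ := hs
    rw [smul_mulVec, one_mulVec, smul_eq_zero] at h
    rw [h.resolve_right hv, zero_smul]
  · push Not at hs
    refine absurd ?_ ((eq_adjoin_of_mem_cubicSubalgebrasOverNone hW hY hs).2 0)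
    rw [IsRoot, eval_charpoly, map_zero, zero_sub, det_neg,
      exists_mulVec_eq_zero_iff.1 ⟨v, hv, h⟩, mul_zero]

/-- Evaluation at a nonzero vector is a bijection from such a subalgebra onto the whole space. -/
theorem exists_mem_mulVec_eq_of_mem_cubicSubalgebrasOverNone
    {W : Subalgebra K (Matrix (Fin 3) (Fin 3) K)} (hW : W ∈ cubicSubalgebrasOverNone K)
    {v : Fin 3 → K} (hv : v ≠ 0) (w : Fin 3 → K) : ∃ Y ∈ W, Y *ᵥ v = w := by
  let e : W →ₗ[K] (Fin 3 → K) :=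
    { toFun := fun Y => Y.1 *ᵥ v
      map_add' := fun Y Z => add_mulVec _ _ _
      map_smul' := fun c Y => smul_mulVec _ _ _ }
  have hinj : Function.Injective e := by
    rw [← LinearMap.ker_eq_bot, LinearMap.ker_eq_bot']
    exact fun Y hY => Subtype.ext
      (eq_zero_of_mulVec_eq_zero_of_mem_cubicSubalgebrasOverNone hW Y.2 hv hY)
  have hsurj : Function.Surjective e := by
    refine (LinearMap.injective_iff_surjective_of_finrank_eq_finrank ?_).1 hinj
    rw [finrank_of_mem_cubicSubalgebras hW.1, finrank_fintype_fun_eq_card, Fintype.card_fin]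
  obtain ⟨Y, hY⟩ := hsurj w
  exact ⟨Y.1, Y.2, hY⟩

theorem charpoly_of_firstCol (α β γ x y z : K) :
    (!![0, α, x; 1, β, y; 0, γ, z] : Matrix (Fin 3) (Fin 3) K).charpoly =
      Polynomial.X ^ 3 - C (β + z) * Polynomial.X ^ 2 + C (β * z - γ * y - α) * Polynomial.X
        - C (γ * x - α * z) := by
  rw [charpoly, det_fin_three]
  simp
  ring

/-- A matrix that maps `e₀` to `e₁`, and `e₁` to a given vector `(α, β, γ)` with `γ ≠ 0`, is
determined by its characteristic polynomial, and every monic cubic occurs. -/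
noncomputable def lastColEquivMonics [Fintype K] (α β : K) (γ : Kˣ) :
    K × K × K ≃ monicsOfDegree K 3 :=
  Equiv.ofBijective (fun w => ⟨(!![0, α, w.1; 1, β, w.2.1; 0, (γ : K), w.2.2] :
      Matrix (Fin 3) (Fin 3) K).charpoly, charpoly_monic _, by
        rw [charpoly_natDegree_eq_dim, Fintype.card_fin]⟩) (by
    have := Fintype.ofFinite (monicsOfDegree K 3)
    rw [Fintype.bijective_iff_injective_and_card]
    constructor
    · rintro ⟨x, y, z⟩ ⟨x', y', z'⟩ h
      have h' := congrArg Subtype.val h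
      simp only [charpoly_of_firstCol] at h'
      have h0 := congrArg (fun f => coeff f 0) h'
      have h1 := congrArg (fun f => coeff f 1) h'
      have h2 := congrArg (fun f => coeff f 2) h'
      simp [coeff_X, coeff_C, -map_add, -map_sub, -map_mul] at h0 h1 h2
      subst h2
      have hx : x = x' := mul_left_cancel₀ γ.ne_zero (by linear_combination -h0)
      have hy : y = y' := mul_left_cancel₀ γ.ne_zero (by linear_combination -h1)
      rw [hx, hy]
    · rw [← Nat.card_eq_fintype_card (α := monicsOfDegree K 3), card_monicsOfDegree]
      simp
      ring)

/-- Such a subalgebra has exactly one element `N` with `N e₀ = e₁`, and `N` generates it. The second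
column of `N` has a nonzero last coordinate, since otherwise `N` would have an invariant plane; it
can be chosen in `q²(q - 1)` ways, and then `N` is given by its characteristic polynomial, one of
the `(q³ - q)/3` monic cubics without roots. -/
theorem card_cubicSubalgebrasOverNone (K : Type*) [Field K] [Fintype K] :
    Nat.card (cubicSubalgebrasOverNone K) =
      (Fintype.card K ^ 3 - Fintype.card K) * (Fintype.card K ^ 3 - Fintype.card K ^ 2) / 3 := by
  let m : K → K → Kˣ → monicsOfDegree K 3 → Matrix (Fin 3) (Fin 3) K := fun α β γ f =>
    !![0, α, ((lastColEquivMonics α β γ).symm f).1;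
      1, β, ((lastColEquivMonics α β γ).symm f).2.1;
      0, (γ : K), ((lastColEquivMonics α β γ).symm f).2.2]
  have hm : ∀ α β γ f, (m α β γ f).charpoly = f.1 := fun α β γ f =>
    congrArg Subtype.val ((lastColEquivMonics α β γ).apply_symm_apply f)
  have hcol : ∀ α β γ f, m α β γ f *ᵥ ![1, 0, 0] = ![0, 1, 0] := by
    intro α β γ f
    ext i
    fin_cases i <;> simp [m, mulVec, dotProduct, Fin.sum_univ_three]
  have hv : (![1, 0, 0] : Fin 3 → K) ≠ 0 := fun h => one_ne_zero (congrFun h 0)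
  have hbij : Function.Bijective
      (fun w : (K × K × Kˣ) × {f : monicsOfDegree K 3 // ∀ t, ¬ f.1.IsRoot t} =>
        (⟨Algebra.adjoin K {m w.1.1 w.1.2.1 w.1.2.2 w.2.1},
          adjoin_mem_cubicSubalgebrasOverNone (by rw [hm]; exact w.2.2)⟩ :
          cubicSubalgebrasOverNone K)) := by
    constructor
    · rintro ⟨⟨α, β, γ⟩, f, hf⟩ ⟨⟨α', β', γ'⟩, f', hf'⟩ h
      have hW : Algebra.adjoin K {m α β γ f} = Algebra.adjoin K {m α' β' γ' f'} :=
        congrArg Subtype.val h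
      have heq : m α β γ f = m α' β' γ' f' := by
        rw [← sub_eq_zero]
        refine eq_zero_of_mulVec_eq_zero_of_mem_cubicSubalgebrasOverNone
          (adjoin_mem_cubicSubalgebrasOverNone (N := m α β γ f) (by rw [hm]; exact hf))
          (sub_mem (Algebra.self_mem_adjoin_singleton _ _)
            (hW ▸ Algebra.self_mem_adjoin_singleton _ _)) hv ?_
        rw [sub_mulVec, hcol, hcol, sub_self]
      have h1 : α = α' := congrFun (congrFun heq 0) 1
      have h2 : β = β' := congrFun (congrFun heq 1) 1
      have h3 : γ = γ' := Units.ext (congrFun (congrFun heq 2) 1)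
      have h4 : f = f' := Subtype.ext (by rw [← hm α β γ f, heq, hm])
      subst h1 h2 h3 h4
      rfl
    · rintro ⟨W, hW⟩
      obtain ⟨N, hN, hcolN⟩ := exists_mem_mulVec_eq_of_mem_cubicSubalgebrasOverNone hW hv ![0, 1, 0]
      have hcolN' : ∀ i, N i 0 = (![0, 1, 0] : Fin 3 → K) i := by
        intro i
        rw [← hcolN]
        simp [mulVec, dotProduct, Fin.sum_univ_three]
      have h00 : N 0 0 = 0 := hcolN' 0
      have h10 : N 1 0 = 1 := hcolN' 1
      have h20 : N 2 0 = 0 := hcolN' 2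
      obtain ⟨hWN, hroot⟩ := eq_adjoin_of_mem_cubicSubalgebrasOverNone hW hN (by
        rintro c rfl
        simp at h10)
      have hγ : N 2 1 ≠ 0 := by
        intro h21
        refine hroot (N 2 2) ?_
        rw [IsRoot, eval_charpoly, det_fin_three]
        simp [h21, h20]
      have hNe : N = !![0, N 0 1, N 0 2; 1, N 1 1, N 1 2; 0, N 2 1, N 2 2] := by
        ext i j
        fin_cases i <;> fin_cases j <;> simp [h00, h10, h20]
      refine ⟨⟨(N 0 1, N 1 1, Units.mk0 _ hγ), ⟨lastColEquivMonics (N 0 1) (N 1 1)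
        (Units.mk0 _ hγ) (N 0 2, N 1 2, N 2 2), ?_⟩⟩, ?_⟩
      · intro t
        have := hroot t
        rw [hNe] at this
        exact this
      · apply Subtype.ext
        simp only [m, Equiv.symm_apply_apply, Units.val_mk0]
        rw [hWN, ← hNe]
  rw [← Nat.card_eq_of_bijective _ hbij]
  have h3 := card_monic_cubic_forall_not_isRoot K
  simp only [Nat.card_prod, Nat.card_eq_fintype_card (α := K), Nat.card_units]
  have h1 := Fintype.one_lt_card (α := K)
  generalize Fintype.card K = q at *
  have h4 : q ^ 3 - q ^ 2 = q * (q * (q - 1)) := by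
    obtain ⟨r, rfl⟩ : ∃ r, q = r + 1 := ⟨q - 1, by omega⟩
    rw [Nat.add_sub_cancel]
    exact Nat.sub_eq_of_eq_add (by ring)
  rw [← h3, h4, mul_assoc 3, Nat.mul_div_cancel_left _ (by norm_num)]
  ring

/-! ### Subalgebras with one idempotent of rank one -/

theorem Matrix.charpoly_fromBlocks_one_two (m x y z w : K) :
    (!![m, 0, 0; 0, x, y; 0, z, w] : Matrix (Fin 3) (Fin 3) K).charpoly =
      (Polynomial.X - C m) *
        (Polynomial.X ^ 2 - C (x + w) * Polynomial.X + C (x * w - y * z)) := by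
  rw [charpoly, det_fin_three]
  simp
  ring

/-- The matrix which acts on the last two coordinates as the companion matrix of
`X ^ 2 - a X - c`. -/
def companionTwo (c a : K) : Matrix (Fin 3) (Fin 3) K := !![0, 0, 0; 0, 0, c; 0, 1, a]

theorem monic_quadratic (c a : K) :
    (Polynomial.X ^ 2 - C a * Polynomial.X - C c).Monic ∧
      (Polynomial.X ^ 2 - C a * Polynomial.X - C c).natDegree = 2 := by
  constructor <;> [skip; compute_degree!]
  monicity!

/-- Monic quadratic polynomials are given by their coefficients. -/
noncomputable def quadraticEquivMonics (K : Type*) [Field K] [Fintype K] :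
    K × K ≃ monicsOfDegree K 2 :=
  Equiv.ofBijective (fun w => ⟨Polynomial.X ^ 2 - C w.2 * Polynomial.X - C w.1,
      monic_quadratic w.1 w.2⟩) (by
    have := Fintype.ofFinite (monicsOfDegree K 2)
    rw [Fintype.bijective_iff_injective_and_card]
    constructor
    · rintro ⟨c, a⟩ ⟨c', a'⟩ h
      have h' := congrArg Subtype.val h
      have h0 := congrArg (fun f => coeff f 0) h'
      have h1 := congrArg (fun f => coeff f 1) h'
      simp [coeff_X, coeff_C] at h0 h1
      rw [h0, h1]
    · rw [← Nat.card_eq_fintype_card (α := monicsOfDegree K 2), card_monicsOfDegree]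
      simp
      ring)

theorem rank_single_one (i j : Fin 3) : (single i j (1 : K)).rank = 1 := by
  rw [rank_eq_one_iff_exists_vecMulVec]
  refine ⟨Pi.single i 1, Pi.single j 1, by simp, by simp, ?_⟩
  rw [single_eq_single_vecMulVec_single]

/-- If `a` is the only eigenvalue of `N`, then the elements of rank one of `K[N]` all belong to `a`,
and are proportional. -/
theorem adjoin_mem_cubicSubalgebrasOver {R N : Matrix (Fin 3) (Fin 3) K}
    (h3 : (minpoly K N).natDegree = 3) (hR : R.rank = 1) {a : K} (hNR : N * R = a • R)
    (hRN : R * N = a • R) (hroot : ∀ t, N.charpoly.IsRoot t → t = a) :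
    Algebra.adjoin K {N} ∈ cubicSubalgebrasOver R := by
  have hmem : R ∈ Algebra.adjoin K {N} :=
    mem_adjoin_of_commute (by rw [h3, Fintype.card_fin]) (by rw [hNR, hRN])
  refine ⟨⟨N, h3, rfl⟩, hmem, fun X hX hr => ?_⟩
  obtain ⟨b, hb⟩ := exists_mul_eq_smul_of_mem_adjoin hX hr
  obtain rfl : b = a :=
    hroot b (eval_charpoly_eq_zero_of_mul_eq_smul (by rintro rfl; simp at hr) hb)
  exact eq_smul_of_mul_eq_smul h3 hX hmem (by rintro rfl; simp at hR) hb hNR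

theorem eq_of_isRoot_charpoly_of_mem_cubicSubalgebrasOver {R M : Matrix (Fin 3) (Fin 3) K}
    (h3 : (minpoly K M).natDegree = 3) (hM : Algebra.adjoin K {M} ∈ cubicSubalgebrasOver R)
    (hR : R ≠ 0) {a t : K} (ha : M * R = a • R) (ht : M.charpoly.IsRoot t) : t = a := by
  obtain ⟨X, hX, hX1, hXt⟩ := exists_rank_eq_one_of_eval_charpoly h3 ht
  obtain ⟨s, rfl⟩ := hM.2.2 X hX hX1
  have hs : s ≠ 0 := by rintro rfl; simp at hX1
  rw [mul_smul_comm, ha, smul_smul, smul_smul, mul_comm] at hXt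
  exact (mul_right_cancel₀ hs (smul_left_injective K hR hXt)).symm

theorem companionTwo_mem_cubicSubalgebrasOver {c a : K}
    (h : ∀ t, ¬ (Polynomial.X ^ 2 - C a * Polynomial.X - C c : K[X]).IsRoot t) :
    (minpoly K (companionTwo c a)).natDegree = 3 ∧
      Algebra.adjoin K {companionTwo c a} ∈ cubicSubalgebrasOver (single 0 0 (1 : K)) := by
  have hc : c ≠ 0 := by
    rintro rfl
    exact h 0 (by simp)
  have h3 : (minpoly K (companionTwo c a)).natDegree = 3 := by
    refine natDegree_minpoly_eq_three fun s => ?_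
    by_cases hs : s = 0
    · exact ⟨1, 1, 2, 2, by simp [hs, companionTwo, hc.symm]⟩
    · exact ⟨0, 0, 2, 1, by simp [hs, companionTwo]⟩
  refine ⟨h3, adjoin_mem_cubicSubalgebrasOver (a := 0) h3 (rank_single_one 0 0) ?_ ?_ ?_⟩
  · ext i j
    fin_cases i <;> fin_cases j <;> simp [companionTwo, mul_apply, Fin.sum_univ_three]
  · ext i j
    fin_cases i <;> fin_cases j <;> simp [companionTwo, mul_apply, Fin.sum_univ_three]
  · intro t ht
    rw [companionTwo, charpoly_fromBlocks_one_two, IsRoot, eval_mul, mul_eq_zero] at ht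
    rcases ht with ht | ht
    · simpa using ht
    · refine absurd ?_ (h t)
      rw [IsRoot, ← ht]
      simp
      ring

/-- A generator of a cubic subalgebra over the idempotent `E = single 0 0 1` commutes with `E`,
hence is a block matrix. Its lower block has no eigenvalues, so subtracting combinations of `1` and
`E`, and rescaling, normalizes the first column of that block to `(0, 1)`. -/
theorem exists_eq_adjoin_companionTwo {W : Subalgebra K (Matrix (Fin 3) (Fin 3) K)}
    (hW : W ∈ cubicSubalgebrasOver (single 0 0 (1 : K))) :
    ∃ c a : K, (∀ t, ¬ (Polynomial.X ^ 2 - C a * Polynomial.X - C c : K[X]).IsRoot t) ∧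
      W = Algebra.adjoin K {companionTwo c a} := by
  obtain ⟨M, h3, rfl⟩ := hW.1
  set E : Matrix (Fin 3) (Fin 3) K := single 0 0 1 with hE
  have hE0 : E ≠ 0 := fun h => by simpa [hE] using congrFun (congrFun h 0) 0
  have hMmem := Algebra.self_mem_adjoin_singleton K M
  have hcomm := commute_of_mem_adjoin hW.2.1 hMmem
  have hcomm' : ∀ i j, (E * M) i j = (M * E) i j := fun i j => by rw [hcomm]
  have h01 : M 0 1 = 0 := by simpa [hE, mul_apply, Fin.sum_univ_three] using hcomm' 0 1
  have h02 : M 0 2 = 0 := by simpa [hE, mul_apply, Fin.sum_univ_three] using hcomm' 0 2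
  have h10 : M 1 0 = 0 := by simpa [hE, mul_apply, Fin.sum_univ_three] using (hcomm' 1 0).symm
  have h20 : M 2 0 = 0 := by simpa [hE, mul_apply, Fin.sum_univ_three] using (hcomm' 2 0).symm
  obtain ⟨m, x, y, z, w, hMe⟩ : ∃ m x y z w : K, M = !![m, 0, 0; 0, x, y; 0, z, w] := by
    refine ⟨M 0 0, M 1 1, M 1 2, M 2 1, M 2 2, ?_⟩
    ext i j
    fin_cases i <;> fin_cases j <;> simp [h01, h02, h10, h20]
  have hME : M * E = m • E := by
    ext i j
    fin_cases i <;> fin_cases j <;> simp [hE, hMe, mul_apply, Fin.sum_univ_three]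
  set f : K[X] := Polynomial.X ^ 2 - C (x + w) * Polynomial.X + C (x * w - y * z) with hf
  have hchar : M.charpoly = (Polynomial.X - C m) * f := by
    rw [hMe, charpoly_fromBlocks_one_two]
  -- `m` is a simple root because `E` is idempotent
  have hfm : f.eval m ≠ 0 := by
    obtain ⟨d, c, hc, hd, hdE⟩ := exists_eq_smul_aeval_of_mul_eq_smul h3 hW.2.1 hE0 hME
    obtain rfl : f = d := by
      rw [minpoly_eq_charpoly_of_natDegree (by rw [h3, Fintype.card_fin]), hchar] at hd
      exact mul_left_cancel₀ (X_sub_C_ne_zero m) hd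
    intro h0
    have h1 := aeval_mul_aeval_of_minpoly_eq hd f
    rw [h0, zero_smul] at h1
    have h2 : E * E = 0 := by rw [hdE, smul_mul_smul_comm, h1, smul_zero]
    rw [hE, single_mul_single_same, mul_one] at h2
    exact hE0 h2
  have hfroot : ∀ t, f.eval t ≠ 0 := by
    intro t ht
    have h1 : M.charpoly.IsRoot t := by rw [IsRoot, hchar, eval_mul, ht, mul_zero]
    rw [eq_of_isRoot_charpoly_of_mem_cubicSubalgebrasOver h3 hW hE0 hME h1] at ht
    exact hfm ht
  have hz : z ≠ 0 := by
    rintro rfl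
    refine hfroot x ?_
    simp [hf]
    ring
  have hroot : ∀ t, ¬ (Polynomial.X ^ 2 - C ((w - x) / z) * Polynomial.X
      - C (y / z) : K[X]).IsRoot t := by
    intro t ht
    refine hfroot (z * t + x) ?_
    simp only [IsRoot, eval_sub, eval_pow, eval_mul, eval_X, eval_C] at ht
    simp only [hf, eval_sub, eval_add, eval_pow, eval_mul, eval_X, eval_C]
    field_simp at ht
    linear_combination z * ht
  refine ⟨y / z, (w - x) / z, hroot, ?_⟩
  refine eq_adjoin_of_mem_cubicSubalgebras hW.1 ?_ (companionTwo_mem_cubicSubalgebrasOver hroot).1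
  have hN : companionTwo (y / z) ((w - x) / z) = z⁻¹ • (M - x • 1 - (m - x) • E) := by
    ext i j
    fin_cases i <;> fin_cases j <;> simp [companionTwo, hMe, hE, hz] <;> field_simp
  rw [hN]
  exact Subalgebra.smul_mem _ (sub_mem (sub_mem hMmem (Subalgebra.smul_mem _ (one_mem _) _))
    (Subalgebra.smul_mem _ hW.2.1 _)) _

/-- The subalgebras are in bijection with the monic quadratic polynomials without roots. -/
theorem card_cubicSubalgebrasOver_single_zero_zero [Fintype K] :
    Nat.card (cubicSubalgebrasOver (single 0 0 (1 : K))) =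
      Fintype.card K * (Fintype.card K - 1) / 2 := by
  rw [← card_monic_quadratic_forall_not_isRoot]
  let e := quadraticEquivMonics K
  have hroot : ∀ f : monicsOfDegree K 2,
      f.1 = Polynomial.X ^ 2 - C (e.symm f).2 * Polynomial.X - C (e.symm f).1 :=
    fun f => (congrArg Subtype.val (e.apply_symm_apply f)).symm
  symm
  refine Nat.card_eq_of_bijective
    (fun f : {f : monicsOfDegree K 2 // ∀ t, ¬ f.1.IsRoot t} =>
      (⟨Algebra.adjoin K {companionTwo (e.symm f.1).1 (e.symm f.1).2},
        (companionTwo_mem_cubicSubalgebrasOver (by rw [← hroot]; exact f.2)).2⟩ :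
        cubicSubalgebrasOver (single 0 0 (1 : K)))) ⟨?_, ?_⟩
  · rintro ⟨f, hf⟩ ⟨f', hf'⟩ h
    have hW := congrArg Subtype.val h
    simp only at hW
    have hover := (companionTwo_mem_cubicSubalgebrasOver
      (c := (e.symm f).1) (a := (e.symm f).2) (by rw [← hroot]; exact hf)).2
    rcases hca : e.symm f with ⟨c, a⟩
    rcases hca' : e.symm f' with ⟨c', a'⟩
    rw [hca, hca'] at hW
    rw [hca] at hover
    simp only at hW hover
    have hmem : companionTwo c a - companionTwo c' a' ∈ Algebra.adjoin K {companionTwo c a} :=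
      sub_mem (Algebra.self_mem_adjoin_singleton _ _)
        (hW ▸ Algebra.self_mem_adjoin_singleton _ _)
    have hvec : companionTwo c a - companionTwo c' a' =
        vecMulVec ![0, c - c', a - a'] ![0, 0, 1] := by
      ext i j
      fin_cases i <;> fin_cases j <;> simp [companionTwo, vecMulVec_apply]
    have hzero : (![0, c - c', a - a'] : Fin 3 → K) = 0 := by
      by_contra hne
      obtain ⟨t, ht⟩ := hover.2.2 _ hmem (by
        rw [hvec, rank_eq_one_iff_exists_vecMulVec]
        exact ⟨_, _, hne, fun h0 => one_ne_zero (congrFun h0 2), rfl⟩)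
      rw [hvec] at ht
      have h1 : c - c' = 0 := by
        simpa [vecMulVec_apply] using congrFun (congrFun ht 1) 2
      have h2 : a - a' = 0 := by
        simpa [vecMulVec_apply] using congrFun (congrFun ht 2) 2
      exact hne (by rw [h1, h2]; ext i; fin_cases i <;> rfl)
    have h1 : c - c' = 0 := congrFun hzero 1
    have h2 : a - a' = 0 := congrFun hzero 2
    apply Subtype.ext
    apply e.symm.injective
    rw [hca, hca', sub_eq_zero.1 h1, sub_eq_zero.1 h2]
  · rintro ⟨W, hW⟩
    obtain ⟨c, a, hroot', rfl⟩ := exists_eq_adjoin_companionTwo hW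
    refine ⟨⟨e (c, a), hroot'⟩, ?_⟩
    apply Subtype.ext
    simp only [Equiv.symm_apply_apply]

/-! ### Subalgebras with one nilpotent of rank one -/

/-- The nilpotent matrix with `e₀ ↦ e₁ ↦ c e₂ ↦ 0`. -/
def nilpotentThree (c : K) : Matrix (Fin 3) (Fin 3) K := !![0, 0, 0; 1, 0, 0; 0, c, 0]

theorem Matrix.charpoly_lowerTriangular_three (x y z u v w : K) :
    (!![x, 0, 0; u, y, 0; v, w, z] : Matrix (Fin 3) (Fin 3) K).charpoly =
      (Polynomial.X - C x) * (Polynomial.X - C y) * (Polynomial.X - C z) := by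
  rw [charpoly, det_fin_three]
  simp

theorem nilpotentThree_mem_cubicSubalgebrasOver {c : K} (hc : c ≠ 0) :
    (minpoly K (nilpotentThree c)).natDegree = 3 ∧
      Algebra.adjoin K {nilpotentThree c} ∈ cubicSubalgebrasOver (single 2 0 (1 : K)) := by
  have h3 : (minpoly K (nilpotentThree c)).natDegree = 3 :=
    natDegree_minpoly_eq_three fun s => ⟨1, 0, 2, 1, by simp [nilpotentThree, hc]⟩
  refine ⟨h3, adjoin_mem_cubicSubalgebrasOver (a := 0) h3 (rank_single_one 2 0) ?_ ?_ ?_⟩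
  · ext i j
    fin_cases i <;> fin_cases j <;> simp [nilpotentThree, mul_apply, Fin.sum_univ_three]
  · ext i j
    fin_cases i <;> fin_cases j <;> simp [nilpotentThree, mul_apply, Fin.sum_univ_three]
  · intro t ht
    rw [nilpotentThree, charpoly_lowerTriangular_three] at ht
    simpa [IsRoot] using ht

/-- A generator of a cubic subalgebra over the nilpotent `E = single 2 0 1` commutes with `E` and
has a single eigenvalue, hence is lower triangular with constant diagonal. Subtracting combinations
of `1` and `E`, and rescaling, leaves only the ratio of the two subdiagonal entries. -/
theorem exists_eq_adjoin_nilpotentThree {W : Subalgebra K (Matrix (Fin 3) (Fin 3) K)}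
    (hW : W ∈ cubicSubalgebrasOver (single 2 0 (1 : K))) :
    ∃ c : K, c ≠ 0 ∧ W = Algebra.adjoin K {nilpotentThree c} := by
  obtain ⟨M, h3, rfl⟩ := hW.1
  set E : Matrix (Fin 3) (Fin 3) K := single 2 0 1 with hE
  have hE0 : E ≠ 0 := fun h => by simpa [hE] using congrFun (congrFun h 2) 0
  have hMmem := Algebra.self_mem_adjoin_singleton K M
  have hcomm := commute_of_mem_adjoin hW.2.1 hMmem
  have hcomm' : ∀ i j, (E * M) i j = (M * E) i j := fun i j => by rw [hcomm]
  have h01 : M 0 1 = 0 := by simpa [hE, mul_apply, Fin.sum_univ_three] using hcomm' 2 1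
  have h02 : M 0 2 = 0 := by simpa [hE, mul_apply, Fin.sum_univ_three] using hcomm' 2 2
  have h12 : M 1 2 = 0 := by simpa [hE, mul_apply, Fin.sum_univ_three] using (hcomm' 1 0).symm
  have h22 : M 2 2 = M 0 0 := by simpa [hE, mul_apply, Fin.sum_univ_three] using (hcomm' 2 0).symm
  obtain ⟨x, y, u, v, w, hMe⟩ : ∃ x y u v w : K, M = !![x, 0, 0; u, y, 0; v, w, x] := by
    refine ⟨M 0 0, M 1 1, M 1 0, M 2 0, M 2 1, ?_⟩
    ext i j
    fin_cases i <;> fin_cases j <;> simp [h01, h02, h12, h22]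
  have hME : M * E = x • E := by
    ext i j
    fin_cases i <;> fin_cases j <;> simp [hE, hMe, mul_apply, Fin.sum_univ_three]
  obtain rfl : y = x := by
    refine eq_of_isRoot_charpoly_of_mem_cubicSubalgebrasOver h3 hW hE0 hME ?_
    rw [hMe, charpoly_lowerTriangular_three]
    simp [IsRoot]
  have huw : w * u ≠ 0 := by
    intro h0
    have h1 : (M - y • 1) * (M - y • 1) = 0 := by
      ext i j
      fin_cases i <;> fin_cases j <;> simp [hMe, mul_apply, Fin.sum_univ_three, h0]
    have h2 : minpoly K M ∣ (Polynomial.X - C y) * (Polynomial.X - C y) := by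
      apply minpoly.dvd
      simpa [Algebra.algebraMap_eq_smul_one] using h1
    have h4 := natDegree_le_of_dvd h2 (mul_ne_zero (X_sub_C_ne_zero y) (X_sub_C_ne_zero y))
    rw [natDegree_mul (X_sub_C_ne_zero y) (X_sub_C_ne_zero y), natDegree_X_sub_C] at h4
    omega
  have hu : u ≠ 0 := right_ne_zero_of_mul huw
  have hw : w ≠ 0 := left_ne_zero_of_mul huw
  have hc : w / u ≠ 0 := div_ne_zero hw hu
  refine ⟨w / u, hc, ?_⟩
  refine eq_adjoin_of_mem_cubicSubalgebras hW.1 ?_ (nilpotentThree_mem_cubicSubalgebrasOver hc).1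
  have hN : nilpotentThree (w / u) = u⁻¹ • (M - y • 1 - v • E) := by
    ext i j
    fin_cases i <;> fin_cases j <;> simp [nilpotentThree, hMe, hE, hu]; field_simp
  rw [hN]
  exact Subalgebra.smul_mem _ (sub_mem (sub_mem hMmem (Subalgebra.smul_mem _ (one_mem _) _))
    (Subalgebra.smul_mem _ hW.2.1 _)) _

theorem card_cubicSubalgebrasOver_single_two_zero [Fintype K] :
    Nat.card (cubicSubalgebrasOver (single 2 0 (1 : K))) = Fintype.card K - 1 := by
  rw [← Nat.card_eq_fintype_card, ← Nat.card_units]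
  symm
  refine Nat.card_eq_of_bijective
    (fun c : Kˣ => (⟨Algebra.adjoin K {nilpotentThree (c : K)},
      (nilpotentThree_mem_cubicSubalgebrasOver c.ne_zero).2⟩ :
        cubicSubalgebrasOver (single 2 0 (1 : K)))) ⟨?_, ?_⟩
  · intro c c' h
    have hW := congrArg Subtype.val h
    simp only at hW
    have hover := (nilpotentThree_mem_cubicSubalgebrasOver c.ne_zero).2
    have hmem : nilpotentThree (c : K) - nilpotentThree (c' : K) ∈
        Algebra.adjoin K {nilpotentThree (c : K)} :=
      sub_mem (Algebra.self_mem_adjoin_singleton _ _)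
        (hW ▸ Algebra.self_mem_adjoin_singleton _ _)
    have hvec : nilpotentThree (c : K) - nilpotentThree (c' : K) =
        vecMulVec ![0, 0, (c : K) - c'] ![0, 1, 0] := by
      ext i j
      fin_cases i <;> fin_cases j <;> simp [nilpotentThree, vecMulVec_apply]
    by_contra hne
    have hsub : (c : K) - c' ≠ 0 := sub_ne_zero.2 fun h => hne (Units.ext h)
    obtain ⟨t, ht⟩ := hover.2.2 _ hmem (by
      rw [hvec, rank_eq_one_iff_exists_vecMulVec]
      exact ⟨_, _, fun h0 => hsub (congrFun h0 2), fun h0 => one_ne_zero (congrFun h0 1), rfl⟩)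
    rw [hvec] at ht
    exact hsub (by simpa [vecMulVec_apply] using congrFun (congrFun ht 2) 1)
  · rintro ⟨W, hW⟩
    obtain ⟨c, hc, rfl⟩ := exists_eq_adjoin_nilpotentThree hW
    exact ⟨Units.mk0 c hc, rfl⟩

/-! ### Conjugation -/

/-- Conjugation by an invertible matrix. -/
def Matrix.conjAlgEquiv {n : Type*} [Fintype n] [DecidableEq n] (g : (Matrix n n K)ˣ) :
    Matrix n n K ≃ₐ[K] Matrix n n K where
  toFun X := g * X * (g⁻¹ : (Matrix n n K)ˣ)
  invFun X := (g⁻¹ : (Matrix n n K)ˣ) * X * g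
  left_inv X := by simp [mul_assoc]
  right_inv X := by simp [mul_assoc]
  map_mul' X Y := by simp [mul_assoc]
  map_add' X Y := by simp [mul_add, add_mul]
  commutes' r := by
    rw [← Algebra.commutes r (g : Matrix n n K), mul_assoc, Units.mul_inv, mul_one]

theorem Matrix.rank_conjAlgEquiv (g : (Matrix (Fin 3) (Fin 3) K)ˣ)
    (X : Matrix (Fin 3) (Fin 3) K) : (conjAlgEquiv g X).rank = X.rank := by
  have h : conjAlgEquiv g X = g.1 * X * (g⁻¹).1 := rfl
  rw [h, rank_mul_eq_left_of_isUnit_det _ _ ((isUnit_iff_isUnit_det _).1 (Units.isUnit _)),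
    rank_mul_eq_right_of_isUnit_det _ _ ((isUnit_iff_isUnit_det _).1 (Units.isUnit _))]

theorem map_mem_cubicSubalgebrasOver (e : Matrix (Fin 3) (Fin 3) K ≃ₐ[K] Matrix (Fin 3) (Fin 3) K)
    (he : ∀ X, (e X).rank = X.rank) {R : Matrix (Fin 3) (Fin 3) K}
    {W : Subalgebra K (Matrix (Fin 3) (Fin 3) K)} (hW : W ∈ cubicSubalgebrasOver R) :
    W.map (e : Matrix (Fin 3) (Fin 3) K →ₐ[K] Matrix (Fin 3) (Fin 3) K) ∈
      cubicSubalgebrasOver (e R) := by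
  refine ⟨?_, ⟨R, hW.2.1, rfl⟩, ?_⟩
  · obtain ⟨M, h3, rfl⟩ := hW.1
    refine ⟨e M, by rw [minpoly.algEquiv_eq, h3], ?_⟩
    rw [AlgHom.map_adjoin_singleton]
    rfl
  · rintro _ ⟨X, hX, rfl⟩ hr
    change (e X).rank = 1 at hr
    rw [he] at hr
    obtain ⟨t, rfl⟩ := hW.2.2 X hX hr
    exact ⟨t, map_smul e t R⟩

theorem card_cubicSubalgebrasOver_algEquiv
    (e : Matrix (Fin 3) (Fin 3) K ≃ₐ[K] Matrix (Fin 3) (Fin 3) K)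
    (he : ∀ X, (e X).rank = X.rank) (R : Matrix (Fin 3) (Fin 3) K) :
    Nat.card (cubicSubalgebrasOver (e R)) = Nat.card (cubicSubalgebrasOver R) := by
  have he' : ∀ X, (e.symm X).rank = X.rank := fun X => by rw [← he, AlgEquiv.apply_symm_apply]
  let F : cubicSubalgebrasOver R → cubicSubalgebrasOver (e R) := fun W =>
    ⟨W.1.map (e : Matrix (Fin 3) (Fin 3) K →ₐ[K] Matrix (Fin 3) (Fin 3) K),
      map_mem_cubicSubalgebrasOver e he W.2⟩
  refine (Nat.card_eq_of_bijective F ⟨?_, ?_⟩).symm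
  · intro W W' h
    refine Subtype.ext (Subalgebra.map_injective
      (f := (e : Matrix (Fin 3) (Fin 3) K →ₐ[K] Matrix (Fin 3) (Fin 3) K)) e.injective ?_)
    exact congrArg Subtype.val h
  · rintro ⟨W, hW⟩
    have h := map_mem_cubicSubalgebrasOver e.symm he' hW
    rw [AlgEquiv.symm_apply_apply] at h
    refine ⟨⟨_, h⟩, Subtype.ext (SetLike.ext fun X => ?_)⟩
    constructor
    · rintro ⟨_, ⟨Y, hY, rfl⟩, rfl⟩
      change e (e.symm Y) ∈ W
      rwa [AlgEquiv.apply_symm_apply]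
    · intro hX
      exact ⟨e.symm X, ⟨X, hX, rfl⟩, e.apply_symm_apply X⟩

theorem cubicSubalgebrasOver_smul (R : Matrix (Fin 3) (Fin 3) K) {c : K} (hc : c ≠ 0) :
    cubicSubalgebrasOver (c • R) = cubicSubalgebrasOver R := by
  have key : ∀ (R : Matrix (Fin 3) (Fin 3) K) {c : K}, c ≠ 0 →
      cubicSubalgebrasOver R ⊆ cubicSubalgebrasOver (c • R) := by
    rintro R c hc W ⟨h1, h2, h3⟩
    refine ⟨h1, Subalgebra.smul_mem _ h2 _, fun X hX hr => ?_⟩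
    obtain ⟨t, rfl⟩ := h3 X hX hr
    exact ⟨t * c⁻¹, by rw [smul_smul, mul_assoc, inv_mul_cancel₀ hc, mul_one]⟩
  refine (key R hc).antisymm' ?_
  have := key (c • R) (inv_ne_zero hc)
  rwa [smul_smul, inv_mul_cancel₀ hc, one_smul] at this

/-- A vector outside the kernel of a nonzero functional and a nonzero vector of that kernel are
the first and the last vector of a basis whose second vector lies in the kernel as well. -/
theorem exists_unit_col {f w v : Fin 3 → K} (hw : f ⬝ᵥ w ≠ 0) (hv0 : v ≠ 0)
    (hv : f ⬝ᵥ v = 0) :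
    ∃ g : (Matrix (Fin 3) (Fin 3) K)ˣ, g.1.col 0 = w ∧ f ⬝ᵥ g.1.col 1 = 0 ∧ g.1.col 2 = v := by
  let φ : (Fin 3 → K) →ₗ[K] K := dotProductBilin K K f
  have hφ : ∀ x, φ x = f ⬝ᵥ x := fun x => rfl
  have hker : 1 < finrank K (LinearMap.ker φ) := by
    have h1 := LinearMap.finrank_range_add_finrank_ker φ
    have h2 := Submodule.finrank_le (LinearMap.range φ)
    rw [finrank_fintype_fun_eq_card, Fintype.card_fin] at h1
    rw [finrank_self] at h2
    omega
  obtain ⟨⟨y, hy⟩, hli⟩ := exists_linearIndependent_pair_of_one_lt_finrank hker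
    (x := ⟨v, hv⟩) (fun h => hv0 (congrArg Subtype.val h))
  have hdet : (Matrix.of ![w, y, v])ᵀ.det ≠ 0 := by
    rw [det_transpose]
    intro h0
    obtain ⟨x, hx0, hx⟩ := exists_vecMul_eq_zero_iff.2 h0
    have hx' : x 0 • w + x 1 • y + x 2 • v = 0 := by
      rw [← hx]
      ext i
      simp [vecMul, dotProduct, Fin.sum_univ_three]
    have hy' : f ⬝ᵥ y = 0 := hy
    have h1 : x 0 = 0 := by
      have := congrArg (f ⬝ᵥ ·) hx'
      simp only [dotProduct_add, dotProduct_smul, hv, hy', mul_zero, add_zero, dotProduct_zero,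
        smul_eq_mul, mul_eq_zero, hw, or_false] at this
      exact this
    rw [LinearIndependent.pair_iff] at hli
    have h2 := hli (x 2) (x 1) (Subtype.ext (by
      change x 2 • v + x 1 • y = 0
      rw [← hx', h1, zero_smul, zero_add, add_comm (x 1 • y)]))
    refine hx0 (funext fun i => ?_)
    fin_cases i
    exacts [h1, h2.2, h2.1]
  refine ⟨Matrix.GeneralLinearGroup.mkOfDetNeZero _ hdet, ?_, ?_, ?_⟩
  · ext i; fin_cases i <;> rfl
  · exact hy
  · ext i; fin_cases i <;> rfl

theorem card_cubicSubalgebrasOver_of_mul_eq {R S : Matrix (Fin 3) (Fin 3) K}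
    (g : (Matrix (Fin 3) (Fin 3) K)ˣ) {c : K} (hc : c ≠ 0) (h : R * g = g * (c • S)) :
    Nat.card (cubicSubalgebrasOver R) = Nat.card (cubicSubalgebrasOver S) := by
  have hR : R = conjAlgEquiv g (c • S) := by
    change R = g.1 * (c • S) * (g⁻¹).1
    rw [← h, mul_assoc, Units.mul_inv, mul_one]
  rw [hR, card_cubicSubalgebrasOver_algEquiv _ (rank_conjAlgEquiv g), cubicSubalgebrasOver_smul _ hc]

/-- When `f u ≠ 0`, the matrix `u fᵀ` is conjugate to a multiple of `single 0 0 1`. -/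
theorem card_cubicSubalgebrasOver_vecMulVec_of_ne [Fintype K] {u f : Fin 3 → K}
    (h : f ⬝ᵥ u ≠ 0) : Nat.card (cubicSubalgebrasOver (vecMulVec u f)) =
      Fintype.card K * (Fintype.card K - 1) / 2 := by
  obtain ⟨v, hv0, hv⟩ : ∃ v : Fin 3 → K, v ≠ 0 ∧ f ⬝ᵥ v = 0 := by
    obtain ⟨v, hv0, hv⟩ := exists_mulVec_eq_zero_iff.2 (det_vecMulVec f f)
    refine ⟨v, hv0, ?_⟩
    rw [vecMulVec_mulVec] at hv
    have hf : f ≠ 0 := by rintro rfl; simp at h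
    obtain ⟨i, hi⟩ := Function.ne_iff.1 hf
    have := congrFun hv i
    simp only [Pi.smul_apply, MulOpposite.smul_eq_mul_unop, MulOpposite.unop_op, Pi.zero_apply,
      mul_eq_zero] at this
    exact this.resolve_left hi
  obtain ⟨g, h0, h1, h2⟩ := exists_unit_col h hv0 hv
  rw [← card_cubicSubalgebrasOver_single_zero_zero]
  refine card_cubicSubalgebrasOver_of_mul_eq g h ?_
  rw [vecMulVec_mul]
  ext i j
  have hcol : ∀ j, (f ᵥ* g.1) j = f ⬝ᵥ g.1.col j := fun j => rfl
  have hu : g.1 i 0 = u i := congrFun h0 i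
  rw [vecMulVec_apply, hcol]
  fin_cases j
  · simp [h0, hu, mul_apply, Fin.sum_univ_three]
  · simp [h1, mul_apply]
  · simp [h2, hv, mul_apply]

/-- When `f u = 0`, the matrix `u fᵀ` is conjugate to a multiple of `single 2 0 1`. -/
theorem card_cubicSubalgebrasOver_vecMulVec_of_eq [Fintype K] {u f : Fin 3 → K}
    (hu : u ≠ 0) (hf : f ≠ 0) (h : f ⬝ᵥ u = 0) :
    Nat.card (cubicSubalgebrasOver (vecMulVec u f)) = Fintype.card K - 1 := by
  obtain ⟨k, hk⟩ := Function.ne_iff.1 hf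
  have hw : f ⬝ᵥ Pi.single k 1 ≠ 0 := by simpa using hk
  obtain ⟨g, h0, h1, h2⟩ := exists_unit_col hw hu h
  rw [← card_cubicSubalgebrasOver_single_two_zero]
  refine card_cubicSubalgebrasOver_of_mul_eq g hw ?_
  rw [vecMulVec_mul]
  ext i j
  have hcol : ∀ j, (f ᵥ* g.1) j = f ⬝ᵥ g.1.col j := fun j => rfl
  have hu : g.1 i 2 = u i := congrFun h2 i
  rw [vecMulVec_apply, hcol]
  fin_cases j
  · simp [h0, hu, mul_apply, Fin.sum_univ_three]
  · simp [h1, mul_apply]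
  · simp [h2, h, mul_apply]

end Cubic

/-! ### Coordinates on the projective plane -/

section Plane

variable {p : ℕ} [Fact p.Prime]

/-- Homogeneous coordinates of the point that labels a row of `T_p`. In the block of rows `s`,
where `s : Fin p` stands for the block `s + 1`, the second coordinate is `s⁻¹`; the convention
`0⁻¹ = 0` makes it run through all of `ZMod p`. The block `s = 0` is the one of the identity
matrices. -/
def pointVec : PGIdx p → Fin 3 → ZMod p
  | .inl _ => ![0, 0, 1]
  | .inr (.inl t) => ![0, 1, -((t : ℕ) + 1)]
  | .inr (.inr (s, i)) =>
      ![1, ((s : ℕ) : ZMod p)⁻¹, if (s : ℕ) = 0 then ((i : ℕ) : ZMod p) else -((i : ℕ) + 2)]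

/-- Coordinates of a functional whose kernel is the line that labels a column of `T_p`. As for
points, the convention `0⁻¹ = 0` is used for the columns of the first block of size `p`. -/
def lineVec : PGIdx p → Fin 3 → ZMod p
  | .inl _ => ![1, 0, 0]
  | .inr (.inl s) => ![((s : ℕ) : ZMod p)⁻¹, -1, 0]
  | .inr (.inr (t, j)) => ![(j : ℕ), -((t : ℕ) + 1), -1]

theorem Fin.natCast_zmod_injective {i j : Fin p} (h : ((i : ℕ) : ZMod p) = (j : ℕ)) : i = j := by
  have := congrArg ZMod.val h
  rwa [ZMod.val_natCast_of_lt i.2, ZMod.val_natCast_of_lt j.2, ← Fin.ext_iff] at this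

theorem ZMod.exists_fin_natCast_eq (x : ZMod p) : ∃ i : Fin p, ((i : ℕ) : ZMod p) = x :=
  ⟨⟨x.val, x.val_lt⟩, ZMod.natCast_zmod_val x⟩

theorem Fin.natCast_zmod_eq_zero_iff {i : Fin p} : ((i : ℕ) : ZMod p) = 0 ↔ (i : ℕ) = 0 := by
  rw [ZMod.natCast_eq_zero_iff]
  exact ⟨fun h => Nat.eq_zero_of_dvd_of_lt h i.2, fun h => h ▸ dvd_zero p⟩

theorem pointVec_ne_zero (i : PGIdx p) : pointVec i ≠ 0 := by
  rcases i with _ | t | ⟨s, i⟩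
  · exact fun h => one_ne_zero (congrFun h 2)
  · exact fun h => one_ne_zero (congrFun h 1)
  · exact fun h => one_ne_zero (congrFun h 0)

theorem lineVec_ne_zero (j : PGIdx p) : lineVec j ≠ 0 := by
  rcases j with _ | s | ⟨t, j⟩
  · exact fun h => one_ne_zero (congrFun h 0)
  · exact fun h => neg_ne_zero.2 one_ne_zero (congrFun h 1)
  · exact fun h => neg_ne_zero.2 one_ne_zero (congrFun h 2)

/-- `T_p` is the incidence matrix in these coordinates. -/
theorem incMatrix_eq (i j : PGIdx p) :
    incMatrix p i j = if lineVec j ⬝ᵥ pointVec i = 0 then 1 else 0 := by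
  rcases i with _ | i | ⟨s, i⟩ <;> rcases j with _ | j | ⟨t, j⟩
  · simp [incMatrix, pointVec, lineVec, dotProduct, Fin.sum_univ_three]
  · simp [incMatrix, pointVec, lineVec, dotProduct, Fin.sum_univ_three]
  · simp [incMatrix, pointVec, lineVec, dotProduct, Fin.sum_univ_three]
  · simp [incMatrix, pointVec, lineVec, dotProduct, Fin.sum_univ_three]
  · simp [incMatrix, pointVec, lineVec, dotProduct, Fin.sum_univ_three]
  · have h : (-1 + -((t : ℕ) : ZMod p) + (((i : ℕ) : ZMod p) + 1) = 0) ↔ i = t :=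
      ⟨fun h => Fin.natCast_zmod_injective (by linear_combination h), by rintro rfl; ring⟩
    simp [incMatrix, blockR, pointVec, lineVec, dotProduct, Fin.sum_univ_three, h]
  · simp [incMatrix, pointVec, lineVec, dotProduct, Fin.sum_univ_three]
  · have h : (((j : ℕ) : ZMod p)⁻¹ + -((s : ℕ) : ZMod p)⁻¹ = 0) ↔ j = s :=
      ⟨fun h => Fin.natCast_zmod_injective (inv_injective (by linear_combination h)),
        by rintro rfl; ring⟩
    simp [incMatrix, blockR, pointVec, lineVec, dotProduct, Fin.sum_univ_three, h]
  · by_cases hs : (s : ℕ) = 0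
    · have h : (((j : ℕ) : ZMod p) + -((i : ℕ) : ZMod p) = 0) ↔ i = j :=
        ⟨fun h => Fin.natCast_zmod_injective (by linear_combination -h), by rintro rfl; ring⟩
      simp only [incMatrix, of_apply, hs, if_true, one_apply, pointVec, lineVec, dotProduct,
        Fin.sum_univ_three]
      simp [h]
    · have hs' : ((s : ℕ) : ZMod p) ≠ 0 := mt Fin.natCast_zmod_eq_zero_iff.1 hs
      have h : ((s : ℕ) * (((i : ℕ) + 1) + ((j : ℕ) + 1)) ≡ (t : ℕ) + 1 [MOD p]) ↔
          lineVec (.inr (.inr (t, j))) ⬝ᵥ pointVec (p := p) (.inr (.inr (s, i))) = 0 := by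
        rw [← ZMod.natCast_eq_natCast_iff]
        simp only [lineVec, pointVec, dotProduct, Fin.sum_univ_three, hs, if_false]
        simp
        field_simp
        constructor <;> intro h <;> linear_combination h
      simp only [incMatrix, of_apply, hs, if_false, blockS, h]

theorem exists_eq_smul_pointVec {v : Fin 3 → ZMod p} (hv : v ≠ 0) :
    ∃ (i : PGIdx p) (c : ZMod p), c ≠ 0 ∧ v = c • pointVec i := by
  by_cases h0 : v 0 = 0
  · by_cases h1 : v 1 = 0
    · have h2 : v 2 ≠ 0 := fun h2 => hv (by ext i; fin_cases i <;> assumption)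
      refine ⟨.inl (), v 2, h2, ?_⟩
      ext i
      fin_cases i <;> simp [pointVec, h0, h1]
    · obtain ⟨t, ht⟩ := ZMod.exists_fin_natCast_eq (-(v 2 / v 1) - 1)
      refine ⟨.inr (.inl t), v 1, h1, ?_⟩
      ext i
      fin_cases i <;> simp [pointVec, h0, ht]
      field_simp
  · obtain ⟨s, hs⟩ := ZMod.exists_fin_natCast_eq ((v 1 / v 0)⁻¹)
    by_cases hs0 : (s : ℕ) = 0
    · obtain ⟨i, hi⟩ := ZMod.exists_fin_natCast_eq (v 2 / v 0)
      refine ⟨.inr (.inr (s, i)), v 0, h0, ?_⟩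
      ext k
      fin_cases k <;> simp only [pointVec, hs, if_pos hs0, hi] <;> simp <;> field_simp
    · obtain ⟨i, hi⟩ := ZMod.exists_fin_natCast_eq (-(v 2 / v 0) - 2)
      refine ⟨.inr (.inr (s, i)), v 0, h0, ?_⟩
      ext k
      fin_cases k <;> simp only [pointVec, hs, if_neg hs0, hi] <;> simp <;> field_simp

theorem pointVec_injective_smul {i j : PGIdx p} {c : ZMod p}
    (h : pointVec i = c • pointVec j) : i = j := by
  have h0 := congrFun h 0
  have h1 := congrFun h 1
  have h2 := congrFun h 2
  rcases i with _ | t | ⟨s, i⟩ <;> rcases j with _ | t' | ⟨s', i'⟩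
  · rfl
  · simp [pointVec] at h0 h1 h2
    simp [← h1] at h2
  · simp [pointVec] at h0 h1 h2
    simp [← h0] at h2
  · simp [pointVec] at h0 h1 h2
  · simp [pointVec] at h0 h1 h2
    simp only [← h1, one_mul] at h2
    rw [Fin.natCast_zmod_injective (i := t) (j := t') (by linear_combination -h2)]
  · simp [pointVec] at h0 h1 h2
    simp [← h0] at h1
  · simp [pointVec] at h0 h1 h2
  · simp [pointVec] at h0 h1 h2
  · simp only [pointVec, Pi.smul_apply, smul_eq_mul, cons_val] at h0 h1 h2
    rw [mul_one] at h0
    rw [← h0, one_mul] at h1 h2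
    obtain rfl := Fin.natCast_zmod_injective (inv_injective h1)
    split_ifs at h2
    · rw [Fin.natCast_zmod_injective h2]
    · rw [Fin.natCast_zmod_injective (i := i) (j := i') (by linear_combination -h2)]

theorem exists_eq_smul_lineVec {v : Fin 3 → ZMod p} (hv : v ≠ 0) :
    ∃ (i : PGIdx p) (c : ZMod p), c ≠ 0 ∧ v = c • lineVec i := by
  by_cases h2 : v 2 = 0
  · by_cases h1 : v 1 = 0
    · have h0 : v 0 ≠ 0 := fun h0 => hv (by ext i; fin_cases i <;> assumption)
      refine ⟨.inl (), v 0, h0, ?_⟩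
      ext i
      fin_cases i <;> simp [lineVec, h1, h2]
    · obtain ⟨s, hs⟩ := ZMod.exists_fin_natCast_eq ((-(v 0 / v 1))⁻¹)
      refine ⟨.inr (.inl s), -v 1, neg_ne_zero.2 h1, ?_⟩
      ext i
      fin_cases i <;> simp [lineVec, h2, hs]
      field_simp
  · obtain ⟨j, hj⟩ := ZMod.exists_fin_natCast_eq (-(v 0 / v 2))
    obtain ⟨t, ht⟩ := ZMod.exists_fin_natCast_eq (v 1 / v 2 - 1)
    refine ⟨.inr (.inr (t, j)), -v 2, neg_ne_zero.2 h2, ?_⟩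
    ext i
    fin_cases i <;> simp [lineVec, hj, ht] <;> field_simp

theorem lineVec_injective_smul {i j : PGIdx p} {c : ZMod p}
    (h : lineVec i = c • lineVec j) : i = j := by
  have h0 := congrFun h 0
  have h1 := congrFun h 1
  have h2 := congrFun h 2
  rcases i with _ | s | ⟨t, i⟩ <;> rcases j with _ | s' | ⟨t', i'⟩
  · rfl
  · simp [lineVec] at h0 h1 h2
    simp [h1] at h0
  · simp [lineVec] at h0 h1 h2
    simp [h2] at h0
  · simp [lineVec] at h0 h1 h2
  · simp [lineVec] at h0 h1 h2
    rw [← h1, one_mul] at h0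
    rw [Fin.natCast_zmod_injective (inv_injective h0)]
  · simp [lineVec] at h0 h1 h2
    simp [h2] at h1
  · simp [lineVec] at h0 h1 h2
  · simp [lineVec] at h0 h1 h2
  · simp [lineVec] at h0 h1 h2
    rw [← h2, one_mul] at h0 h1
    rw [Fin.natCast_zmod_injective h0,
      Fin.natCast_zmod_injective (i := t) (j := t') (by linear_combination -h1)]

/-- The points of the projective plane, labelled by the rows of `T_p`. -/
noncomputable def pointEquiv (p : ℕ) [Fact p.Prime] : PGIdx p ≃ PGPoint (ZMod p) :=
  Equiv.ofBijective
    (fun i => ⟨Submodule.span (ZMod p) {pointVec i},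
      finrank_span_singleton (pointVec_ne_zero i)⟩) (by
    constructor
    · intro i j h
      have h' : Submodule.span (ZMod p) {pointVec i} = Submodule.span (ZMod p) {pointVec j} :=
        congrArg Subtype.val h
      have hi : pointVec i ∈ Submodule.span (ZMod p) {pointVec j} :=
        h' ▸ Submodule.mem_span_singleton_self _
      obtain ⟨c, hc⟩ := Submodule.mem_span_singleton.1 hi
      exact pointVec_injective_smul hc.symm
    · rintro ⟨P, hP⟩
      obtain ⟨⟨v, hvP⟩, hv0, hv⟩ := finrank_eq_one_iff'.1 hP
      have hv0' : v ≠ 0 := fun h => hv0 (Subtype.ext h)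
      obtain ⟨i, c, hc, rfl⟩ := exists_eq_smul_pointVec hv0'
      refine ⟨i, Subtype.ext (Submodule.eq_of_le_of_finrank_eq ?_ ?_)⟩
      · rw [Submodule.span_singleton_le_iff_mem]
        exact (Submodule.smul_mem_iff P hc).1 hvP
      · rw [finrank_span_singleton (pointVec_ne_zero i), hP])

/-- The kernel of the functional `f ⬝ᵥ ·`. -/
def dotKer {K : Type*} [Field K] (f : Fin 3 → K) : Submodule K (Fin 3 → K) :=
  LinearMap.ker (dotProductBilin K K f)

theorem mem_dotKer {K : Type*} [Field K] {f v : Fin 3 → K} : v ∈ dotKer f ↔ f ⬝ᵥ v = 0 := Iff.rfl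

theorem dotKer_smul {K : Type*} [Field K] {f : Fin 3 → K} {c : K} (hc : c ≠ 0) :
    dotKer (c • f) = dotKer f := by
  ext v
  rw [mem_dotKer, mem_dotKer, smul_dotProduct, smul_eq_mul, mul_eq_zero, or_iff_right hc]

theorem finrank_dotKer {K : Type*} [Field K] {f : Fin 3 → K} (hf : f ≠ 0) :
    finrank K (dotKer f) = 2 := by
  have hf' : (dotProductBilin K K f : Dual K (Fin 3 → K)) ≠ 0 := by
    intro h
    refine hf (funext fun i => ?_)
    simpa using LinearMap.congr_fun h (Pi.single i 1)
  have h := Module.Dual.finrank_ker_add_one_of_ne_zero hf'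
  rw [finrank_fintype_fun_eq_card, Fintype.card_fin] at h
  exact Nat.succ_injective h

theorem exists_eq_smul_of_dotKer_le {K : Type*} [Field K] {f g : Fin 3 → K} (hg : g ≠ 0)
    (h : dotKer g ≤ dotKer f) : ∃ c : K, f = c • g := by
  obtain ⟨k, hk⟩ := Function.ne_iff.1 hg
  have hk' : g k ≠ 0 := hk
  refine ⟨f k / g k, funext fun i => ?_⟩
  have h1 : f ⬝ᵥ (Pi.single i 1 - (g i / g k) • Pi.single k 1) = 0 := by
    refine mem_dotKer.1 (h (mem_dotKer.2 ?_))
    simp only [dotProduct_sub, dotProduct_smul, dotProduct_single, mul_one, smul_eq_mul]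
    field_simp
    ring
  simp only [dotProduct_sub, dotProduct_smul, dotProduct_single, mul_one, smul_eq_mul] at h1
  simp only [Pi.smul_apply, smul_eq_mul]
  field_simp at h1 ⊢
  linear_combination h1

theorem exists_eq_dotKer {K : Type*} [Field K] {L : Submodule K (Fin 3 → K)}
    (hL : finrank K L = 2) : ∃ f, f ≠ 0 ∧ L = dotKer f := by
  have hlt : L < ⊤ := by
    refine lt_top_iff_ne_top.2 fun h => ?_
    rw [h, finrank_top, finrank_fintype_fun_eq_card, Fintype.card_fin] at hL
    omega
  obtain ⟨φ, hφ, hle⟩ := Submodule.exists_le_ker_of_lt_top L hlt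
  have hdot : ∀ v, (fun i => φ (Pi.single i 1)) ⬝ᵥ v = φ v := by
    intro v
    conv_rhs => rw [← LinearMap.sum_single_apply (fun _ => K) v, map_sum]
    refine Finset.sum_congr rfl fun i _ => ?_
    rw [mul_comm, ← smul_eq_mul, ← map_smul, ← Pi.single_smul, smul_eq_mul, mul_one]
  have hf : (fun i => φ (Pi.single i 1)) ≠ 0 := by
    intro h
    refine hφ (LinearMap.ext fun v => ?_)
    rw [← hdot, h, zero_dotProduct, LinearMap.zero_apply]
  refine ⟨_, hf, Submodule.eq_of_le_of_finrank_eq (fun v hv => ?_) ?_⟩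
  · rw [mem_dotKer, hdot]
    exact hle hv
  · rw [hL, finrank_dotKer hf]

/-- The lines of the projective plane, labelled by the columns of `T_p`. -/
noncomputable def lineEquiv (p : ℕ) [Fact p.Prime] : PGIdx p ≃ PGLine (ZMod p) :=
  Equiv.ofBijective (fun j => ⟨dotKer (lineVec j), finrank_dotKer (lineVec_ne_zero j)⟩) (by
    constructor
    · intro i j h
      obtain ⟨c, hc⟩ := exists_eq_smul_of_dotKer_le (lineVec_ne_zero j)
        (congrArg Subtype.val h).ge
      exact lineVec_injective_smul hc
    · rintro ⟨L, hL⟩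
      obtain ⟨f, hf, rfl⟩ := exists_eq_dotKer hL
      obtain ⟨j, c, hc, rfl⟩ := exists_eq_smul_lineVec hf
      exact ⟨j, Subtype.ext (dotKer_smul hc).symm⟩)

/-! ### The matrices of rank one and the entries of `T_p` -/

/-- The matrix of rank one whose image and kernel are the point and the line of an entry. -/
def entryMatrix (x : PGEntry p) : Matrix (Fin 3) (Fin 3) (ZMod p) :=
  vecMulVec (pointVec x.1) (lineVec x.2)

theorem rank_entryMatrix (x : PGEntry p) : (entryMatrix x).rank = 1 :=
  rank_eq_one_iff_exists_vecMulVec.2 ⟨_, _, pointVec_ne_zero _, lineVec_ne_zero _, rfl⟩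

theorem entryMatrix_ne_zero (x : PGEntry p) : entryMatrix x ≠ 0 := by
  intro h
  have := rank_entryMatrix x
  rw [h, rank_zero] at this
  exact zero_ne_one this

theorem exists_eq_smul_entryMatrix {X : Matrix (Fin 3) (Fin 3) (ZMod p)} (hX : X.rank = 1) :
    ∃ (x : PGEntry p) (c : ZMod p), c ≠ 0 ∧ X = c • entryMatrix x := by
  obtain ⟨u, f, hu, hf, rfl⟩ := rank_eq_one_iff_exists_vecMulVec.1 hX
  obtain ⟨i, c, hc, rfl⟩ := exists_eq_smul_pointVec hu
  obtain ⟨j, d, hd, rfl⟩ := exists_eq_smul_lineVec hf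
  refine ⟨(i, j), d * c, mul_ne_zero hd hc, ?_⟩
  rw [smul_vecMulVec, vecMulVec_smul, smul_smul, entryMatrix, mul_comm]

theorem vecMulVec_eq_smul_vecMulVec {K n : Type*} [Field K] {u v f g : n → K} {c : K}
    (hu : u ≠ 0) (hf : f ≠ 0) (h : vecMulVec u f = c • vecMulVec v g) :
    (∃ a : K, u = a • v) ∧ ∃ b : K, f = b • g := by
  have h' : ∀ i j, u i * f j = c * (v i * g j) := fun i j => congrFun (congrFun h i) j
  constructor
  · obtain ⟨j, hj⟩ := Function.ne_iff.1 hf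
    refine ⟨c * g j * (f j)⁻¹, funext fun i => ?_⟩
    have hj' : f j ≠ 0 := hj
    simp only [Pi.smul_apply, smul_eq_mul]
    field_simp
    linear_combination h' i j
  · obtain ⟨i, hi⟩ := Function.ne_iff.1 hu
    refine ⟨c * v i * (u i)⁻¹, funext fun j => ?_⟩
    have hi' : u i ≠ 0 := hi
    simp only [Pi.smul_apply, smul_eq_mul]
    field_simp
    linear_combination h' i j

theorem entryMatrix_injective_smul {x y : PGEntry p} {c : ZMod p}
    (h : entryMatrix x = c • entryMatrix y) : x = y := by
  obtain ⟨⟨a, ha⟩, b, hb⟩ := vecMulVec_eq_smul_vecMulVec (pointVec_ne_zero _) (lineVec_ne_zero _) h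
  exact Prod.ext (pointVec_injective_smul ha) (lineVec_injective_smul hb)

theorem isE_iff {x : PGEntry p} : IsE x ↔ lineVec x.2 ⬝ᵥ pointVec x.1 = 0 := by
  rw [IsE, incMatrix_eq]
  split_ifs with h <;> simp [h]

theorem isB_iff {x : PGEntry p} : IsB x ↔ lineVec x.2 ⬝ᵥ pointVec x.1 ≠ 0 := by
  rw [IsB, incMatrix_eq]
  split_ifs with h <;> simp [h]

theorem isB_iff_not_isE {x : PGEntry p} : IsB x ↔ ¬ IsE x := by
  rw [isB_iff, isE_iff]

theorem entryMatrix_mul_entryMatrix (x y : PGEntry p) : entryMatrix x * entryMatrix y =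
    (lineVec x.2 ⬝ᵥ pointVec y.1) • vecMulVec (pointVec x.1) (lineVec y.2) := by
  rw [entryMatrix, entryMatrix, vecMulVec_mul_vecMulVec, vecMulVec_smul]

/-- Two distinct points lie on at most one line. -/
theorem eq_of_incident {i i' j j' : PGIdx p} (hi : i ≠ i')
    (h1 : lineVec j ⬝ᵥ pointVec i = 0) (h2 : lineVec j ⬝ᵥ pointVec i' = 0)
    (h3 : lineVec j' ⬝ᵥ pointVec i = 0) (h4 : lineVec j' ⬝ᵥ pointVec i' = 0) : j = j' := by
  have hli : LinearIndependent (ZMod p) ![pointVec i, pointVec i'] := by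
    rw [LinearIndependent.pair_iff' (pointVec_ne_zero i)]
    intro a h
    exact hi (pointVec_injective_smul h.symm).symm
  have hspan : ∀ j : PGIdx p, lineVec j ⬝ᵥ pointVec i = 0 → lineVec j ⬝ᵥ pointVec i' = 0 →
      Submodule.span (ZMod p) (Set.range ![pointVec i, pointVec i']) = dotKer (lineVec j) := by
    intro j h h'
    refine Submodule.eq_of_le_of_finrank_eq ?_ ?_
    · rw [Submodule.span_le]
      rintro _ ⟨k, rfl⟩
      fin_cases k
      exacts [h, h']
    · rw [finrank_span_eq_card hli, finrank_dotKer (lineVec_ne_zero j), Fintype.card_fin]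
  obtain ⟨c, hc⟩ := exists_eq_smul_of_dotKer_le (lineVec_ne_zero j')
    ((hspan j h1 h2).symm.trans (hspan j' h3 h4)).ge
  exact lineVec_injective_smul hc

/-- Two matrices of rank one commute exactly when they are proportional or both products vanish. -/
theorem entryMatrix_commute_iff {x y : PGEntry p} (hxy : x ≠ y) :
    entryMatrix x * entryMatrix y = entryMatrix y * entryMatrix x ↔
      lineVec x.2 ⬝ᵥ pointVec y.1 = 0 ∧ lineVec y.2 ⬝ᵥ pointVec x.1 = 0 := by
  rw [entryMatrix_mul_entryMatrix, entryMatrix_mul_entryMatrix]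
  have hne : ∀ i j : PGIdx p, vecMulVec (pointVec i) (lineVec j) ≠ 0 := fun i j =>
    entryMatrix_ne_zero (i, j)
  constructor
  · intro h
    by_cases ha : lineVec x.2 ⬝ᵥ pointVec y.1 = 0
    · rw [ha, zero_smul] at h
      exact ⟨ha, (smul_eq_zero.1 h.symm).resolve_right (hne _ _)⟩
    · have h' : entryMatrix (x.1, y.2) = ((lineVec x.2 ⬝ᵥ pointVec y.1)⁻¹ *
          (lineVec y.2 ⬝ᵥ pointVec x.1)) • entryMatrix (y.1, x.2) := by
        rw [mul_smul, entryMatrix, entryMatrix, ← h, smul_smul, inv_mul_cancel₀ ha, one_smul]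
      have := entryMatrix_injective_smul h'
      rw [Prod.mk.injEq] at this
      exact absurd (Prod.ext this.1 this.2.symm) hxy
  · rintro ⟨ha, hb⟩
    rw [ha, hb, zero_smul, zero_smul]

/-- The graph on the entries of `T_p` is the commuting graph of the matrices of rank one. Two
entries equal to one for which both products vanish share a row or a column, because two points lie
on at most one line. -/
theorem beGraph_adj_iff {x y : PGEntry p} (hxy : x ≠ y) :
    (beGraph p).Adj x y ↔ entryMatrix x * entryMatrix y = entryMatrix y * entryMatrix x := by
  rw [entryMatrix_commute_iff hxy]
  have hadj : (beGraph p).Adj x y ↔ x ≠ y ∧ ((IsE x ∧ IsE y ∧ (x.1 = y.1 ∨ x.2 = y.2)) ∨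
      ((IsB x ∨ IsB y) ∧ x.1 ≠ y.1 ∧ x.2 ≠ y.2 ∧ IsE (x.1, y.2) ∧ IsE (y.1, x.2))) := Iff.rfl
  rw [hadj]
  constructor
  · rintro ⟨-, ⟨hx, hy, h | h⟩ | ⟨-, -, -, h1, h2⟩⟩
    · rw [isE_iff] at hx hy
      exact ⟨h ▸ hx, h ▸ hy⟩
    · rw [isE_iff] at hx hy
      exact ⟨h ▸ hy, h ▸ hx⟩
    · exact ⟨isE_iff.1 h2, isE_iff.1 h1⟩
  · rintro ⟨ha, hb⟩
    refine ⟨hxy, ?_⟩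
    by_cases hE : IsE x ∧ IsE y
    · refine Or.inl ⟨hE.1, hE.2, ?_⟩
      by_contra! hne
      exact hne.2 (eq_of_incident hne.1 (isE_iff.1 hE.1) ha hb (isE_iff.1 hE.2))
    · refine Or.inr ⟨?_, ?_, ?_, isE_iff.2 hb, isE_iff.2 ha⟩
      · rw [isB_iff_not_isE, isB_iff_not_isE]
        tauto
      · intro h
        exact hE ⟨isE_iff.2 (h ▸ ha), isE_iff.2 (h ▸ hb)⟩
      · intro h
        exact hE ⟨isE_iff.2 (h ▸ hb), isE_iff.2 (h ▸ ha)⟩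

end Plane

/-! ### Dimension and rank-one entries of a vertex -/

theorem PGVertex.vtype_entry_of_isB {p : ℕ} {x : PGEntry p} (h : IsB x) :
    (PGVertex.entry x).vtype = .B := if_pos h

theorem PGVertex.vtype_entry_of_isE {p : ℕ} {x : PGEntry p} (h : IsE x) :
    (PGVertex.entry x).vtype = .E := by
  refine if_neg fun h0 => ?_
  rw [IsE, h0] at h
  exact zero_ne_one h

/-- The invariant of a vertex of the constructed graph: the dimension of the subalgebra that it is
going to represent, and the entries of `T_p` that belong to the rank-one matrices in it. -/
def PGVertex.key {p : ℕ} : PGVertex p → ℕ × Finset (PGEntry p)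
  | .entry x => (2, {x})
  | .typeC _ t _ _ => (3, t)
  | .typeF b e _ _ _ => (3, {b, e})
  | .typeH b _ _ => (3, {b})
  | .typeD e _ _ => (3, {e})
  | .typeG _ => (3, ∅)
  | .typeA => (1, ∅)

section Key

variable {p : ℕ} [Fact p.Prime]

/-- Subrings of an algebra over `ZMod p` are subalgebras. -/
def Subring.toZModSubalgebra {R : Type*} [Ring R] [Algebra (ZMod p) R] (S : Subring R) :
    Subalgebra (ZMod p) R :=
  { S with
    algebraMap_mem' := fun r => by
      rw [← ZMod.natCast_zmod_val r, map_natCast]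
      exact natCast_mem S _ }

theorem Subring.toZModSubalgebra_closure {R : Type*} [Ring R] [Algebra (ZMod p) R] (a : R) :
    (Subring.closure {a}).toZModSubalgebra = Algebra.adjoin (ZMod p) {a} := by
  apply le_antisymm
  · have : Subring.closure {a} ≤ (Algebra.adjoin (ZMod p) {a}).toSubring := by
      rw [Subring.closure_le, Set.singleton_subset_iff]
      exact Algebra.self_mem_adjoin_singleton _ _
    exact this
  · rw [Algebra.adjoin_le_iff, Set.singleton_subset_iff]
    exact Subring.subset_closure (Set.mem_singleton a)

/-- A vertex of the unital compressed commuting graph as a subalgebra of the matrix algebra. -/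
def UCCVertex.subalgebra (v : UCCVertex (Matrix (Fin 3) (Fin 3) (ZMod p))) :
    Subalgebra (ZMod p) (Matrix (Fin 3) (Fin 3) (ZMod p)) :=
  v.1.toZModSubalgebra

theorem UCCVertex.subalgebra_gen (M : Matrix (Fin 3) (Fin 3) (ZMod p)) :
    (UCCVertex.gen M).subalgebra = Algebra.adjoin (ZMod p) {M} :=
  Subring.toZModSubalgebra_closure M

theorem UCCVertex.subalgebra_injective : Function.Injective
    (UCCVertex.subalgebra : UCCVertex (Matrix (Fin 3) (Fin 3) (ZMod p)) → _) := by
  intro v w h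
  exact Subtype.ext (SetLike.ext fun x => (SetLike.ext_iff.1 h x))

theorem UCCVertex.exists_eq_gen {R : Type*} [Ring R] (v : UCCVertex R) :
    ∃ M, v = UCCVertex.gen M := by
  obtain ⟨S, M, rfl⟩ := v
  exact ⟨M, rfl⟩

open Classical in
/-- The entries of `T_p` whose matrices of rank one lie in a given subalgebra. -/
noncomputable def entriesIn (W : Subalgebra (ZMod p) (Matrix (Fin 3) (Fin 3) (ZMod p))) :
    Finset (PGEntry p) :=
  Finset.univ.filter fun x => entryMatrix x ∈ W

theorem mem_entriesIn {W : Subalgebra (ZMod p) (Matrix (Fin 3) (Fin 3) (ZMod p))}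
    {x : PGEntry p} : x ∈ entriesIn W ↔ entryMatrix x ∈ W := by
  simp [entriesIn]

/-- The invariant of a vertex that determines its type and its neighbours other than itself: the
dimension of the subalgebra and the set of its elements of rank one, up to scalars. -/
noncomputable def UCCVertex.key (v : UCCVertex (Matrix (Fin 3) (Fin 3) (ZMod p))) :
    ℕ × Finset (PGEntry p) :=
  (finrank (ZMod p) v.subalgebra, entriesIn v.subalgebra)

theorem UCCVertex.key_gen (M : Matrix (Fin 3) (Fin 3) (ZMod p)) : (UCCVertex.gen M).key =
    ((minpoly (ZMod p) M).natDegree, entriesIn (Algebra.adjoin (ZMod p) {M})) := by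
  rw [key, subalgebra_gen, finrank_adjoin_singleton_eq_natDegree_minpoly]

theorem entriesIn_adjoin_smul_one (c : ZMod p) :
    entriesIn (Algebra.adjoin (ZMod p) {(c • 1 : Matrix (Fin 3) (Fin 3) (ZMod p))}) = ∅ := by
  have hbot : Algebra.adjoin (ZMod p) {(c • 1 : Matrix (Fin 3) (Fin 3) (ZMod p))} ≤ ⊥ := by
    rw [Algebra.adjoin_le_iff, Set.singleton_subset_iff]
    exact Subalgebra.smul_mem _ (one_mem _) _
  refine Finset.eq_empty_of_forall_notMem fun x hx => ?_
  obtain ⟨s, hs⟩ := Algebra.mem_bot.1 (hbot (mem_entriesIn.1 hx))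
  have h2 := natDegree_minpoly_of_rank_eq_one (rank_entryMatrix x)
  rw [← hs, minpoly.eq_X_sub_C_of_algebraMap_inj _ (FaithfulSMul.algebraMap_injective _ _),
    natDegree_X_sub_C] at h2
  omega

theorem adjoin_smul_one_add_smul_entryMatrix (x : PGEntry p) (s : ZMod p) {c : ZMod p}
    (hc : c ≠ 0) : Algebra.adjoin (ZMod p) {s • 1 + c • entryMatrix x} =
      Algebra.adjoin (ZMod p) {entryMatrix x} :=
  Algebra.adjoin_singleton_smul_one_add_smul _ s hc

theorem entriesIn_adjoin_entryMatrix (x : PGEntry p) :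
    entriesIn (Algebra.adjoin (ZMod p) {entryMatrix x}) = {x} := by
  ext y
  rw [mem_entriesIn, Finset.mem_singleton]
  constructor
  · intro h
    obtain ⟨t, ht⟩ := eq_smul_of_mem_adjoin_of_rank_eq_one (rank_entryMatrix x)
      (rank_entryMatrix y) h
    exact entryMatrix_injective_smul ht
  · rintro rfl
    exact Algebra.self_mem_adjoin_singleton _ _

theorem key_gen_entryMatrix (x : PGEntry p) : (UCCVertex.gen (entryMatrix x)).key = (2, {x}) := by
  rw [UCCVertex.key_gen, natDegree_minpoly_of_rank_eq_one (rank_entryMatrix x),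
    entriesIn_adjoin_entryMatrix]

/-- A matrix with quadratic minimal polynomial generates the same vertex as a matrix of rank
one. -/
theorem exists_gen_eq_gen_entryMatrix {M : Matrix (Fin 3) (Fin 3) (ZMod p)}
    (hM : (minpoly (ZMod p) M).natDegree = 2) :
    ∃ (x : PGEntry p) (s c : ZMod p), c ≠ 0 ∧ M = s • 1 + c • entryMatrix x ∧
      UCCVertex.gen M = UCCVertex.gen (entryMatrix x) := by
  obtain ⟨s, R, hR, rfl⟩ := exists_eq_smul_one_add_of_natDegree_eq_two hM
  obtain ⟨x, c, hc, rfl⟩ := exists_eq_smul_entryMatrix hR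
  refine ⟨x, s, c, hc, rfl, UCCVertex.subalgebra_injective ?_⟩
  rw [UCCVertex.subalgebra_gen, UCCVertex.subalgebra_gen,
    adjoin_smul_one_add_smul_entryMatrix x s hc]

theorem charpoly_smul_one_add_entryMatrix (x : PGEntry p) (s c : ZMod p) :
    (s • 1 + c • entryMatrix x).charpoly =
      (Polynomial.X - C s) ^ 2 *
        (Polynomial.X - C (s + c * (lineVec x.2 ⬝ᵥ pointVec x.1))) := by
  have h : s • 1 + c • entryMatrix x =
      vecMulVec (c • pointVec x.1) (lineVec x.2) - scalar (Fin 3) (-s) := by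
    rw [smul_vecMulVec, ← entryMatrix, map_neg, sub_neg_eq_add, add_comm, scalar_apply,
      smul_one_eq_diagonal]
  rw [h, charpoly_sub_scalar, charpoly_vecMulVec, smul_dotProduct, dotProduct_comm]
  simp [smul_eq_C_mul]
  ring

theorem minpoly_smul_one_add_entryMatrix (x : PGEntry p) (s : ZMod p) {c : ZMod p} (hc : c ≠ 0) :
    minpoly (ZMod p) (s • 1 + c • entryMatrix x) =
      (Polynomial.X - C s) *
        (Polynomial.X - C (s + c * (lineVec x.2 ⬝ᵥ pointVec x.1))) := by
  have hdeg : (minpoly (ZMod p) (s • 1 + c • entryMatrix x)).natDegree = 2 := by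
    rw [← finrank_adjoin_singleton_eq_natDegree_minpoly,
      adjoin_smul_one_add_smul_entryMatrix x s hc,
      finrank_adjoin_singleton_eq_natDegree_minpoly,
      natDegree_minpoly_of_rank_eq_one (rank_entryMatrix x)]
  refine (Polynomial.eq_of_monic_of_dvd_of_natDegree_le
    (minpoly.monic (Matrix.isIntegral _)) ((monic_X_sub_C _).mul (monic_X_sub_C _)) ?_ ?_).symm
  · apply minpoly.dvd
    simp only [map_mul, map_sub, aeval_X, aeval_C, Algebra.algebraMap_eq_smul_one,
      add_sub_cancel_left, add_smul, mul_sub, mul_add, smul_mul_smul_comm, mul_one,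
      entryMatrix_mul_entryMatrix]
    rw [entryMatrix]
    module
  · rw [hdeg, (monic_X_sub_C _).natDegree_mul (monic_X_sub_C _), natDegree_X_sub_C,
      natDegree_X_sub_C]

/-! ### Eigenvalues of the rank-one elements -/

/-- `x` is an entry whose matrix lies in `K[M]` and consists of eigenvectors for `t`. -/
def IsEigenEntry (M : Matrix (Fin 3) (Fin 3) (ZMod p)) (t : ZMod p) (x : PGEntry p) : Prop :=
  entryMatrix x ∈ Algebra.adjoin (ZMod p) {M} ∧ M * entryMatrix x = t • entryMatrix x

variable {M : Matrix (Fin 3) (Fin 3) (ZMod p)}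

theorem exists_isEigenEntry_of_isRoot (hM : (minpoly (ZMod p) M).natDegree = 3) {t : ZMod p}
    (ht : M.charpoly.IsRoot t) : ∃ x, IsEigenEntry M t x := by
  obtain ⟨X, hX, hX1, hXt⟩ := exists_rank_eq_one_of_eval_charpoly hM ht
  obtain ⟨x, c, hc, rfl⟩ := exists_eq_smul_entryMatrix hX1
  have hx : entryMatrix x = c⁻¹ • (c • entryMatrix x) := by
    rw [smul_smul, inv_mul_cancel₀ hc, one_smul]
  refine ⟨x, ?_, ?_⟩
  · rw [hx]
    exact Subalgebra.smul_mem _ hX _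
  · rw [hx, mul_smul_comm, hXt, smul_comm]

theorem exists_isEigenEntry_of_mem {x : PGEntry p}
    (hx : entryMatrix x ∈ Algebra.adjoin (ZMod p) {M}) :
    ∃ t, M.charpoly.IsRoot t ∧ IsEigenEntry M t x := by
  obtain ⟨t, ht⟩ := exists_mul_eq_smul_of_mem_adjoin hx (rank_entryMatrix x)
  exact ⟨t, eval_charpoly_eq_zero_of_mul_eq_smul (entryMatrix_ne_zero x) ht, hx, ht⟩

theorem IsEigenEntry.unique (hM : (minpoly (ZMod p) M).natDegree = 3) {t : ZMod p}
    {x y : PGEntry p} (hx : IsEigenEntry M t x) (hy : IsEigenEntry M t y) : x = y := by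
  obtain ⟨c, hc⟩ := eq_smul_of_mul_eq_smul hM hx.1 hy.1 (entryMatrix_ne_zero y) hx.2 hy.2
  exact entryMatrix_injective_smul hc

theorem IsEigenEntry.eigenvalue_unique {t s : ZMod p}
    {x : PGEntry p} (hx : IsEigenEntry M t x) (hy : IsEigenEntry M s x) : t = s :=
  smul_left_injective _ (entryMatrix_ne_zero x) (hx.2.symm.trans hy.2)

/-- The element of rank one that belongs to a root of the minimal polynomial is nilpotent when the
root is multiple, and idempotent up to a scalar otherwise. -/
theorem IsEigenEntry.isE_iff_eval_eq_zero (hM : (minpoly (ZMod p) M).natDegree = 3) {t : ZMod p}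
    {x : PGEntry p} (hx : IsEigenEntry M t x) {d : (ZMod p)[X]}
    (hd : M.charpoly = (Polynomial.X - C t) * d) : IsE x ↔ d.eval t = 0 := by
  obtain ⟨d', c, hc, hd', hX⟩ :=
    exists_eq_smul_aeval_of_mul_eq_smul hM hx.1 (entryMatrix_ne_zero x) hx.2
  obtain rfl : d = d' := by
    rw [minpoly_eq_charpoly_of_natDegree (by rw [hM, Fintype.card_fin]), hd] at hd'
    exact mul_left_cancel₀ (X_sub_C_ne_zero t) hd'
  have h1 : entryMatrix x * entryMatrix x = (c * d.eval t) • entryMatrix x := by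
    rw [hX, smul_mul_smul_comm, aeval_mul_aeval_of_minpoly_eq hd', smul_smul, smul_smul]
    congr 1
    ring
  rw [entryMatrix_mul_entryMatrix] at h1
  have h2 : lineVec x.2 ⬝ᵥ pointVec x.1 = c * d.eval t :=
    smul_left_injective _ (entryMatrix_ne_zero x) h1
  rw [isE_iff, h2, mul_eq_zero, or_iff_right hc]

theorem beGraph_adj_of_mem_adjoin {x y : PGEntry p} (hxy : x ≠ y)
    (hx : entryMatrix x ∈ Algebra.adjoin (ZMod p) {M})
    (hy : entryMatrix y ∈ Algebra.adjoin (ZMod p) {M}) : (beGraph p).Adj x y :=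
  (beGraph_adj_iff hxy).2 (commute_of_mem_adjoin hx hy)

/-- For a cubic minimal polynomial, the entries of `K[M]` correspond to the roots of the
characteristic polynomial. -/
theorem entriesIn_eq (hM : (minpoly (ZMod p) M).natDegree = 3) {S : Finset (PGEntry p)}
    (h1 : ∀ x ∈ S, ∃ t, IsEigenEntry M t x)
    (h2 : ∀ t, M.charpoly.IsRoot t → ∃ x ∈ S, IsEigenEntry M t x) :
    entriesIn (Algebra.adjoin (ZMod p) {M}) = S := by
  ext x
  rw [mem_entriesIn]
  constructor
  · intro hx
    obtain ⟨t, ht, hxt⟩ := exists_isEigenEntry_of_mem hx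
    obtain ⟨y, hy, hyt⟩ := h2 t ht
    rwa [hxt.unique hM hyt]
  · intro hx
    obtain ⟨t, ht⟩ := h1 x hx
    exact ht.1

/-! ### Types of matrices -/

/-- The sets of vertices of types (D) and (H) over an entry, and of type (G), are not empty. -/
theorem index_card_pos (p : ℕ) [Fact p.Prime] : 0 < p - 1 ∧ 0 < p * (p - 1) / 2 ∧
    0 < (p ^ 3 - p) * (p ^ 3 - p ^ 2) / 3 := by
  obtain ⟨k, rfl⟩ : ∃ k, p = k + 2 :=
    ⟨p - 2, by have := (Fact.out : p.Prime).two_le; omega⟩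
  have h1 : (k + 2) ^ 3 - (k + 2) = (k + 2) * (k + 1) * (k + 3) :=
    Nat.sub_eq_of_eq_add (by ring)
  have h2 : (k + 2) ^ 3 - (k + 2) ^ 2 = (k + 2) ^ 2 * (k + 1) :=
    Nat.sub_eq_of_eq_add (by ring)
  refine ⟨by omega, ?_, ?_⟩
  · refine Nat.div_pos ?_ (by norm_num)
    have : k + 2 - 1 = k + 1 := by omega
    rw [this]
    nlinarith
  · rw [h1, h2]
    refine Nat.div_pos ?_ (by norm_num)
    calc 3 ≤ k + 3 := by omega
      _ ≤ _ := Nat.le_mul_of_pos_left _ (by positivity)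
      _ ≤ _ := Nat.le_mul_of_pos_right _ (by positivity)

/-- The generator of a vertex has one of the eight types, and the invariant of the vertex is that
of a vertex of the constructed graph of the same type. -/
theorem exists_key_eq_and_isOfType (M : Matrix (Fin 3) (Fin 3) (ZMod p)) :
    ∃ w : PGVertex p, w.key = (UCCVertex.gen M).key ∧ M.IsOfType w.vtype := by
  have h3 := M.natDegree_minpoly_le
  have h0 := minpoly.natDegree_pos (Matrix.isIntegral M (R := ZMod p))
  rcases (show (minpoly (ZMod p) M).natDegree = 1 ∨ (minpoly (ZMod p) M).natDegree = 2 ∨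
    (minpoly (ZMod p) M).natDegree = 3 by omega) with hM | hM | hM
  · obtain ⟨c, rfl⟩ := exists_eq_smul_one_of_natDegree_eq_one hM
    refine ⟨.typeA, ?_, c, ?_, ?_⟩
    · rw [UCCVertex.key_gen, hM, entriesIn_adjoin_smul_one, PGVertex.key]
    · rw [smul_one_eq_diagonal, charpoly_diagonal]
      simp
    · rw [← Algebra.algebraMap_eq_smul_one,
        minpoly.eq_X_sub_C_of_algebraMap_inj _ (FaithfulSMul.algebraMap_injective _ _)]
  · obtain ⟨x, s, c, hc, hMe, hgen⟩ := exists_gen_eq_gen_entryMatrix hM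
    refine ⟨.entry x, by rw [hgen, key_gen_entryMatrix, PGVertex.key], ?_⟩
    by_cases hE : IsE x
    · rw [PGVertex.vtype_entry_of_isE hE]
      rw [isE_iff] at hE
      refine ⟨s, ?_, ?_⟩
      · rw [hMe, charpoly_smul_one_add_entryMatrix, hE, mul_zero, add_zero]
        ring
      · rw [hMe, minpoly_smul_one_add_entryMatrix _ _ hc, hE, mul_zero, add_zero]
        ring
    · rw [PGVertex.vtype_entry_of_isB (isB_iff_not_isE.2 hE)]
      rw [isE_iff] at hE
      refine ⟨s + c * (lineVec x.2 ⬝ᵥ pointVec x.1), s, ?_, ?_, ?_⟩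
      · rw [Ne, add_eq_left]
        exact mul_ne_zero hc hE
      · rw [hMe, charpoly_smul_one_add_entryMatrix]
        ring
      · rw [hMe, minpoly_smul_one_add_entryMatrix _ _ hc]
        ring
  · have hmc := minpoly_eq_charpoly_of_natDegree (by rw [hM, Fintype.card_fin])
    have hmon := M.charpoly_monic
    have hdeg : M.charpoly.natDegree = 3 := by rw [← hmc, hM]
    obtain ⟨hD, hH, hG⟩ := index_card_pos p
    rw [UCCVertex.key_gen, hM]
    by_cases hroot : ∃ t, M.charpoly.IsRoot t
    swap
    · push Not at hroot
      refine ⟨.typeG ⟨0, hG⟩, ?_, ?_, hmc⟩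
      · rw [PGVertex.key, entriesIn_eq hM (S := ∅)]
        · simp
        · exact fun t ht => absurd ht (hroot t)
      · refine irreducible_of_degree_le_three_of_not_isRoot ?_ hroot
        rw [hdeg]
        decide
    obtain ⟨t, ht⟩ := hroot
    obtain ⟨d, hd⟩ := dvd_iff_isRoot.2 ht
    have hdm : d.Monic := (monic_X_sub_C t).of_mul_monic_left (hd ▸ hmon)
    have hd2 : d.natDegree = 2 := by
      rw [hd, (monic_X_sub_C t).natDegree_mul hdm, natDegree_X_sub_C] at hdeg
      omega
    by_cases hroot2 : ∃ s, d.IsRoot s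
    swap
    · push Not at hroot2
      obtain ⟨x, hx⟩ := exists_isEigenEntry_of_isRoot hM ht
      have hB : IsB x := by
        rw [isB_iff_not_isE, hx.isE_iff_eval_eq_zero hM hd]
        exact hroot2 t
      refine ⟨.typeH x hB ⟨0, hH⟩, ?_, t, d, ?_, hd, hmc.trans hd⟩
      · rw [PGVertex.key, entriesIn_eq hM (S := {x})]
        · exact fun y hy => ⟨t, Finset.mem_singleton.1 hy ▸ hx⟩
        · intro s hs
          rw [hd, IsRoot, eval_mul, mul_eq_zero, or_iff_left (show d.eval s ≠ 0 from hroot2 s)] at hs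
          obtain rfl : s = t := by simpa [sub_eq_zero] using hs
          exact ⟨x, Finset.mem_singleton_self x, hx⟩
      · refine irreducible_of_degree_le_three_of_not_isRoot ?_ hroot2
        rw [hd2]
        decide
    obtain ⟨s, hs⟩ := hroot2
    obtain ⟨l, hl⟩ := dvd_iff_isRoot.2 hs
    have hlm : l.Monic := (monic_X_sub_C s).of_mul_monic_left (hl ▸ hdm)
    have hl1 : l.natDegree = 1 := by
      rw [hl, (monic_X_sub_C s).natDegree_mul hlm, natDegree_X_sub_C] at hd2
      omega
    obtain ⟨r, rfl⟩ : ∃ r, l = Polynomial.X - C r :=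
      ⟨-l.coeff 0, by rw [hlm.eq_X_add_C hl1]; simp⟩
    rw [hl] at hd
    -- two equal roots `a` and a third root `b`
    have hdouble : ∀ a b : ZMod p, M.charpoly = (Polynomial.X - C a) ^ 2 * (Polynomial.X - C b) →
        ∃ w : PGVertex p, w.key = (3, entriesIn (Algebra.adjoin (ZMod p) {M})) ∧
          M.IsOfType w.vtype := by
      intro a b hab
      have hra : M.charpoly.IsRoot a := by simp [hab]
      have hrb : M.charpoly.IsRoot b := by simp [hab]
      have hroots : ∀ c, M.charpoly.IsRoot c → c = a ∨ c = b := by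
        intro c hc
        simpa [hab, sub_eq_zero] using hc
      obtain ⟨x, hx⟩ := exists_isEigenEntry_of_isRoot hM hra
      obtain ⟨y, hy⟩ := exists_isEigenEntry_of_isRoot hM hrb
      have hE : IsE x := by
        rw [hx.isE_iff_eval_eq_zero hM
          (d := (Polynomial.X - C a) * (Polynomial.X - C b)) (by rw [hab]; ring)]
        simp
      by_cases heq : a = b
      · subst heq
        have hcube : M.charpoly = (Polynomial.X - C a) ^ 3 := by rw [hab]; ring
        refine ⟨.typeD x hE ⟨0, hD⟩, ?_, a, hcube, hmc.trans hcube⟩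
        rw [PGVertex.key, entriesIn_eq hM (S := {x})]
        · exact fun y hy => ⟨a, Finset.mem_singleton.1 hy ▸ hx⟩
        · intro c hc
          obtain rfl : c = a := (hroots c hc).elim id id
          exact ⟨x, Finset.mem_singleton_self x, hx⟩
      · have hB : IsB y := by
          rw [isB_iff_not_isE, hy.isE_iff_eval_eq_zero hM
            (d := (Polynomial.X - C a) ^ 2) (by rw [hab]; ring)]
          simpa [sub_eq_zero] using Ne.symm heq
        have hne : y ≠ x := by
          rintro rfl
          exact heq (hx.eigenvalue_unique hy)
        refine ⟨.typeF y x hB hE (beGraph_adj_of_mem_adjoin hne hy.1 hx.1), ?_,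
          a, b, heq, hab, hmc.trans hab⟩
        rw [PGVertex.key, entriesIn_eq hM (S := {y, x})]
        · intro z hz
          rw [Finset.mem_insert, Finset.mem_singleton] at hz
          rcases hz with rfl | rfl
          exacts [⟨b, hy⟩, ⟨a, hx⟩]
        · intro c hc
          rcases hroots c hc with rfl | rfl
          exacts [⟨x, by simp, hx⟩, ⟨y, by simp, hy⟩]
    by_cases hts : t = s
    · subst hts
      exact hdouble t r (by rw [hd]; ring)
    by_cases htr : t = r
    · subst htr
      exact hdouble t s (by rw [hd]; ring)
    by_cases hsr : s = r
    · subst hsr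
      exact hdouble s t (by rw [hd]; ring)
    have hd' : M.charpoly = (Polynomial.X - C t) * (Polynomial.X - C s) * (Polynomial.X - C r) := by
      rw [hd]; ring
    have hroots : ∀ c, M.charpoly.IsRoot c ↔ c = t ∨ c = s ∨ c = r := by
      intro c
      rw [hd']
      simp [sub_eq_zero, or_assoc]
    obtain ⟨x, hx⟩ := exists_isEigenEntry_of_isRoot hM ((hroots t).2 (by simp))
    obtain ⟨y, hy⟩ := exists_isEigenEntry_of_isRoot hM ((hroots s).2 (by simp))
    obtain ⟨z, hz⟩ := exists_isEigenEntry_of_isRoot hM ((hroots r).2 (by simp))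
    have hxB : IsB x := by
      rw [isB_iff_not_isE, hx.isE_iff_eval_eq_zero hM hd]
      simp [sub_eq_zero, hts, htr]
    have hyB : IsB y := by
      rw [isB_iff_not_isE, hy.isE_iff_eval_eq_zero hM
        (d := (Polynomial.X - C t) * (Polynomial.X - C r)) (by rw [hd]; ring)]
      simp [sub_eq_zero, Ne.symm hts, hsr]
    have hzB : IsB z := by
      rw [isB_iff_not_isE, hz.isE_iff_eval_eq_zero hM
        (d := (Polynomial.X - C t) * (Polynomial.X - C s)) (by rw [hd]; ring)]
      simp [sub_eq_zero, Ne.symm htr, Ne.symm hsr]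
    have hxy : x ≠ y := by rintro rfl; exact hts (hx.eigenvalue_unique hy)
    have hxz : x ≠ z := by rintro rfl; exact htr (hx.eigenvalue_unique hz)
    have hyz : y ≠ z := by rintro rfl; exact hsr (hy.eigenvalue_unique hz)
    have hp : 3 ≤ p := by
      have h := Finset.card_le_univ ({t, s, r} : Finset (ZMod p))
      rwa [Finset.card_eq_three.2 ⟨t, s, r, hts, htr, hsr, rfl⟩, ZMod.card] at h
    classical
    refine ⟨.typeC hp {x, y, z} ?_ ?_, ?_, t, s, r, hts, htr, hsr, hd', hmc.trans hd'⟩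
    · rw [SimpleGraph.is3Clique_triple_iff]
      exact ⟨beGraph_adj_of_mem_adjoin hxy hx.1 hy.1, beGraph_adj_of_mem_adjoin hxz hx.1 hz.1,
        beGraph_adj_of_mem_adjoin hyz hy.1 hz.1⟩
    · simp [hxB, hyB, hzB]
    · rw [PGVertex.key, entriesIn_eq hM (S := {x, y, z})]
      · intro w hw
        simp only [Finset.mem_insert, Finset.mem_singleton] at hw
        rcases hw with rfl | rfl | rfl
        exacts [⟨t, hx⟩, ⟨s, hy⟩, ⟨r, hz⟩]
      · intro c hc
        rcases (hroots c).1 hc with rfl | rfl | rfl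
        exacts [⟨x, by simp, hx⟩, ⟨y, by simp, hy⟩, ⟨z, by simp, hz⟩]

end Key

/-! ### Vertices of the constructed graph with a given invariant -/

section Fibre

variable {p : ℕ}

theorem PGVertex.key_eq_one_iff {w : PGVertex p} : w.key.1 = 1 ↔ w = .typeA := by
  cases w <;> simp [PGVertex.key]

theorem PGVertex.key_eq_entry_iff {w : PGVertex p} {x : PGEntry p} :
    w.key = (2, {x}) ↔ w = .entry x := by
  cases w <;> simp [PGVertex.key]

theorem PGVertex.key_eq_empty_iff {w : PGVertex p} : w.key = (3, ∅) ↔ ∃ k, w = .typeG k := by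
  cases w with
  | typeC hp t ht hB =>
    simp only [PGVertex.key, Prod.mk.injEq, true_and, reduceCtorEq, exists_false, iff_false]
    rintro rfl
    simpa using ht.card_eq
  | _ => simp [PGVertex.key]

theorem not_isB_of_isE {x : PGEntry p} (hE : IsE x) : ¬ IsB x := fun hB =>
  zero_ne_one (hB.symm.trans hE)

theorem PGVertex.key_eq_singleton_B_iff {w : PGVertex p} {b : PGEntry p} (hb : IsB b) :
    w.key = (3, {b}) ↔ ∃ k, w = .typeH b hb k := by
  cases w with
  | typeC hp t ht hB =>
    simp only [PGVertex.key, Prod.mk.injEq, true_and, reduceCtorEq, exists_false, iff_false]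
    rintro rfl
    simpa using ht.card_eq
  | typeF b' e hb' he hbe =>
    simp only [PGVertex.key, Prod.mk.injEq, true_and, reduceCtorEq, exists_false, iff_false]
    intro h
    have := congrArg Finset.card h
    rw [Finset.card_pair hbe.1, Finset.card_singleton] at this
    omega
  | typeD e he k =>
    simp only [PGVertex.key, Prod.mk.injEq, true_and, reduceCtorEq, exists_false, iff_false,
      Finset.singleton_inj]
    rintro rfl
    exact not_isB_of_isE he hb
  | typeH b' hb' k =>
    simp only [PGVertex.key, Prod.mk.injEq, true_and, Finset.singleton_inj]
    constructor
    · rintro rfl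
      exact ⟨k, rfl⟩
    · rintro ⟨k', h⟩
      cases h
      rfl
  | _ => simp [PGVertex.key]

theorem PGVertex.key_eq_singleton_E_iff {w : PGVertex p} {e : PGEntry p} (he : IsE e) :
    w.key = (3, {e}) ↔ ∃ k, w = .typeD e he k := by
  cases w with
  | typeC hp t ht hB =>
    simp only [PGVertex.key, Prod.mk.injEq, true_and, reduceCtorEq, exists_false, iff_false]
    rintro rfl
    simpa using ht.card_eq
  | typeF b' e hb' he hbe =>
    simp only [PGVertex.key, Prod.mk.injEq, true_and, reduceCtorEq, exists_false, iff_false]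
    intro h
    have := congrArg Finset.card h
    rw [Finset.card_pair hbe.1, Finset.card_singleton] at this
    omega
  | typeH b hb k =>
    simp only [PGVertex.key, Prod.mk.injEq, true_and, reduceCtorEq, exists_false, iff_false,
      Finset.singleton_inj]
    rintro rfl
    exact not_isB_of_isE he hb
  | typeD e' he' k =>
    simp only [PGVertex.key, Prod.mk.injEq, true_and, Finset.singleton_inj]
    constructor
    · rintro rfl
      exact ⟨k, rfl⟩
    · rintro ⟨k', h⟩
      cases h
      rfl
  | _ => simp [PGVertex.key]

theorem PGVertex.key_eq_pair_iff {w : PGVertex p} {b e : PGEntry p} (hb : IsB b) (he : IsE e)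
    (hbe : (beGraph p).Adj b e) : w.key = (3, {b, e}) ↔ w = .typeF b e hb he hbe := by
  have hcard := Finset.card_pair hbe.1
  constructor
  · intro h
    have h2 : w.key.2 = {b, e} := congrArg Prod.snd h
    cases w with
    | typeC hp t ht hB =>
      change t = _ at h2
      have := ht.card_eq
      rw [h2, hcard] at this
      omega
    | typeF b' e' hb' he' hbe' =>
      change ({b', e'} : Finset _) = {b, e} at h2
      have h3 : b' ∈ ({b, e} : Finset (PGEntry p)) := h2 ▸ by simp
      have h4 : e' ∈ ({b, e} : Finset (PGEntry p)) := h2 ▸ by simp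
      rw [Finset.mem_insert, Finset.mem_singleton] at h3 h4
      obtain rfl : b' = b := h3.resolve_right (by rintro rfl; exact not_isB_of_isE he hb')
      obtain rfl : e' = e := h4.resolve_left (by rintro rfl; exact not_isB_of_isE he' hb)
      rfl
    | typeH b' hb' k =>
      change {b'} = _ at h2
      rw [← h2, Finset.card_singleton] at hcard
      omega
    | typeD e' he' k =>
      change {e'} = _ at h2
      rw [← h2, Finset.card_singleton] at hcard
      omega
    | typeG k =>
      change ∅ = _ at h2
      rw [← h2, Finset.card_empty] at hcard
      omega
    | _ => simp [PGVertex.key] at h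
  · rintro rfl
    rfl

theorem PGVertex.key_eq_triangle_iff {w : PGVertex p} {t : Finset (PGEntry p)} (hp : 3 ≤ p)
    (ht : (beGraph p).IsNClique 3 t) (hB : ∀ x ∈ t, IsB x) :
    w.key = (3, t) ↔ w = .typeC hp t ht hB := by
  have hcard := ht.card_eq
  constructor
  · intro h
    have h2 : w.key.2 = t := congrArg Prod.snd h
    cases w with
    | typeC hp' t' ht' hB' =>
      obtain rfl : t' = t := h2
      rfl
    | typeF b' e' hb' he' hbe' =>
      change {b', e'} = _ at h2
      rw [← h2, Finset.card_pair hbe'.1] at hcard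
      omega
    | typeH b' hb' k =>
      change {b'} = _ at h2
      rw [← h2, Finset.card_singleton] at hcard
      omega
    | typeD e' he' k =>
      change {e'} = _ at h2
      rw [← h2, Finset.card_singleton] at hcard
      omega
    | typeG k =>
      change ∅ = _ at h2
      rw [← h2, Finset.card_empty] at hcard
      omega
    | _ => simp [PGVertex.key] at h
  · rintro rfl
    rfl

theorem PGVertex.card_key_le (w : PGVertex p) : w.key.2.card ≤ 3 := by
  cases w with
  | typeC hp t ht hB => exact ht.card_eq.le
  | typeF b e hb he hbe => exact Finset.card_le_two.trans (by norm_num)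
  | _ => simp [PGVertex.key]

/-- The type of a vertex depends on its invariant only. -/
theorem PGVertex.vtype_eq_of_key_eq {v w : PGVertex p} (h : v.key = w.key) :
    v.vtype = w.vtype := by
  cases w with
  | entry x => rw [PGVertex.key_eq_entry_iff.1 h]
  | typeC hp t ht hB => rw [(PGVertex.key_eq_triangle_iff hp ht hB).1 h]
  | typeF b e hb he hbe => rw [(PGVertex.key_eq_pair_iff hb he hbe).1 h]
  | typeH b hb k =>
    obtain ⟨k', rfl⟩ := (PGVertex.key_eq_singleton_B_iff hb).1 h
    rfl
  | typeD e he k =>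
    obtain ⟨k', rfl⟩ := (PGVertex.key_eq_singleton_E_iff he).1 h
    rfl
  | typeG k =>
    obtain ⟨k', rfl⟩ := PGVertex.key_eq_empty_iff.1 h
    rfl
  | typeA => rw [PGVertex.key_eq_one_iff.1 (congrArg Prod.fst h)]

theorem card_fibre_eq_one {α β : Type*} {f : α → β} {b : β} (a : α) (h : ∀ x, f x = b ↔ x = a) :
    Nat.card {x // f x = b} = 1 := by
  rw [Nat.card_eq_one_iff_exists]
  exact ⟨⟨a, (h a).2 rfl⟩, fun x => Subtype.ext ((h x.1).1 x.2)⟩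

theorem card_fibre_eq_of_injective {α β : Type*} {f : α → β} {b : β} {n : ℕ} (g : Fin n → α)
    (hg : Function.Injective g) (h : ∀ x, f x = b ↔ ∃ k, x = g k) :
    Nat.card {x // f x = b} = n := by
  rw [← Nat.card_fin n]
  symm
  refine Nat.card_eq_of_bijective (fun k => (⟨g k, (h _).2 ⟨k, rfl⟩⟩ : {x // f x = b})) ⟨?_, ?_⟩
  · exact fun k k' hk => hg (congrArg Subtype.val hk)
  · rintro ⟨x, hx⟩
    obtain ⟨k, rfl⟩ := (h x).1 hx
    exact ⟨k, rfl⟩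

/-! ### Subalgebras with a given invariant -/

variable [Fact p.Prime]

theorem UCCVertex.subalgebra_mem_cubicSubalgebras_iff
    {v : UCCVertex (Matrix (Fin 3) (Fin 3) (ZMod p))} :
    v.subalgebra ∈ cubicSubalgebras (ZMod p) ↔ v.key.1 = 3 := by
  constructor
  · exact finrank_of_mem_cubicSubalgebras
  · intro h
    obtain ⟨M, rfl⟩ := v.exists_eq_gen
    rw [UCCVertex.key_gen] at h
    exact ⟨M, h, UCCVertex.subalgebra_gen M⟩

theorem UCCVertex.exists_subalgebra_eq
    {W : Subalgebra (ZMod p) (Matrix (Fin 3) (Fin 3) (ZMod p))}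
    (hW : W ∈ cubicSubalgebras (ZMod p)) :
    ∃ v : UCCVertex (Matrix (Fin 3) (Fin 3) (ZMod p)), v.subalgebra = W := by
  obtain ⟨M, -, rfl⟩ := hW
  exact ⟨UCCVertex.gen M, UCCVertex.subalgebra_gen M⟩

theorem entriesIn_eq_singleton_iff
    {W : Subalgebra (ZMod p) (Matrix (Fin 3) (Fin 3) (ZMod p))} {x : PGEntry p} :
    entriesIn W = {x} ↔
      entryMatrix x ∈ W ∧ ∀ X ∈ W, X.rank = 1 → ∃ t : ZMod p, X = t • entryMatrix x := by
  constructor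
  · intro h
    refine ⟨mem_entriesIn.1 (h ▸ Finset.mem_singleton_self x), fun X hX hr => ?_⟩
    obtain ⟨y, c, hc, rfl⟩ := exists_eq_smul_entryMatrix hr
    have hy : y ∈ entriesIn W := by
      rw [mem_entriesIn]
      have := Subalgebra.smul_mem _ hX c⁻¹
      rwa [smul_smul, inv_mul_cancel₀ hc, one_smul] at this
    rw [h, Finset.mem_singleton] at hy
    exact ⟨c, by rw [hy]⟩
  · rintro ⟨hx, h⟩
    ext y
    rw [Finset.mem_singleton, mem_entriesIn]
    constructor
    · intro hy
      obtain ⟨t, ht⟩ := h _ hy (rank_entryMatrix y)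
      exact entryMatrix_injective_smul ht
    · rintro rfl
      exact hx

theorem entriesIn_eq_empty_iff
    {W : Subalgebra (ZMod p) (Matrix (Fin 3) (Fin 3) (ZMod p))} :
    entriesIn W = ∅ ↔ ∀ X ∈ W, X.rank ≠ 1 := by
  constructor
  · intro h X hX hr
    obtain ⟨y, c, hc, rfl⟩ := exists_eq_smul_entryMatrix hr
    refine Finset.notMem_empty y (h ▸ mem_entriesIn.2 ?_)
    have := Subalgebra.smul_mem _ hX c⁻¹
    rwa [smul_smul, inv_mul_cancel₀ hc, one_smul] at this
  · intro h
    exact Finset.eq_empty_of_forall_notMem fun y hy =>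
      h _ (mem_entriesIn.1 hy) (rank_entryMatrix y)

/-- Vertices whose invariant is `(3, S)` are cubic subalgebras with the entries `S`. -/
theorem card_fibre_cubic {S : Finset (PGEntry p)}
    {F : Set (Subalgebra (ZMod p) (Matrix (Fin 3) (Fin 3) (ZMod p)))}
    (hF : ∀ W, W ∈ F ↔ W ∈ cubicSubalgebras (ZMod p) ∧ entriesIn W = S) :
    Nat.card {v : UCCVertex (Matrix (Fin 3) (Fin 3) (ZMod p)) // v.key = (3, S)} = Nat.card F := by
  have hv : ∀ v : UCCVertex (Matrix (Fin 3) (Fin 3) (ZMod p)),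
      v.key = (3, S) ↔ v.subalgebra ∈ F := by
    intro v
    rw [hF, UCCVertex.subalgebra_mem_cubicSubalgebras_iff, Prod.ext_iff]
    rfl
  refine Nat.card_eq_of_bijective (fun v => (⟨v.1.subalgebra, (hv v.1).1 v.2⟩ : F)) ⟨?_, ?_⟩
  · exact fun v w h => Subtype.ext (UCCVertex.subalgebra_injective (congrArg Subtype.val h))
  · rintro ⟨W, hW⟩
    obtain ⟨v, rfl⟩ := UCCVertex.exists_subalgebra_eq ((hF W).1 hW).1
    exact ⟨⟨v, (hv v).2 hW⟩, rfl⟩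

theorem card_fibre_singleton (x : PGEntry p) :
    Nat.card {v : UCCVertex (Matrix (Fin 3) (Fin 3) (ZMod p)) // v.key = (3, {x})} =
      Nat.card (cubicSubalgebrasOver (entryMatrix x)) :=
  card_fibre_cubic fun W => by rw [entriesIn_eq_singleton_iff]; rfl

theorem card_fibre_empty :
    Nat.card {v : UCCVertex (Matrix (Fin 3) (Fin 3) (ZMod p)) // v.key = (3, ∅)} =
      (p ^ 3 - p) * (p ^ 3 - p ^ 2) / 3 := by
  have h := card_cubicSubalgebrasOverNone (ZMod p)
  rw [ZMod.card] at h
  rw [← h]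
  exact card_fibre_cubic fun W => by rw [entriesIn_eq_empty_iff]; rfl

/-- Two different elements of rank one cannot lie in a common subalgebra `K[N]` of dimension at
most two. -/
theorem natDegree_minpoly_eq_three_of_entries {N : Matrix (Fin 3) (Fin 3) (ZMod p)}
    {x y : PGEntry p} (hxy : x ≠ y) (hx : entryMatrix x ∈ Algebra.adjoin (ZMod p) {N})
    (hy : entryMatrix y ∈ Algebra.adjoin (ZMod p) {N}) : (minpoly (ZMod p) N).natDegree = 3 := by
  rw [← mem_entriesIn] at hx hy
  rcases N.natDegree_minpoly_eq_three_or with h | ⟨c, rfl⟩ | ⟨c, R, hR, rfl⟩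
  · exact h
  · rw [entriesIn_adjoin_smul_one] at hx
    exact absurd hx (Finset.notMem_empty x)
  · obtain ⟨z, d, hd, rfl⟩ := exists_eq_smul_entryMatrix hR
    rw [adjoin_smul_one_add_smul_entryMatrix z c hd, entriesIn_adjoin_entryMatrix,
      Finset.mem_singleton] at hx hy
    exact absurd (hx.trans hy.symm) hxy

theorem UCCVertex.eq_gen_of_mem {v : UCCVertex (Matrix (Fin 3) (Fin 3) (ZMod p))}
    {N : Matrix (Fin 3) (Fin 3) (ZMod p)} (hv : v.key.1 = 3) (hN : N ∈ v.subalgebra)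
    (h3 : (minpoly (ZMod p) N).natDegree = 3) : v = UCCVertex.gen N := by
  apply UCCVertex.subalgebra_injective
  rw [UCCVertex.subalgebra_gen]
  exact eq_adjoin_of_mem_cubicSubalgebras
    (UCCVertex.subalgebra_mem_cubicSubalgebras_iff.2 hv) hN h3

theorem UCCVertex.entryMatrix_mem_of_mem_key {v : UCCVertex (Matrix (Fin 3) (Fin 3) (ZMod p))}
    {x : PGEntry p} (h : x ∈ v.key.2) : entryMatrix x ∈ v.subalgebra := mem_entriesIn.1 h

/-- The multiple of the matrix of a zero entry that is idempotent (for an entry equal to one, the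
scalar is `0⁻¹ = 0`, and this is the zero matrix). -/
noncomputable def entryIdempotent (x : PGEntry p) : Matrix (Fin 3) (Fin 3) (ZMod p) :=
  (lineVec x.2 ⬝ᵥ pointVec x.1)⁻¹ • entryMatrix x

theorem entryIdempotent_mul_entryMatrix {x : PGEntry p} (hx : IsB x) :
    entryIdempotent x * entryMatrix x = entryMatrix x := by
  rw [entryIdempotent, smul_mul_assoc, entryMatrix_mul_entryMatrix, ← entryMatrix, smul_smul,
    inv_mul_cancel₀ (isB_iff.1 hx), one_smul]

theorem entryIdempotent_mul_self {x : PGEntry p} (hx : IsB x) :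
    entryIdempotent x * entryIdempotent x = entryIdempotent x := by
  have h : entryIdempotent x * ((lineVec x.2 ⬝ᵥ pointVec x.1)⁻¹ • entryMatrix x) =
      (lineVec x.2 ⬝ᵥ pointVec x.1)⁻¹ • entryMatrix x := by
    rw [mul_smul_comm, entryIdempotent_mul_entryMatrix hx]
  exact h

theorem entryMatrix_eq_smul_entryIdempotent {x : PGEntry p} (hx : IsB x) :
    entryMatrix x = (lineVec x.2 ⬝ᵥ pointVec x.1) • entryIdempotent x := by
  rw [entryIdempotent, smul_smul, mul_inv_cancel₀ (isB_iff.1 hx), one_smul]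

theorem entryMatrix_mul_self_of_isE {x : PGEntry p} (hx : IsE x) :
    entryMatrix x * entryMatrix x = 0 := by
  rw [entryMatrix_mul_entryMatrix, isE_iff.1 hx, zero_smul]

theorem entryMatrix_mul_eq_zero_of_adj {x y : PGEntry p} (h : (beGraph p).Adj x y) :
    entryMatrix x * entryMatrix y = 0 ∧ entryMatrix y * entryMatrix x = 0 := by
  have h0 := (entryMatrix_commute_iff h.1).1 ((beGraph_adj_iff h.1).1 h)
  rw [entryMatrix_mul_entryMatrix, entryMatrix_mul_entryMatrix, h0.1, h0.2, zero_smul, zero_smul]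
  exact ⟨rfl, rfl⟩

/-- Three pairwise orthogonal idempotents `P`, `Q`, `R` of rank one lie in exactly one cubic
subalgebra, the one generated by `P - Q`. -/
theorem exists_unique_key_eq_triangle {t : Finset (PGEntry p)} (hp : 3 ≤ p)
    (ht : (beGraph p).IsNClique 3 t) (hB : ∀ x ∈ t, IsB x) :
    ∃ v₀ : UCCVertex (Matrix (Fin 3) (Fin 3) (ZMod p)), ∀ v, v.key = (3, t) ↔ v = v₀ := by
  obtain ⟨x, y, z, hxy, hxz, hyz, rfl⟩ := SimpleGraph.is3Clique_iff.1 ht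
  have hx : IsB x := hB x (by simp)
  have hy : IsB y := hB y (by simp)
  have h2 : (2 : ZMod p) ≠ 0 := by
    intro h
    have h' : ((2 : ℕ) : ZMod p) = 0 := by exact_mod_cast h
    rw [ZMod.natCast_eq_zero_iff] at h'
    have := Nat.le_of_dvd (by norm_num) h'
    omega
  set P := entryIdempotent x with hP
  set Q := entryIdempotent y with hQ
  have hPP : P * P = P := entryIdempotent_mul_self hx
  have hQQ : Q * Q = Q := entryIdempotent_mul_self hy
  have hPQ : P * Q = 0 := by
    rw [hP, hQ, entryIdempotent, entryIdempotent, smul_mul_smul_comm,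
      (entryMatrix_mul_eq_zero_of_adj hxy).1, smul_zero]
  have hQP : Q * P = 0 := by
    rw [hP, hQ, entryIdempotent, entryIdempotent, smul_mul_smul_comm,
      (entryMatrix_mul_eq_zero_of_adj hxy).2, smul_zero]
  set N := P - Q with hN
  have hNN : N * N = P + Q := by
    rw [hN, sub_mul, mul_sub, mul_sub, hPP, hQQ, hPQ, hQP]
    abel
  have hNmem := Algebra.self_mem_adjoin_singleton (ZMod p) N
  have hPmem : P ∈ Algebra.adjoin (ZMod p) {N} := by
    have h : P = (2 : ZMod p)⁻¹ • (N * N + N) := by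
      rw [hNN, hN, add_add_sub_cancel, ← two_smul (ZMod p), smul_smul, inv_mul_cancel₀ h2, one_smul]
    rw [h]
    exact Subalgebra.smul_mem _ (add_mem (mul_mem hNmem hNmem) hNmem) _
  have hQmem : Q ∈ Algebra.adjoin (ZMod p) {N} := by
    have h : Q = P - N := by rw [hN, sub_sub_cancel]
    rw [h]
    exact sub_mem hPmem hNmem
  have hxmem : entryMatrix x ∈ Algebra.adjoin (ZMod p) {N} := by
    rw [entryMatrix_eq_smul_entryIdempotent hx]
    exact Subalgebra.smul_mem _ hPmem _
  have hymem : entryMatrix y ∈ Algebra.adjoin (ZMod p) {N} := by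
    rw [entryMatrix_eq_smul_entryIdempotent hy]
    exact Subalgebra.smul_mem _ hQmem _
  have h3 := natDegree_minpoly_eq_three_of_entries hxy.1 hxmem hymem
  have hzmem : entryMatrix z ∈ Algebra.adjoin (ZMod p) {N} := by
    refine mem_adjoin_of_commute (by rw [h3, Fintype.card_fin]) ?_
    rw [hN, hP, hQ, entryIdempotent, entryIdempotent, mul_sub, sub_mul, mul_smul_comm,
      mul_smul_comm, smul_mul_assoc, smul_mul_assoc, (entryMatrix_mul_eq_zero_of_adj hxz).1,
      (entryMatrix_mul_eq_zero_of_adj hxz).2, (entryMatrix_mul_eq_zero_of_adj hyz).1,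
      (entryMatrix_mul_eq_zero_of_adj hyz).2]
  refine ⟨UCCVertex.gen N, fun v => ⟨fun hv => ?_, ?_⟩⟩
  · refine UCCVertex.eq_gen_of_mem (congrArg Prod.fst hv) (sub_mem ?_ ?_) h3
    · exact Subalgebra.smul_mem _ (UCCVertex.entryMatrix_mem_of_mem_key (by rw [hv]; simp)) _
    · exact Subalgebra.smul_mem _ (UCCVertex.entryMatrix_mem_of_mem_key (by rw [hv]; simp)) _
  · rintro rfl
    obtain ⟨w, hw, -⟩ := exists_key_eq_and_isOfType N
    have hcard := w.card_key_le
    rw [hw] at hcard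
    rw [UCCVertex.key_gen, h3] at hcard ⊢
    congr 1
    symm
    refine Finset.eq_of_subset_of_card_le ?_ (by rw [ht.card_eq]; exact hcard)
    intro a ha
    rw [mem_entriesIn]
    simp only [Finset.mem_insert, Finset.mem_singleton] at ha
    rcases ha with rfl | rfl | rfl
    exacts [hxmem, hymem, hzmem]

/-- An idempotent `P` and a nilpotent `N` of rank one with `P * N = N * P = 0` lie in exactly one
cubic subalgebra, the one generated by `P + N`. -/
theorem exists_unique_key_eq_pair {b e : PGEntry p} (hb : IsB b) (he : IsE e)
    (hbe : (beGraph p).Adj b e) :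
    ∃ v₀ : UCCVertex (Matrix (Fin 3) (Fin 3) (ZMod p)), ∀ v, v.key = (3, {b, e}) ↔ v = v₀ := by
  set P := entryIdempotent b with hP
  set N := entryMatrix e with hN
  have hPN : P * N = 0 := by
    rw [hP, entryIdempotent, smul_mul_assoc, (entryMatrix_mul_eq_zero_of_adj hbe).1, smul_zero]
  have hNP : N * P = 0 := by
    rw [hP, entryIdempotent, mul_smul_comm, (entryMatrix_mul_eq_zero_of_adj hbe).2, smul_zero]
  have hsq : (P + N) * (P + N) = P := by
    rw [add_mul, mul_add, mul_add, entryIdempotent_mul_self hb, hPN, hNP,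
      entryMatrix_mul_self_of_isE he, add_zero, add_zero, add_zero]
  have hmem := Algebra.self_mem_adjoin_singleton (ZMod p) (P + N)
  have hPmem : P ∈ Algebra.adjoin (ZMod p) {P + N} := by
    have h := mul_mem hmem hmem
    rwa [hsq] at h
  have hNmem : N ∈ Algebra.adjoin (ZMod p) {P + N} := by
    have h := sub_mem hmem hPmem
    rwa [add_sub_cancel_left] at h
  have hbmem : entryMatrix b ∈ Algebra.adjoin (ZMod p) {P + N} := by
    rw [entryMatrix_eq_smul_entryIdempotent hb]
    exact Subalgebra.smul_mem _ hPmem _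
  have h3 := natDegree_minpoly_eq_three_of_entries hbe.1 hbmem hNmem
  refine ⟨UCCVertex.gen (P + N), fun v => ⟨fun hv => ?_, ?_⟩⟩
  · refine UCCVertex.eq_gen_of_mem (congrArg Prod.fst hv) (add_mem ?_ ?_) h3
    · exact Subalgebra.smul_mem _ (UCCVertex.entryMatrix_mem_of_mem_key (by rw [hv]; simp)) _
    · exact UCCVertex.entryMatrix_mem_of_mem_key (by rw [hv]; simp)
  · rintro rfl
    obtain ⟨w, hw, -⟩ := exists_key_eq_and_isOfType (P + N)
    have hbw : b ∈ w.key.2 := by rw [hw]; exact mem_entriesIn.2 (by rwa [UCCVertex.subalgebra_gen])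
    have hew : e ∈ w.key.2 := by rw [hw]; exact mem_entriesIn.2 (by rwa [UCCVertex.subalgebra_gen])
    rw [← hw]
    have h1 : w.key.1 = 3 := by rw [hw, UCCVertex.key_gen, h3]
    cases w with
    | typeC hp t ht hB => exact absurd (hB e hew) (not_isB_of_isE he)
    | typeF b' e' hb' he' hbe' =>
      refine Prod.ext rfl (Finset.eq_of_subset_of_card_le ?_ ?_).symm
      · intro a ha
        rw [Finset.mem_insert, Finset.mem_singleton] at ha
        rcases ha with rfl | rfl
        exacts [hbw, hew]
      · rw [Finset.card_pair hbe.1]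
        exact Finset.card_le_two
    | typeH b' hb' k =>
      exact absurd ((Finset.mem_singleton.1 hbw).trans (Finset.mem_singleton.1 hew).symm) hbe.1
    | typeD e' he' k =>
      exact absurd ((Finset.mem_singleton.1 hbw).trans (Finset.mem_singleton.1 hew).symm) hbe.1
    | typeG k => exact absurd hbw (Finset.notMem_empty b)
    | entry x => simp [PGVertex.key] at h1
    | typeA => simp [PGVertex.key] at h1

theorem UCCVertex.key_eq_entry_iff {v : UCCVertex (Matrix (Fin 3) (Fin 3) (ZMod p))}
    {x : PGEntry p} : v.key = (2, {x}) ↔ v = UCCVertex.gen (entryMatrix x) := by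
  constructor
  · intro h
    obtain ⟨M, rfl⟩ := v.exists_eq_gen
    rw [UCCVertex.key_gen] at h
    obtain ⟨y, s, c, hc, hMe, hgen⟩ := exists_gen_eq_gen_entryMatrix (congrArg Prod.fst h)
    rw [← UCCVertex.key_gen, hgen, key_gen_entryMatrix, Prod.mk.injEq, Finset.singleton_inj] at h
    rw [hgen, h.2]
  · rintro rfl
    exact key_gen_entryMatrix x

theorem UCCVertex.key_eq_one_iff {v : UCCVertex (Matrix (Fin 3) (Fin 3) (ZMod p))} :
    v.key = (1, ∅) ↔ v = UCCVertex.gen 0 := by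
  have hkey : (UCCVertex.gen (0 : Matrix (Fin 3) (Fin 3) (ZMod p))).key = (1, ∅) := by
    have h := entriesIn_adjoin_smul_one (0 : ZMod p)
    rw [zero_smul] at h
    rw [UCCVertex.key_gen, h, minpoly.zero, natDegree_X]
  constructor
  · intro h
    apply UCCVertex.subalgebra_injective
    have h1 : finrank (ZMod p) v.subalgebra = 1 := congrArg Prod.fst h
    have h2 : finrank (ZMod p) (UCCVertex.gen (0 : Matrix (Fin 3) (Fin 3) (ZMod p))).subalgebra = 1 :=
      congrArg Prod.fst hkey
    rw [Subalgebra.finrank_eq_one_iff] at h1 h2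
    rw [h1, h2]
  · rintro rfl
    exact hkey

/-- Both graphs have the same number of vertices with a given invariant. -/
theorem card_fibre_eq (w : PGVertex p) :
    ∃ n, n ≠ 0 ∧
      Nat.card {v : UCCVertex (Matrix (Fin 3) (Fin 3) (ZMod p)) // v.key = w.key} = n ∧
      Nat.card {w' : PGVertex p // w'.key = w.key} = n := by
  obtain ⟨hD, hH, hG⟩ := index_card_pos p
  cases w with
  | entry x =>
    exact ⟨1, one_ne_zero, card_fibre_eq_one _ fun _ => UCCVertex.key_eq_entry_iff,
      card_fibre_eq_one _ fun _ => PGVertex.key_eq_entry_iff⟩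
  | typeC hp t ht hB =>
    obtain ⟨v₀, hv⟩ := exists_unique_key_eq_triangle hp ht hB
    exact ⟨1, one_ne_zero, card_fibre_eq_one v₀ hv,
      card_fibre_eq_one _ fun _ => PGVertex.key_eq_triangle_iff hp ht hB⟩
  | typeF b e hb he hbe =>
    obtain ⟨v₀, hv⟩ := exists_unique_key_eq_pair hb he hbe
    exact ⟨1, one_ne_zero, card_fibre_eq_one v₀ hv,
      card_fibre_eq_one _ fun _ => PGVertex.key_eq_pair_iff hb he hbe⟩
  | typeH b hb k =>
    refine ⟨_, hH.ne', (card_fibre_singleton b).trans ?_, card_fibre_eq_of_injective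
      (fun k => .typeH b hb k) (fun k k' h => by cases h; rfl)
      fun _ => PGVertex.key_eq_singleton_B_iff hb⟩
    rw [entryMatrix, card_cubicSubalgebrasOver_vecMulVec_of_ne (isB_iff.1 hb), ZMod.card]
  | typeD e he k =>
    refine ⟨_, hD.ne', (card_fibre_singleton e).trans ?_, card_fibre_eq_of_injective
      (fun k => .typeD e he k) (fun k k' h => by cases h; rfl)
      fun _ => PGVertex.key_eq_singleton_E_iff he⟩
    rw [entryMatrix, card_cubicSubalgebrasOver_vecMulVec_of_eq (pointVec_ne_zero _)
      (lineVec_ne_zero _) (isE_iff.1 he), ZMod.card]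
  | typeG k =>
    exact ⟨_, hG.ne', card_fibre_empty, card_fibre_eq_of_injective
      (fun k => .typeG k) (fun k k' h => by cases h; rfl) fun _ => PGVertex.key_eq_empty_iff⟩
  | typeA =>
    refine ⟨1, one_ne_zero, card_fibre_eq_one _ fun _ => UCCVertex.key_eq_one_iff,
      card_fibre_eq_one .typeA fun w => ⟨fun h => PGVertex.key_eq_one_iff.1 (congrArg Prod.fst h),
        by rintro rfl; rfl⟩⟩

/-- The fibres over `k` are finite of the same size if `k` is the invariant of some vertex of the
constructed graph, and otherwise both are empty. -/
theorem nonempty_fibre_equiv (k : ℕ × Finset (PGEntry p)) :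
    Nonempty ({v : UCCVertex (Matrix (Fin 3) (Fin 3) (ZMod p)) // v.key = k} ≃
      {w : PGVertex p // w.key = k}) := by
  by_cases h : ∃ w : PGVertex p, w.key = k
  · obtain ⟨w, rfl⟩ := h
    obtain ⟨n, hn, h1, h2⟩ := card_fibre_eq w
    have := Nat.finite_of_card_ne_zero (h1.trans_ne hn)
    have := Nat.finite_of_card_ne_zero (h2.trans_ne hn)
    exact ⟨(Finite.equivFinOfCardEq h1).trans (Finite.equivFinOfCardEq h2).symm⟩
  · have : IsEmpty {w : PGVertex p // w.key = k} := ⟨fun w => h ⟨w.1, w.2⟩⟩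
    have : IsEmpty {v : UCCVertex (Matrix (Fin 3) (Fin 3) (ZMod p)) // v.key = k} := by
      refine ⟨fun v => ?_⟩
      obtain ⟨M, hM⟩ := v.1.exists_eq_gen
      obtain ⟨w, hw, -⟩ := exists_key_eq_and_isOfType M
      exact h ⟨w, by rw [hw, ← hM, v.2]⟩
    exact ⟨Equiv.equivOfIsEmpty _ _⟩

end Fibre

/-! ### Adjacency -/

section Adjacency

variable {p : ℕ}

/-- Adjacency of two different vertices in terms of their invariants. -/
def KeyAdj (k l : ℕ × Finset (PGEntry p)) : Prop :=
  k.1 = 1 ∨ l.1 = 1 ∨ (k.1 = 2 ∧ l.1 = 2 ∧ ∃ x ∈ k.2, ∃ y ∈ l.2, (beGraph p).Adj x y) ∨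
    (k.1 = 3 ∧ l.1 = 2 ∧ l.2 ⊆ k.2) ∨ (k.1 = 2 ∧ l.1 = 3 ∧ k.2 ⊆ l.2)

theorem KeyAdj.symm {k l : ℕ × Finset (PGEntry p)} (h : KeyAdj k l) : KeyAdj l k := by
  rcases h with h | h | ⟨h1, h2, x, hx, y, hy, hxy⟩ | h | h
  · exact Or.inr (Or.inl h)
  · exact Or.inl h
  · exact Or.inr (Or.inr (Or.inl ⟨h2, h1, y, hy, x, hx, hxy.symm⟩))
  · exact Or.inr (Or.inr (Or.inr (Or.inr ⟨h.2.1, h.1, h.2.2⟩)))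
  · exact Or.inr (Or.inr (Or.inr (Or.inl ⟨h.2.1, h.1, h.2.2⟩)))

theorem PGVertex.keyAdj_of_joined {v w : PGVertex p} (h : PGVertex.Joined v w) :
    KeyAdj v.key w.key := by
  cases h with
  | be x y hxy =>
    exact Or.inr (Or.inr (Or.inl ⟨rfl, rfl, x, Finset.mem_singleton_self x, y,
      Finset.mem_singleton_self y, hxy⟩))
  | universal w hw => exact Or.inl rfl
  | _ =>
    refine Or.inr (Or.inr (Or.inr (Or.inl ⟨rfl, rfl, ?_⟩)))
    simp_all [PGVertex.key]

theorem PGVertex.joined_entry_of_mem {v : PGVertex p} {x : PGEntry p} (h3 : v.key.1 = 3)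
    (hx : x ∈ v.key.2) : PGVertex.Joined v (.entry x) := by
  cases v with
  | entry y => simp [PGVertex.key] at h3
  | typeC hp t ht hB => exact .triangle hp t ht hB x hx
  | typeF b e hb he hbe =>
    simp only [PGVertex.key, Finset.mem_insert, Finset.mem_singleton] at hx
    rcases hx with rfl | rfl
    exacts [.edgeB _ _ hb he hbe, .edgeE _ _ hb he hbe]
  | typeH b hb k =>
    obtain rfl := Finset.mem_singleton.1 hx
    exact .pendantH _ hb k
  | typeD e he k =>
    obtain rfl := Finset.mem_singleton.1 hx
    exact .pendantD _ he k
  | typeG k => exact absurd hx (Finset.notMem_empty x)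
  | typeA => simp [PGVertex.key] at h3

theorem PGVertex.eq_entry_of_key {v : PGVertex p} (h : v.key.1 = 2) : ∃ x, v = .entry x := by
  cases v <;> simp_all [PGVertex.key]

/-- In the constructed graph, adjacency of different vertices depends on their invariants only. -/
theorem constructedGraph_adj_iff {v w : PGVertex p} :
    (constructedGraph p).Adj v w ↔ v = w ∨ KeyAdj v.key w.key := by
  have hadj : (constructedGraph p).Adj v w ↔
      v = w ∨ v ≠ w ∧ (PGVertex.Joined v w ∨ PGVertex.Joined w v) := Iff.rfl
  rw [hadj]
  constructor
  · rintro (h | ⟨-, h | h⟩)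
    · exact Or.inl h
    · exact Or.inr (PGVertex.keyAdj_of_joined h)
    · exact Or.inr (PGVertex.keyAdj_of_joined h).symm
  · rintro (h | h)
    · exact Or.inl h
    by_cases hvw : v = w
    · exact Or.inl hvw
    refine Or.inr ⟨hvw, ?_⟩
    rcases h with h | h | ⟨h1, h2, x, hx, y, hy, hxy⟩ | ⟨h1, h2, h⟩ | ⟨h1, h2, h⟩
    · rw [PGVertex.key_eq_one_iff] at h
      exact Or.inl (h ▸ .universal w (by rw [← h]; exact Ne.symm hvw))
    · rw [PGVertex.key_eq_one_iff] at h
      exact Or.inr (h ▸ .universal v (by rw [← h]; exact hvw))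
    · obtain ⟨x', rfl⟩ := PGVertex.eq_entry_of_key h1
      obtain ⟨y', rfl⟩ := PGVertex.eq_entry_of_key h2
      obtain rfl := Finset.mem_singleton.1 hx
      obtain rfl := Finset.mem_singleton.1 hy
      exact Or.inl (.be _ _ hxy)
    · obtain ⟨y, rfl⟩ := PGVertex.eq_entry_of_key h2
      exact Or.inl (PGVertex.joined_entry_of_mem h1 (h (Finset.mem_singleton_self y)))
    · obtain ⟨x, rfl⟩ := PGVertex.eq_entry_of_key h1
      exact Or.inr (PGVertex.joined_entry_of_mem h2 (h (Finset.mem_singleton_self x)))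

variable [Fact p.Prime]

theorem UCCVertex.eq_gen_entryMatrix_of_key {v : UCCVertex (Matrix (Fin 3) (Fin 3) (ZMod p))}
    (h : v.key.1 = 2) : ∃ x, v = UCCVertex.gen (entryMatrix x) := by
  obtain ⟨M, rfl⟩ := v.exists_eq_gen
  rw [UCCVertex.key_gen] at h
  obtain ⟨x, -, -, -, -, hx⟩ := exists_gen_eq_gen_entryMatrix h
  exact ⟨x, hx⟩

theorem UCCVertex.eq_gen_zero_of_key {v : UCCVertex (Matrix (Fin 3) (Fin 3) (ZMod p))}
    (h : v.key.1 = 1) : v = UCCVertex.gen 0 := by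
  obtain ⟨M, rfl⟩ := v.exists_eq_gen
  rw [UCCVertex.key_gen] at h
  obtain ⟨c, rfl⟩ := exists_eq_smul_one_of_natDegree_eq_one h
  rw [← UCCVertex.key_eq_one_iff, UCCVertex.key_gen,
    show (minpoly (ZMod p) (c • (1 : Matrix (Fin 3) (Fin 3) (ZMod p)))).natDegree = 1 from h,
    entriesIn_adjoin_smul_one]

theorem UCCVertex.key_fst_eq_or (v : UCCVertex (Matrix (Fin 3) (Fin 3) (ZMod p))) :
    v.key.1 = 1 ∨ v.key.1 = 2 ∨ v.key.1 = 3 := by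
  obtain ⟨M, rfl⟩ := v.exists_eq_gen
  rw [UCCVertex.key_gen]
  have h1 := M.natDegree_minpoly_le
  have h2 := minpoly.natDegree_pos (Matrix.isIntegral M (R := ZMod p))
  dsimp only
  omega

/-- The neighbours of a cubic vertex `K[M]` are its subalgebras, because `K[M]` is the centralizer
of `M`. -/
theorem uccGraph_adj_iff_mem {M N : Matrix (Fin 3) (Fin 3) (ZMod p)}
    (hM : (minpoly (ZMod p) M).natDegree = 3) :
    (uccGraph _).Adj (UCCVertex.gen M) (UCCVertex.gen N) ↔
      N ∈ Algebra.adjoin (ZMod p) {M} := by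
  rw [uccGraph_adj_gen]
  constructor
  · exact fun h => mem_adjoin_of_commute (by rw [hM, Fintype.card_fin]) h.symm
  · exact fun h => (commute_of_mem_adjoin h (Algebra.self_mem_adjoin_singleton _ _)).symm

theorem uccGraph_adj_gen_entryMatrix_iff {M : Matrix (Fin 3) (Fin 3) (ZMod p)}
    (hM : (minpoly (ZMod p) M).natDegree = 3) (x : PGEntry p) :
    (uccGraph _).Adj (UCCVertex.gen M) (UCCVertex.gen (entryMatrix x)) ↔
      KeyAdj (UCCVertex.gen M).key (UCCVertex.gen (entryMatrix x)).key := by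
  rw [uccGraph_adj_iff_mem hM, key_gen_entryMatrix, UCCVertex.key_gen, hM]
  simp [KeyAdj, mem_entriesIn]

/-- In the commuting graph, adjacency of different vertices depends on their invariants, by the same
rule as in the constructed graph. -/
theorem uccGraph_adj_iff (v w : UCCVertex (Matrix (Fin 3) (Fin 3) (ZMod p))) :
    (uccGraph _).Adj v w ↔ v = w ∨ KeyAdj v.key w.key := by
  have hsymm : ∀ v w : UCCVertex (Matrix (Fin 3) (Fin 3) (ZMod p)),
      (uccGraph _).Adj v w ↔ (uccGraph _).Adj w v :=
    fun v w => ⟨(uccGraph _).symm v w, (uccGraph _).symm w v⟩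
  rcases v.key_fst_eq_or with hv | hv | hv
  · obtain rfl := UCCVertex.eq_gen_zero_of_key hv
    obtain ⟨N, rfl⟩ := w.exists_eq_gen
    rw [uccGraph_adj_gen, zero_mul, mul_zero]
    exact iff_of_true rfl (Or.inr (Or.inl hv))
  · obtain ⟨x, rfl⟩ := UCCVertex.eq_gen_entryMatrix_of_key hv
    rcases w.key_fst_eq_or with hw | hw | hw
    · obtain rfl := UCCVertex.eq_gen_zero_of_key hw
      rw [uccGraph_adj_gen, zero_mul, mul_zero]
      exact iff_of_true rfl (Or.inr (Or.inr (Or.inl hw)))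
    · obtain ⟨y, rfl⟩ := UCCVertex.eq_gen_entryMatrix_of_key hw
      have heq : UCCVertex.gen (entryMatrix x) = UCCVertex.gen (entryMatrix y) ↔ x = y := by
        constructor
        · intro h
          have h2 := congrArg UCCVertex.key h
          rw [key_gen_entryMatrix, key_gen_entryMatrix, Prod.mk.injEq, Finset.singleton_inj] at h2
          exact h2.2
        · rintro rfl
          rfl
      rw [uccGraph_adj_gen, heq, key_gen_entryMatrix, key_gen_entryMatrix]
      by_cases hxy : x = y
      · subst hxy
        simp
      · rw [← beGraph_adj_iff hxy]
        simp [KeyAdj, hxy]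
    · obtain ⟨N, rfl⟩ := w.exists_eq_gen
      have hN : (minpoly (ZMod p) N).natDegree = 3 := by rwa [UCCVertex.key_gen] at hw
      rw [hsymm, uccGraph_adj_gen_entryMatrix_iff hN]
      constructor
      · exact fun h => Or.inr h.symm
      · rintro (h | h)
        · rw [← h, hv] at hw
          omega
        · exact h.symm
  · obtain ⟨M, rfl⟩ := v.exists_eq_gen
    have hM : (minpoly (ZMod p) M).natDegree = 3 := by rwa [UCCVertex.key_gen] at hv
    rcases w.key_fst_eq_or with hw | hw | hw
    · obtain rfl := UCCVertex.eq_gen_zero_of_key hw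
      rw [uccGraph_adj_gen, zero_mul, mul_zero]
      exact iff_of_true rfl (Or.inr (Or.inr (Or.inl hw)))
    · obtain ⟨y, rfl⟩ := UCCVertex.eq_gen_entryMatrix_of_key hw
      rw [uccGraph_adj_gen_entryMatrix_iff hM]
      refine ⟨Or.inr, ?_⟩
      rintro (h | h)
      · rw [← h, hv] at hw
        omega
      · exact h
    · obtain ⟨N, rfl⟩ := w.exists_eq_gen
      have hN : (minpoly (ZMod p) N).natDegree = 3 := by rwa [UCCVertex.key_gen] at hw
      have hnot : ¬ KeyAdj (UCCVertex.gen M).key (UCCVertex.gen N).key := by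
        simp [KeyAdj, hv, hw]
      rw [uccGraph_adj_iff_mem hM, or_iff_left hnot]
      constructor
      · intro h
        exact UCCVertex.eq_gen_of_mem hv (by rwa [UCCVertex.subalgebra_gen]) hN
      · intro h
        rw [← UCCVertex.subalgebra_gen, h, UCCVertex.subalgebra_gen]
        exact Algebra.self_mem_adjoin_singleton _ _

/-! ### Uniqueness of the type -/

/-- The degree of a polynomial, its number of roots and its number of distinct roots. -/
noncomputable def rootPattern {K : Type*} [Field K] (f : K[X]) : ℕ × ℕ × ℕ := by
  classical exact (f.natDegree, Multiset.card f.roots, f.roots.toFinset.card)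

/-- The root pattern of the minimal polynomial of a matrix of a given type. -/
def VType.pattern : VType → ℕ × ℕ × ℕ
  | .A => (1, 1, 1)
  | .B => (2, 2, 2)
  | .C => (3, 3, 3)
  | .D => (3, 3, 1)
  | .E => (2, 2, 1)
  | .F => (3, 3, 2)
  | .G => (3, 0, 0)
  | .H => (3, 1, 1)

theorem VType.pattern_injective : Function.Injective VType.pattern := by
  intro S T h
  cases S <;> cases T <;> first | rfl | simp [VType.pattern] at h

theorem rootPattern_multiset_prod {K : Type*} [Field K] [DecidableEq K] (s : Multiset K) :
    rootPattern (s.map fun a => Polynomial.X - C a).prod =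
      (Multiset.card s, Multiset.card s, s.toFinset.card) := by
  rw [rootPattern, roots_multiset_prod_X_sub_C, natDegree_multiset_prod_X_sub_C_eq_card]
  congr!

theorem Matrix.IsOfType.rootPattern_minpoly {K : Type*} [Field K] {M : Matrix (Fin 3) (Fin 3) K}
    {T : VType} (h : M.IsOfType T) : rootPattern (minpoly K M) = T.pattern := by
  classical
  have hdeg : M.charpoly.natDegree = 3 := by rw [M.charpoly_natDegree_eq_dim, Fintype.card_fin]
  cases T with
  | A =>
    obtain ⟨a, -, h⟩ := h
    have := rootPattern_multiset_prod {a}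
    simpa [h, VType.pattern] using this
  | B =>
    obtain ⟨a, b, hab, -, h⟩ := h
    have := rootPattern_multiset_prod {a, b}
    simpa [h, VType.pattern, hab] using this
  | C =>
    obtain ⟨a, b, c, hab, hac, hbc, -, h⟩ := h
    have := rootPattern_multiset_prod {a, b, c}
    simpa [h, VType.pattern, hab, hac, hbc, mul_assoc] using this
  | D =>
    obtain ⟨a, -, h⟩ := h
    have := rootPattern_multiset_prod {a, a, a}
    simpa [h, VType.pattern, pow_succ, mul_assoc] using this
  | E =>
    obtain ⟨a, -, h⟩ := h
    have := rootPattern_multiset_prod {a, a}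
    simpa [h, VType.pattern, pow_succ, mul_assoc] using this
  | F =>
    obtain ⟨a, b, hab, -, h⟩ := h
    have := rootPattern_multiset_prod {a, a, b}
    simpa [h, VType.pattern, pow_succ, mul_assoc, hab] using this
  | G =>
    obtain ⟨hirr, h⟩ := h
    have hr : M.charpoly.roots = 0 :=
      (irreducible_iff_roots_eq_zero_of_degree_le_three (by omega) (by omega)).1 hirr
    simp [rootPattern, h, hr, hdeg, VType.pattern]
  | H =>
    obtain ⟨a, q, hq, hc, h⟩ := h
    have hqd : q.natDegree = 2 := by
      rw [hc, natDegree_mul (X_sub_C_ne_zero a) hq.ne_zero, natDegree_X_sub_C] at hdeg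
      omega
    have hr : q.roots = 0 :=
      (irreducible_iff_roots_eq_zero_of_degree_le_three (by omega) (by omega)).1 hq
    have hroots : ((Polynomial.X - C a) * q).roots = {a} := by
      rw [roots_mul (mul_ne_zero (X_sub_C_ne_zero a) hq.ne_zero), hr, roots_X_sub_C, add_zero]
    rw [hc] at hdeg
    simp [rootPattern, h, hroots, hdeg, VType.pattern]

theorem Matrix.IsOfType.unique {K : Type*} [Field K] {M : Matrix (Fin 3) (Fin 3) K}
    {S T : VType} (hS : M.IsOfType S) (hT : M.IsOfType T) : S = T :=
  VType.pattern_injective (hS.rootPattern_minpoly.symm.trans hT.rootPattern_minpoly)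

/-- A matrix of rank one is determined up to a scalar by its image and its kernel. -/
theorem gen_eq_gen_entryMatrix_of_range_of_ker {M : Matrix (Fin 3) (Fin 3) (ZMod p)}
    {i j : PGIdx p} (hr : LinearMap.range M.mulVecLin = (pointEquiv p i).1)
    (hk : LinearMap.ker M.mulVecLin = (lineEquiv p j).1) :
    UCCVertex.gen M = UCCVertex.gen (entryMatrix (i, j)) := by
  have hrank : M.rank = 1 := by
    change finrank (ZMod p) (LinearMap.range M.mulVecLin) = 1
    rw [hr]
    exact (pointEquiv p i).2
  obtain ⟨x, c, hc, rfl⟩ := exists_eq_smul_entryMatrix hrank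
  have hmul : ∀ v, (c • entryMatrix x) *ᵥ v = (c * (lineVec x.2 ⬝ᵥ v)) • pointVec x.1 := by
    intro v
    rw [smul_mulVec, entryMatrix, vecMulVec_mulVec, op_smul_eq_smul, smul_smul]
  have hi : x.1 = i := by
    obtain ⟨k, hk⟩ := Function.ne_iff.1 (lineVec_ne_zero x.2)
    have hmem : (c • entryMatrix x) *ᵥ Pi.single k 1 ∈ (pointEquiv p i).1 := hr ▸ ⟨_, rfl⟩
    have hk' : c * (lineVec x.2 ⬝ᵥ Pi.single k 1) ≠ 0 := by
      rw [dotProduct_single, mul_one]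
      exact mul_ne_zero hc hk
    rw [hmul, Submodule.smul_mem_iff _ hk'] at hmem
    obtain ⟨d, hd⟩ := Submodule.mem_span_singleton.1 hmem
    exact pointVec_injective_smul hd.symm
  have hj : x.2 = j := by
    have hle : dotKer (lineVec x.2) ≤ dotKer (lineVec j) := by
      intro v hv
      have hv' : v ∈ LinearMap.ker (c • entryMatrix x).mulVecLin := by
        rw [LinearMap.mem_ker, mulVecLin_apply, hmul, mem_dotKer.1 hv, mul_zero, zero_smul]
      rw [hk] at hv'
      exact hv'
    obtain ⟨d, hd⟩ := exists_eq_smul_of_dotKer_le (lineVec_ne_zero _) hle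
    exact (lineVec_injective_smul hd).symm
  obtain rfl : x = (i, j) := Prod.ext hi hj
  apply UCCVertex.subalgebra_injective
  have := adjoin_smul_one_add_smul_entryMatrix (i, j) 0 hc
  rw [zero_smul, zero_add] at this
  rw [UCCVertex.subalgebra_gen, UCCVertex.subalgebra_gen, this]

theorem pointEquiv_le_lineEquiv_iff {i j : PGIdx p} :
    (pointEquiv p i).1 ≤ (lineEquiv p j).1 ↔ lineVec j ⬝ᵥ pointVec i = 0 :=
  Submodule.span_singleton_le_iff_mem _ _

end Adjacency

theorem mainTheorem2 (p : ℕ) [Fact p.Prime] :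
    ∃ (pt : PGIdx p ≃ PGPoint (ZMod p)) (ln : PGIdx p ≃ PGLine (ZMod p))
      (φ : (uccGraph (Matrix (Fin 3) (Fin 3) (ZMod p))).Adj ≃r (constructedGraph p).Adj),
      (∀ i j, ((pt i).1 ≤ (ln j).1 → incMatrix p i j = 1) ∧
        (¬ (pt i).1 ≤ (ln j).1 → incMatrix p i j = 0)) ∧
      (∀ (M : Matrix (Fin 3) (Fin 3) (ZMod p)) (T : VType),
        M.IsOfType T ↔ (φ (UCCVertex.gen M)).vtype = T) ∧
      (∀ (M : Matrix (Fin 3) (Fin 3) (ZMod p)) (i j : PGIdx p),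
        LinearMap.range M.mulVecLin = (pt i).1 → LinearMap.ker M.mulVecLin = (ln j).1 →
          φ (UCCVertex.gen M) = .entry (i, j)) := by
  let φ₀ : UCCVertex (Matrix (Fin 3) (Fin 3) (ZMod p)) ≃ PGVertex p :=
    Equiv.ofFiberEquiv (f := UCCVertex.key) (g := PGVertex.key)
      fun k => (nonempty_fibre_equiv k).some
  have hkey : ∀ v, (φ₀ v).key = v.key := Equiv.ofFiberEquiv_map _
  refine ⟨pointEquiv p, lineEquiv p, ⟨φ₀, fun {v w} => ?_⟩, fun i j => ?_, fun M T => ?_,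
    fun M i j hr hk => ?_⟩
  · rw [constructedGraph_adj_iff, uccGraph_adj_iff, hkey, hkey, φ₀.apply_eq_iff_eq]
  · rw [pointEquiv_le_lineEquiv_iff, incMatrix_eq]
    exact ⟨fun h => if_pos h, fun h => if_neg h⟩
  · obtain ⟨w, hw, hM⟩ := exists_key_eq_and_isOfType M
    have hφ : (φ₀ (UCCVertex.gen M)).vtype = w.vtype :=
      PGVertex.vtype_eq_of_key_eq ((hkey _).trans hw.symm)
    change M.IsOfType T ↔ (φ₀ (UCCVertex.gen M)).vtype = T
    rw [hφ]
    exact ⟨fun hT => hM.unique hT, fun hT => hT ▸ hM⟩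
  · change φ₀ (UCCVertex.gen M) = _
    rw [← PGVertex.key_eq_entry_iff, hkey, gen_eq_gen_entryMatrix_of_range_of_ker hr hk,
      key_gen_entryMatrix]
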